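/- Let $\omega>0$ and $\omega'=i\tau$ with $\tau>0$, let $\wp$ be the Weierstrass function with period lattice $\Lambda=2\omega\mathbb Z+2\omega'\mathbb Z$ and invariant $g_2$, put $e_1=\wp(\omega)$, $e_2=\wp(\omega+\omega')$, $e_3=\wp(\omega')$, and let $V_0(x)=6\wp(x+\omega')$, a potential on the real line with period $2\omega$. A *Bloch solution* with eigenvalue $a\in\mathbb C$ is a nonzero $u:\mathbb R\to\mathbb C$ with $-u''+V_0u=au$ and $u(x+2\omega)=\beta u(x)$ for some constant $\beta$. A real $E$ is *allowed* if there is a Bloch solution with eigenvalue $E$ and $|\beta|=1$; the *band edges* are the boundary points of the set of allowed $E$. For $d\in\mathbb C$, complex numbers $a_1,a_2$ are *factorization constants producing the displacement $d$* if there are Bloch solutions $u_1,u_2$ with eigenvalues $a_1,a_2$ such that, with $W=u_1u_2'-u_1'u_2$, one has $W(x)\neq0$ and $V_0(x)-2(\log W)''(x)=V_0(x+d)$ for every real $x$ at which $V_0(x+d)$ is regular. Then $e_1,e_2,e_3,g_2$ are real, and $V_0$ has exactly five band edges $$E_0=-\sqrt{3g_2}\;<\;E_1=3e_3\;<\;E_{1'}=3e_2\;<\;E_2=3e_1\;<\;E_{2'}=\sqrt{3g_2}.$$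 For $d\in\mathbb C\setminus\Lambda$ put $$a_{1,2}(d)=-\tfrac32\Bigl[\wp(d)\mp\sqrt{g_2-3\wp(d)^2}\,\Bigr]$$ (principal square root). If $a_1(d)\ne a_2(d)$, then $a_1(d),a_2(d)$ are, up to their order, the only factorization constants producing the displacement $d$; if $a_1(d)=a_2(d)$, there are none. Moreover: (i) The three band edges $E_1,E_{1'},E_2$ correspond to the displacements $d=\omega,\ \omega+\omega',\ \omega'$: they are, in pairs, the factorization constants producing these displacements, namely $$(a_1,a_2)(\omega)=(E_{1'},E_1),\qquad (a_1,a_2)(\omega+\omega')=(E_2,E_1),\qquad (a_1,a_2)(\omega')=(E_2,E_{1'}).$$ (ii) The highest band edge $E_{2'}$ is a stationary value of $a_1$ and the lowest band edge $E_0$ is a stationary value of $a_2$: there are $d_1,d_2\in\mathbb C\setminus\Lambda$ such that $a_1$ is complex differentiable at $d_1$ with $a_1(d_1)=\sqrt{3g_2}$, $a_1'(d_1)=0$, and $a_2$ is complex differentiable at $d_2$ with $a_2(d_2)=-\sqrt{3g_2}$, $a_2'(d_2)=0$. -/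

import Mathlib

open Complex

noncomputable section

namespace DarbouxDisplacement

/-- `u` is a (twice differentiable, complex valued) solution on the real line of the Schrödinger
equation `-u'' + V u = a u`. The potential is given on the complex plane; only its values on the
real line enter here. -/
def IsSolution (V : ℂ → ℂ) (a : ℂ) (u : ℝ → ℂ) : Prop :=
  Differentiable ℝ u ∧ Differentiable ℝ (deriv u) ∧
    ∀ x : ℝ, -deriv (deriv u) x + V x * u x = a * u x

/-- `u` is a Bloch solution with multiplier `β` with respect to the real period `T`:
a nonzero solution of `-u'' + V u = a u` with `u (x + T) = β u x`. -/
def IsBlochSolution (V : ℂ → ℂ) (T : ℝ) (a β : ℂ) (u : ℝ → ℂ) : Prop :=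
  IsSolution V a u ∧ u ≠ 0 ∧ ∀ x : ℝ, u (x + T) = β * u x

/-- The allowed energies of a potential of real period `T` (the union of its spectral bands):
the real `E` for which there is a Bloch solution whose multiplier has modulus one. -/
def allowedEnergies (V : ℂ → ℂ) (T : ℝ) : Set ℝ :=
  {E : ℝ | ∃ (β : ℂ) (u : ℝ → ℂ), ‖β‖ = 1 ∧ IsBlochSolution V T E β u}

/-- The band edges: the boundary points of the set of allowed energies. -/
def bandEdges (V : ℂ → ℂ) (T : ℝ) : Set ℝ :=
  frontier (allowedEnergies V T)

/-- The Wronskian `u₁ u₂' - u₁' u₂`. -/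
def wronskian (u₁ u₂ : ℝ → ℂ) (x : ℝ) : ℂ :=
  u₁ x * deriv u₂ x - deriv u₁ x * u₂ x

/-- The second order Darboux transformation with transformation functions `u₁`, `u₂` displaces the
potential by the complex number `d`: `V - 2 (log W)'' = V (· + d)` on the real line, where
`W` is the Wronskian of `u₁` and `u₂`; both sides are considered at the real points `x` for which
`x + d` is not a singularity of `V`, and `W` has to be nonzero there. -/
def DisplacesBy (V : ℂ → ℂ) (d : ℂ) (u₁ u₂ : ℝ → ℂ) : Prop :=
  ∀ x : ℝ, AnalyticAt ℂ V (x + d) →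
    wronskian u₁ u₂ x ≠ 0 ∧
      V x - 2 * deriv (fun y : ℝ => deriv (wronskian u₁ u₂) y / wronskian u₁ u₂ y) x = V (x + d)

/-- `a₁`, `a₂` are the factorization constants of a second order Darboux transformation that
produces the displacement `d`: they are the eigenvalues of two Bloch solutions which, used as
transformation functions, displace the potential by `d`. -/
def AreFactorizationConstants (V : ℂ → ℂ) (T : ℝ) (d a₁ a₂ : ℂ) : Prop :=
  ∃ (β₁ β₂ : ℂ) (u₁ u₂ : ℝ → ℂ), IsBlochSolution V T a₁ β₁ u₁ ∧ IsBlochSolution V T a₂ β₂ u₂ ∧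
    DisplacesBy V d u₁ u₂

/-- The Lamé-Ince potential `V₀ x = 6 ℘ (x + ω')`, `ω' = L.ω₂ / 2` being the second
half-period. -/
def lameInce (L : PeriodPair) (x : ℂ) : ℂ :=
  6 * L.weierstrassP (x + L.ω₂ / 2)

/-- `a₁ (d) = -(3/2) (℘ (d) - √(g₂ - 3 ℘ (d)²))`, with the principal square root. -/
def factorConst₁ (L : PeriodPair) (d : ℂ) : ℂ :=
  -(3 / 2) * (L.weierstrassP d - (L.g₂ - 3 * L.weierstrassP d ^ 2) ^ (1 / 2 : ℂ))

/-- `a₂ (d) = -(3/2) (℘ (d) + √(g₂ - 3 ℘ (d)²))`, with the principal square root. -/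
def factorConst₂ (L : PeriodPair) (d : ℂ) : ℂ :=
  -(3 / 2) * (L.weierstrassP d + (L.g₂ - 3 * L.weierstrassP d ^ 2) ^ (1 / 2 : ℂ))

end DarbouxDisplacement

end

/-! ### Second-order linear equations on the line: uniqueness, global existence, Sturm comparison.
-/

noncomputable section

namespace DarbouxDisplacement

open Set Filter Topology

section LinearODE

/-! Write `p = ℘(x + iτ)`, so that `V₀ = 6p`. Two algebraic devices carry the proof: Hermite's
product of solutions for the band edges, and the chord slope of the addition theorem for the
displacements.

Bands. The quadratic `X = 9p² + 3Ep + E² - 9g₂/4` satisfies the third-order equation for products of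
two solutions of energy `E`, and its first integral `X'²/4 - X X''/2 + X²(V₀ - E)` is a quintic
`P(E)` with roots `±√(3g₂)`, `3e₁`, `3e₂`, `3e₃` (`hermite_first_integral`). Hence `M u = X u' - X'
u / 2` acts on the solution space, commutes with translation by the period, and satisfies `M² =
P(E)`. Its eigenvectors are Bloch solutions (`exists_bloch_eigenvector`). If `P(E) < 0`, the
eigenvalue is imaginary and `|u|²/X` is constant, so the multiplier has modulus one. If `P(E) > 0`,
the eigenvalue is real, and a multiplier of modulus one would be `±1` and shared by all solutions;
then some solution has zeros one period apart, starting anywhere (`exists_solves_zero_zero`). Sturm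
comparison with the solutions at the adjacent edges, whose zeros are zeros of the explicit `X`,
excludes this in each gap.

Displacements. Let `ℓ` be the slope of the chord through the points of the elliptic curve with
parameters `x + iτ` and `d`. The addition theorem gives `ℓ' = ℘(x + iτ) - ℘(x + iτ + d)`, so the
displacement property says `(log W)' = 3(ℓ + κ)` with a constant `κ`. Since `W' = (a₁ - a₂) u₁ u₂`,
an identity between `u₁ u₂`, its first two derivatives and `W` becomes a polynomial equation for `ℓ`
with constant coefficients. As `ℓ` takes infinitely many values, the coefficients vanish, which
fixes `a₁ + a₂` and `(a₁ - a₂)²` (`sum_and_diff_of_displacement`). Conversely, for these `a₁`, `a₂`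
each `X` has the factor `p - ℘(d)`, and the eigenvectors of `M` with suitable signs satisfy `W' =
3ℓW` (`wronskian_relation`).

The special displacements and the stationary values are then evaluations of explicit formulas, using
the ordering of `e₁`, `e₂`, `e₃` and `√(3g₂)`. -/

/-- `u` solves `u'' = Q u` on the real line, with derivative `u'`. -/
def Solves {𝕜 : Type*} [NontriviallyNormedField 𝕜] [NormedAlgebra ℝ 𝕜]
    (Q u u' : ℝ → 𝕜) : Prop :=
  ∀ x, HasDerivAt u (u' x) x ∧ HasDerivAt u' (Q x * u x) x

/-- The first order system belonging to `u'' = q u`. -/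
def companion {𝕜 : Type*} [NontriviallyNormedField 𝕜] (q : 𝕜) (v : 𝕜 × 𝕜) : 𝕜 × 𝕜 :=
  (v.2, q * v.1)

section General

variable {𝕜 : Type*} [NontriviallyNormedField 𝕜]

lemma lipschitzWith_companion {q : 𝕜} {K : NNReal} (hq : ‖q‖ ≤ K) (hK : 1 ≤ K) :
    LipschitzWith K (companion q) := by
  refine LipschitzWith.of_dist_le_mul fun v w => ?_
  rw [dist_eq_norm, dist_eq_norm]
  have h1 : ‖(v - w).1‖ ≤ ‖v - w‖ := norm_fst_le _
  have h2 : ‖(v - w).2‖ ≤ ‖v - w‖ := norm_snd_le _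
  have hK' : (1 : ℝ) ≤ K := by exact_mod_cast hK
  have h0 := norm_nonneg (v - w)
  have : companion q v - companion q w = ((v - w).2, q * (v - w).1) := by
    simp [companion, mul_sub]
  rw [this, Prod.norm_def]
  refine max_le ?_ ?_
  · nlinarith
  · change ‖q * (v - w).1‖ ≤ _
    rw [norm_mul]
    exact mul_le_mul hq h1 (norm_nonneg _) (by positivity)

variable [NormedAlgebra ℝ 𝕜]

lemma Solves.hasDerivAt_prod {Q u u' : ℝ → 𝕜} (h : Solves Q u u') (x : ℝ) :
    HasDerivAt (fun x => (u x, u' x)) (companion (Q x) (u x, u' x)) x :=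
  (h x).1.prodMk (h x).2

lemma Solves.unique {Q u u' v v' : ℝ → 𝕜} (hu : Solves Q u u') (hv : Solves Q v v')
    {K : ℝ} (hK : ∀ x, ‖Q x‖ ≤ K) {x₀ : ℝ} (h0 : u x₀ = v x₀) (h1 : u' x₀ = v' x₀) :
    u = v ∧ u' = v' := by
  have key : (fun x => (u x, u' x)) = (fun x => (v x, v' x)) := by
    refine ODE_solution_unique_univ (v := fun t => companion (Q t)) (s := fun _ => univ)
      (K := (max K 1).toNNReal) (t₀ := x₀) (fun t => ?_) (fun t => ⟨hu.hasDerivAt_prod t, trivial⟩)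
      (fun t => ⟨hv.hasDerivAt_prod t, trivial⟩) (by simp [h0, h1])
    refine (lipschitzWith_companion ?_ ?_).lipschitzOnWith
    · rw [Real.coe_toNNReal _ (by positivity)]
      exact (hK t).trans (le_max_left _ _)
    · rw [← NNReal.coe_le_coe, Real.coe_toNNReal _ (by positivity)]
      exact le_max_right _ _
  constructor
  · funext x; exact congrArg Prod.fst (congrFun key x)
  · funext x; exact congrArg Prod.snd (congrFun key x)

lemma Solves.add {Q u u' v v' : ℝ → 𝕜} (hu : Solves Q u u') (hv : Solves Q v v') :
    Solves Q (fun x => u x + v x) (fun x => u' x + v' x) := fun x =>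
  ⟨(hu x).1.add (hv x).1, ((hu x).2.add (hv x).2).congr_deriv (by ring)⟩

lemma Solves.const_mul {Q u u' : ℝ → 𝕜} (hu : Solves Q u u') (c : 𝕜) :
    Solves Q (fun x => c * u x) (fun x => c * u' x) := fun x =>
  ⟨(hu x).1.const_mul c, ((hu x).2.const_mul c).congr_deriv (by ring)⟩

lemma Solves.zero (Q : ℝ → 𝕜) : Solves Q (fun _ => 0) (fun _ => 0) := fun x =>
  ⟨hasDerivAt_const x 0, by simpa using hasDerivAt_const x (0 : 𝕜)⟩

/-- A solution that vanishes to second order at a point vanishes identically. -/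
lemma Solves.eq_zero {Q u u' : ℝ → 𝕜} (hu : Solves Q u u')
    {K : ℝ} (hK : ∀ x, ‖Q x‖ ≤ K) {x₀ : ℝ} (h0 : u x₀ = 0) (h1 : u' x₀ = 0) (x : ℝ) : u x = 0 :=
  congrFun (hu.unique (Solves.zero Q) hK h0 h1).1 x

lemma Solves.comp_add {Q u u' : ℝ → 𝕜} (hu : Solves Q u u') {T : ℝ} (hQ : ∀ x, Q (x + T) = Q x) :
    Solves Q (fun x => u (x + T)) (fun x => u' (x + T)) := fun x =>
  ⟨(hu (x + T)).1.comp_add_const x T,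
    ((hu (x + T)).2.comp_add_const x T).congr_deriv (by rw [hQ])⟩

lemma Solves.comp_neg {Q u u' : ℝ → 𝕜} (hu : Solves Q u u') (hQ : ∀ x, Q (-x) = Q x) :
    Solves Q (fun x => u (-x)) (fun x => -u' (-x)) := fun x => by
  constructor
  · have := (hu (-x)).1.scomp x (hasDerivAt_neg x)
    simpa [Function.comp_def] using this
  · have := ((hu (-x)).2.scomp x (hasDerivAt_neg x)).fun_neg
    simpa [Function.comp_def, hQ] using this

end General

open ODE in
/-- Global existence for `u'' = Q u` with a bounded continuously differentiable coefficient. -/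
lemma exists_solves {Q : ℝ → ℂ} (hQ : ContDiff ℝ 1 Q) {K : ℝ} (hK : ∀ x, ‖Q x‖ ≤ K)
    (x₀ : ℝ) (a b : ℂ) : ∃ u u' : ℝ → ℂ, Solves Q u u' ∧ u x₀ = a ∧ u' x₀ = b := by
  classical
  set B : ℝ := max K 1 with hB
  have hB1 : 1 ≤ B := le_max_right _ _
  have hBQ : ∀ x, ‖Q x‖ ≤ B := fun x => (hK x).trans (le_max_left _ _)
  have hlip : ∀ t, LipschitzWith B.toNNReal (companion (Q t)) := fun t =>
    lipschitzWith_companion (by rw [Real.coe_toNNReal _ (by positivity)]; exact hBQ t)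
      (by rw [← NNReal.coe_le_coe, Real.coe_toNNReal _ (by positivity)]; exact hB1)
  -- On the ball of radius `a = ‖v₀‖ + 1` about `v₀` the field is bounded by `2aB`. A half-length
  -- `1/(2B)` is therefore admissible for Picard–Lindelöf whatever the initial point, and this
  -- uniformity is what allows continuation to the whole line.
  set ε : ℝ := 1 / (2 * B) with hε
  have hε0 : 0 < ε := by positivity
  -- local existence on an interval of uniform length
  have hloc : ∀ (t₀ : ℝ) (v₀ : ℂ × ℂ), ∃ α : ℝ → ℂ × ℂ, α t₀ = v₀ ∧
      ∀ t ∈ Icc (t₀ - ε) (t₀ + ε), HasDerivWithinAt α (companion (Q t) (α t))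
        (Icc (t₀ - ε) (t₀ + ε)) t := by
    intro t₀ v₀
    have ht₀ : t₀ ∈ Icc (t₀ - ε) (t₀ + ε) := ⟨by linarith, by linarith⟩
    set a : ℝ := ‖v₀‖ + 1 with ha
    have ha0 : 0 ≤ a := by positivity
    have hP : IsPicardLindelof (fun t => companion (Q t)) (⟨t₀, ht₀⟩ : Icc (t₀ - ε) (t₀ + ε)) v₀
        a.toNNReal 0 (B * (2 * a)).toNNReal B.toNNReal := by
      refine ⟨fun t _ => (hlip t).lipschitzOnWith, fun x _ => ?_, fun t _ x hx => ?_, ?_⟩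
      · have : Continuous fun t => companion (Q t) x := by
          unfold companion
          have := hQ.continuous
          fun_prop
        exact this.continuousOn
      · rw [Real.coe_toNNReal _ (by positivity)]
        have h1 := (hlip t).dist_le_mul x 0
        have h2 : companion (Q t) 0 = 0 := by simp [companion]
        rw [h2, dist_zero_right, dist_zero_right, Real.coe_toNNReal _ (by positivity)] at h1
        refine h1.trans (mul_le_mul_of_nonneg_left ?_ (by positivity))
        rw [Metric.mem_closedBall, Real.coe_toNNReal _ ha0, dist_eq_norm] at hx
        have := norm_le_norm_add_norm_sub' x v₀
        linarith
      · rw [Real.coe_toNNReal _ (by positivity), Real.coe_toNNReal _ (by positivity)]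
        simp only [add_sub_cancel_left, sub_sub_cancel, max_self, NNReal.coe_zero, sub_zero]
        rw [hε]
        apply le_of_eq
        field_simp
    exact hP.exists_eq_forall_mem_Icc_hasDerivWithinAt₀
  -- the autonomous field
  let F : ℝ × (ℂ × ℂ) → ℝ × (ℂ × ℂ) := fun y => (1, companion (Q y.1) y.2)
  have hF : ContDiff ℝ 1 F := by
    unfold F companion
    fun_prop
  -- The extension lemma for a uniform existence time concerns autonomous fields; this is why time
  -- was made a coordinate.
  obtain ⟨γ, hγ0, hγ⟩ := exists_isMIntegralCurve_of_isMIntegralCurveOn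
    (I := modelWithCornersSelf ℝ (ℝ × (ℂ × ℂ))) (M := ℝ × (ℂ × ℂ)) (v := F)
    (contMDiff_vectorSpace_iff_contDiff.2 hF) hε0 (fun y => by
      obtain ⟨α, hα0, hα⟩ := hloc y.1 y.2
      refine ⟨fun t => (y.1 + t, α (y.1 + t)), by simp [hα0], fun t ht => ?_⟩
      have h1 : HasDerivAt α (companion (Q (y.1 + t)) (α (y.1 + t))) (y.1 + t) :=
        (hα (y.1 + t) ⟨by linarith [ht.1], by linarith [ht.2]⟩).hasDerivAt
          (Icc_mem_nhds (by linarith [ht.1]) (by linarith [ht.2]))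
      have h2 : HasDerivAt (fun t => (y.1 + t, α (y.1 + t)))
          (F (y.1 + t, α (y.1 + t))) t :=
        ((hasDerivAt_id t).const_add y.1).prodMk (h1.comp_const_add y.1 t)
      exact h2.hasFDerivAt.hasMFDerivAt.hasMFDerivWithinAt) (x₀, (a, b))
  have hγ' : ∀ t, HasDerivAt γ (F (γ t)) t := fun t => by
    have h1 : HasFDerivAt γ ((1 : ℝ →L[ℝ] ℝ).smulRight (F (γ t))) t := (hγ t).hasFDerivAt
    simpa using h1.hasDerivAt
  have hfst : ∀ t, (γ t).1 = x₀ + t := by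
    have h1 : ∀ t, HasDerivAt (fun t => (γ t).1 - t) 0 t := fun t => by
      have := ((hγ' t).hasFDerivAt.fst.hasDerivAt).fun_sub (hasDerivAt_id t)
      simpa [F] using this
    intro t
    have := is_const_of_deriv_eq_zero (fun t => (h1 t).differentiableAt)
      (fun t => (h1 t).deriv) t 0
    simp [hγ0] at this
    linarith
  refine ⟨fun x => (γ (x - x₀)).2.1, fun x => (γ (x - x₀)).2.2, fun x => ?_, by simp [hγ0],
    by simp [hγ0]⟩
  have h1 : HasDerivAt (fun x => γ (x - x₀)) (F (γ (x - x₀))) x :=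
    (hγ' (x - x₀)).comp_sub_const x x₀
  have h2 := h1.hasFDerivAt.snd
  have e : x₀ + (x - x₀) = x := by ring
  constructor
  · have := h2.fst.hasDerivAt
    simpa [F, companion] using this
  · have := h2.snd.hasDerivAt
    simpa [F, companion, hfst, e] using this

/-- The Picone function `s s' - s² v' / v` is continuous at the zeros of `s`. -/
lemma continuousAt_picone {q r s s' v v' : ℝ → ℝ} (hs : Solves q s s') (hv : Solves r v v') {a : ℝ}
    (ha : s a = 0) (hva : v a ≠ 0 ∨ v' a ≠ 0) :
    ContinuousAt (fun x => s x * s' x - s x * (s x * v' x / v x)) a := by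
  have cs := (hs a).1.continuousAt
  have cs' := (hs a).2.continuousAt
  have cv := (hv a).1.continuousAt
  have cv' := (hv a).2.continuousAt
  by_cases h0 : v a = 0
  -- Both functions vanish at `a`, and `v` only to first order, so `s / v` tends to `s' a / v' a`.
  · have h1 : v' a ≠ 0 := hva.resolve_left (not_not.2 h0)
    rw [continuousAt_iff_punctured_nhds]
    have t1 := hasDerivAt_iff_tendsto_slope.1 (hs a).1
    have t2 := hasDerivAt_iff_tendsto_slope.1 (hv a).1
    have c (f : ℝ → ℝ) (hf : ContinuousAt f a) : Tendsto f (𝓝[≠] a) (𝓝 (f a)) :=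
      hf.tendsto.mono_left nhdsWithin_le_nhds
    have t3 := ((c s cs).mul (c s' cs')).sub ((c s cs).mul ((t1.div t2 h1).mul (c v' cv')))
    simp only [ha, zero_mul, sub_zero] at t3 ⊢
    refine t3.congr' ?_
    filter_upwards [self_mem_nhdsWithin] with x hx
    have hxa : x - a ≠ 0 := sub_ne_zero.2 hx
    simp only [slope_def_field, ha, h0, sub_zero, Pi.div_apply]
    rw [div_div_div_cancel_right₀ hxa]
    ring
  · exact (cs.mul cs').sub (cs.mul ((cs.mul cv').div cv h0))

/-- **Sturm comparison**: between two zeros of `s`, where `s'' = q s`, every solution of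
`v'' = r v` with `r < q` has a zero. -/
lemma Solves.exists_zero_of_lt {q r s s' v v' : ℝ → ℝ} (hs : Solves q s s') (hv : Solves r v v')
    (hlt : ∀ x, r x < q x) {K : ℝ} (hq : ∀ x, ‖q x‖ ≤ K) (hr : ∀ x, ‖r x‖ ≤ K)
    (hs0 : ∃ x, s x ≠ 0) {a b : ℝ} (hab : a < b) (ha : s a = 0) (hb : s b = 0) :
    ∃ y ∈ Ioo a b, v y = 0 := by
  by_contra! hne
  have hv0 (x : ℝ) : v x ≠ 0 ∨ v' x ≠ 0 := by
    by_contra! h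
    exact hne ((a + b) / 2) ⟨by linarith, by linarith⟩ (hv.eq_zero hr h.1 h.2 _)
  -- Picone's identity: `h' = (s' - s v'/v)² + (q - r) s² ≥ 0`, while `h` vanishes at both ends. So
  -- `h` is identically zero on the interval, and `q - r > 0` forces `s = 0` there.
  set h : ℝ → ℝ := fun x => s x * s' x - s x * (s x * v' x / v x) with hh
  have hder : ∀ x ∈ Ioo a b, HasDerivAt h
      ((s' x - s x * v' x / v x) ^ 2 + (q x - r x) * s x ^ 2) x := fun x hx => by
    have hvx := hne x hx
    refine (((hs x).1.mul (hs x).2).sub ((hs x).1.mul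
      (((hs x).1.mul (hv x).2).div (hv x).1 hvx))).congr_deriv ?_
    simp only [Pi.mul_apply, Pi.div_apply]
    field_simp
    ring
  have hcont : ContinuousOn h (Icc a b) := fun x hx => by
    rcases eq_or_lt_of_le hx.1 with rfl | h1
    · exact (continuousAt_picone hs hv ha (hv0 _)).continuousWithinAt
    rcases eq_or_lt_of_le hx.2 with rfl | h2
    · exact (continuousAt_picone hs hv hb (hv0 _)).continuousWithinAt
    · exact (hder x ⟨h1, h2⟩).continuousAt.continuousWithinAt
  have hmono : MonotoneOn h (Icc a b) := by
    refine monotoneOn_of_hasDerivWithinAt_nonneg (convex_Icc a b) hcont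
      (f' := fun x => (s' x - s x * v' x / v x) ^ 2 + (q x - r x) * s x ^ 2)
      (fun x hx => ?_) (fun x hx => ?_)
    · rw [interior_Icc] at hx ⊢
      exact (hder x hx).hasDerivWithinAt
    · have := hlt x
      have : 0 < q x - r x := by linarith
      positivity
  have h0 : ∀ x ∈ Icc a b, h x = 0 := fun x hx => by
    have h1 := hmono ⟨le_rfl, hab.le⟩ hx hx.1
    have h2 := hmono hx ⟨hab.le, le_rfl⟩ hx.2
    have h3 : h a = 0 := by simp [hh, ha]
    have h4 : h b = 0 := by simp [hh, hb]
    linarith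
  have hs1 : ∀ x ∈ Ioo a b, s x = 0 := fun x hx => by
    have h1 : HasDerivAt h 0 x := (hasDerivAt_const x (0 : ℝ)).congr_of_eventuallyEq
      (by filter_upwards [Ioo_mem_nhds hx.1 hx.2] with y hy using h0 y ⟨hy.1.le, hy.2.le⟩)
    have h2 := (hder x hx).unique h1
    have h3 := hlt x
    have h4 : (q x - r x) * s x ^ 2 = 0 := by
      have : 0 ≤ (q x - r x) * s x ^ 2 := mul_nonneg (by linarith) (sq_nonneg _)
      nlinarith [sq_nonneg (s' x - s x * v' x / v x)]
    rcases mul_eq_zero.1 h4 with h5 | h5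
    · linarith
    · exact pow_eq_zero_iff two_ne_zero |>.1 h5
  have hm : (a + b) / 2 ∈ Ioo a b := ⟨by linarith, by linarith⟩
  have hs2 : s' ((a + b) / 2) = 0 := by
    refine (hs _).1.unique ((hasDerivAt_const _ (0 : ℝ)).congr_of_eventuallyEq ?_)
    filter_upwards [Ioo_mem_nhds hm.1 hm.2] with y hy using hs1 y hy
  obtain ⟨x, hx⟩ := hs0
  exact hx (hs.eq_zero hq (hs1 _ hm) hs2 x)

end LinearODE

end DarbouxDisplacement

end

/-! ### The Weierstrass function of a general lattice: addition theorem and fibres. -/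

noncomputable section

namespace PeriodPair

open Set Filter Topology

variable (L : PeriodPair)

lemma isOpen_compl_lattice : IsOpen ((L.lattice : Set ℂ)ᶜ) := L.isClosed_lattice.isOpen_compl

lemma countable_lattice : (L.lattice : Set ℂ).Countable :=
  countable_of_Lindelof_of_discrete (X := L.lattice)

lemma isPreconnected_compl_lattice : IsPreconnected ((L.lattice : Set ℂ)ᶜ) :=
  (L.countable_lattice.isConnected_compl_of_one_lt_rank (by simp)).isPreconnected

variable {L}

lemma hasDerivAt_weierstrassP {z : ℂ} (hz : z ∉ L.lattice) :
    HasDerivAt L.weierstrassP (L.derivWeierstrassP z) z := by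
  rw [← L.deriv_weierstrassP]
  exact (L.analyticOnNhd_weierstrassP z hz).differentiableAt.hasDerivAt

variable (L)

lemma tendsto_weierstrassP_zero : Tendsto L.weierstrassP (𝓝[≠] 0) (Bornology.cobounded ℂ) :=
  tendsto_cobounded_of_meromorphicOrderAt_neg (by
    rw [L.order_weierstrassP 0 (zero_mem _)]; decide)

lemma eventually_notMem_lattice_nhdsNE_zero : ∀ᶠ z in 𝓝[≠] (0 : ℂ), z ∉ L.lattice := by
  filter_upwards [self_mem_nhdsWithin,
    mem_nhdsWithin_of_mem_nhds (L.compl_lattice_sdiff_singleton_mem_nhds 0)] with w hw hw'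
  intro h
  exact hw' ⟨h, hw⟩

/-- `℘` is not constant. -/
lemma not_eqOn_weierstrassP_const (c : ℂ) :
    ¬ EqOn L.weierstrassP (fun _ => c) (L.lattice : Set ℂ)ᶜ := by
  intro h
  have h1 : Tendsto (fun _ : ℂ => c) (𝓝[≠] 0) (Bornology.cobounded ℂ) :=
    L.tendsto_weierstrassP_zero.congr' (by
      filter_upwards [L.eventually_notMem_lattice_nhdsNE_zero] with z hz using h hz)
  have h2 : Tendsto (fun _ : ℂ => c) (𝓝[≠] (0 : ℂ)) (𝓝 c) := tendsto_const_nhds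
  exact h1.not_tendsto (Metric.disjoint_nhds_cobounded c).symm h2

lemma not_eventually_weierstrassP_eq_const {z : ℂ} (hz : z ∉ L.lattice) (c : ℂ) :
    ¬ ∀ᶠ w in 𝓝 z, L.weierstrassP w = c := fun h =>
  L.not_eqOn_weierstrassP_const c
    (L.analyticOnNhd_weierstrassP.eqOn_of_preconnected_of_eventuallyEq
      (fun _ _ => analyticAt_const) L.isPreconnected_compl_lattice hz h)

lemma not_eventually_derivWeierstrassP_eq_zero {z : ℂ} (hz : z ∉ L.lattice) :
    ¬ ∀ᶠ w in 𝓝 z, L.derivWeierstrassP w = 0 := fun h => by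
  have h0 : EqOn L.derivWeierstrassP (fun _ => 0) (L.lattice : Set ℂ)ᶜ :=
    L.analyticOnNhd_derivWeierstrassP.eqOn_of_preconnected_of_eventuallyEq
      (fun _ _ => analyticAt_const) L.isPreconnected_compl_lattice hz h
  refine L.not_eqOn_weierstrassP_const (L.weierstrassP z)
    (L.isOpen_compl_lattice.eqOn_of_deriv_eq L.isPreconnected_compl_lattice
      L.differentiableOn_weierstrassP (differentiableOn_const _) (fun w hw => ?_) hz rfl)
  rw [L.deriv_weierstrassP]
  simpa using h0 hw

lemma eventually_derivWeierstrassP_ne_zero {z : ℂ} (hz : z ∉ L.lattice) :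
    ∀ᶠ w in 𝓝[≠] z, L.derivWeierstrassP w ≠ 0 :=
  (L.analyticOnNhd_derivWeierstrassP z hz).eventually_eq_zero_or_eventually_ne_zero.resolve_left
    (L.not_eventually_derivWeierstrassP_eq_zero hz)

variable {L}

/-- `℘'' = 6 ℘² - g₂ / 2`. -/
lemma hasDerivAt_derivWeierstrassP {z : ℂ} (hz : z ∉ L.lattice) :
    HasDerivAt L.derivWeierstrassP (6 * L.weierstrassP z ^ 2 - L.g₂ / 2) z := by
  have hd : ∀ w ∉ L.lattice, HasDerivAt L.derivWeierstrassP (deriv L.derivWeierstrassP w) w :=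
    fun w hw => (L.analyticOnNhd_derivWeierstrassP w hw).differentiableAt.hasDerivAt
  -- Differentiating the cubic relation gives the formula multiplied by `2℘'`. Division is possible
  -- off the isolated zeros of `℘'`, and continuity covers these.
  have key : ∀ w ∉ L.lattice, L.derivWeierstrassP w ≠ 0 →
      deriv L.derivWeierstrassP w = 6 * L.weierstrassP w ^ 2 - L.g₂ / 2 := fun w hw hw0 => by
    have h1 : HasDerivAt (fun z => L.derivWeierstrassP z ^ 2) _ w := (hd w hw).pow 2
    have hp := hasDerivAt_weierstrassP hw
    have h2 : HasDerivAt (fun z => 4 * L.weierstrassP z ^ 3 - L.g₂ * L.weierstrassP z - L.g₃) _ w :=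
      (((hp.pow 3).const_mul 4).sub (hp.const_mul L.g₂)).sub_const L.g₃
    have h3 := h1.unique (h2.congr_of_eventuallyEq (by
      filter_upwards [L.isOpen_compl_lattice.mem_nhds hw] with v hv using
        L.derivWeierstrassP_sq v hv))
    apply mul_left_cancel₀ hw0
    norm_num at h3
    linear_combination h3 / 2
  have hcd : ContinuousAt (deriv L.derivWeierstrassP) z :=
    (L.analyticOnNhd_derivWeierstrassP z hz).deriv.continuousAt
  have hcp : ContinuousAt (fun w => 6 * L.weierstrassP w ^ 2 - L.g₂ / 2) z := by
    have := (hasDerivAt_weierstrassP hz).continuousAt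
    fun_prop
  have heq : deriv L.derivWeierstrassP z = 6 * L.weierstrassP z ^ 2 - L.g₂ / 2 := by
    refine tendsto_nhds_unique (hcd.tendsto.mono_left nhdsWithin_le_nhds)
      ((hcp.tendsto.mono_left nhdsWithin_le_nhds).congr' ?_ : Tendsto _ (𝓝[≠] z) _)
    filter_upwards [L.eventually_derivWeierstrassP_ne_zero hz,
      mem_nhdsWithin_of_mem_nhds (L.isOpen_compl_lattice.mem_nhds hz)] with w h1 h2
    exact (key w h2 h1).symm
  rw [← heq]
  exact hd z hz

/-- The slope function `½ (℘' z - ℘' w) / (℘ z - ℘ w)` of the addition theorem. -/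
def chord (L : PeriodPair) (z w : ℂ) : ℂ :=
  (L.derivWeierstrassP z - L.derivWeierstrassP w) / (2 * (L.weierstrassP z - L.weierstrassP w))

/-- A Riccati equation for the slope, which needs only the cubic relation at both points. By the
addition theorem its right side is `℘ z - ℘ (z + w)` when `z + w` is off the lattice. -/
lemma hasDerivAt_chord_left {z w : ℂ} (hz : z ∉ L.lattice) (hw : w ∉ L.lattice)
    (h : L.weierstrassP z ≠ L.weierstrassP w) :
    HasDerivAt (fun z => L.chord z w)
      (2 * L.weierstrassP z + L.weierstrassP w - L.chord z w ^ 2) z := by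
  have h' : L.weierstrassP z - L.weierstrassP w ≠ 0 := sub_ne_zero.2 h
  refine (((hasDerivAt_derivWeierstrassP hz).sub_const _).div
    (((hasDerivAt_weierstrassP hz).sub_const _).const_mul 2)
    (mul_ne_zero two_ne_zero h')).congr_deriv ?_
  unfold chord
  field_simp
  linear_combination L.derivWeierstrassP_sq w hw - L.derivWeierstrassP_sq z hz

lemma hasDerivAt_const_sub {f : ℂ → ℂ} {f' c z : ℂ} (h : HasDerivAt f f' (c - z)) :
    HasDerivAt (fun z => f (c - z)) (-f') z := by
  simpa [Function.comp_def] using h.scomp z ((hasDerivAt_id z).const_sub c)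

/-- The slope is differentiated with the sum of the two parameters held fixed, in preparation for
the addition theorem. -/
lemma hasDerivAt_chord_const_sub {z c : ℂ} (hz : z ∉ L.lattice) (hw : c - z ∉ L.lattice)
    (h : L.weierstrassP z ≠ L.weierstrassP (c - z)) :
    HasDerivAt (fun z => L.chord z (c - z)) (L.weierstrassP z - L.weierstrassP (c - z)) z := by
  have h' : L.weierstrassP z - L.weierstrassP (c - z) ≠ 0 := sub_ne_zero.2 h
  refine (((hasDerivAt_derivWeierstrassP hz).sub
    (hasDerivAt_const_sub (hasDerivAt_derivWeierstrassP hw))).div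
    (((hasDerivAt_weierstrassP hz).sub (hasDerivAt_const_sub
      (hasDerivAt_weierstrassP hw))).const_mul 2) (mul_ne_zero two_ne_zero h')).congr_deriv ?_
  simp only [Pi.sub_apply]
  field_simp
  linear_combination 2 * L.derivWeierstrassP_sq _ hw - 2 * L.derivWeierstrassP_sq z hz

/-- The addition theorem up to its constant: with `w = c - z`, the square of the slope contributes
`2λ(℘ z - ℘ w) = ℘' z - ℘' w`, which is exactly the derivative of `℘ z + ℘ (c - z)`. -/
lemma hasDerivAt_chord_sq_sub {z c : ℂ} (hz : z ∉ L.lattice) (hw : c - z ∉ L.lattice)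
    (h : L.weierstrassP z ≠ L.weierstrassP (c - z)) :
    HasDerivAt (fun z => L.chord z (c - z) ^ 2 - L.weierstrassP z - L.weierstrassP (c - z))
      0 z := by
  have h' : L.weierstrassP z - L.weierstrassP (c - z) ≠ 0 := sub_ne_zero.2 h
  refine ((((hasDerivAt_chord_const_sub hz hw h).fun_pow 2).sub (hasDerivAt_weierstrassP hz)).sub
    (hasDerivAt_const_sub (hasDerivAt_weierstrassP hw))).congr_deriv ?_
  have e : L.chord z (c - z) * (L.weierstrassP z - L.weierstrassP (c - z)) =
      (L.derivWeierstrassP z - L.derivWeierstrassP (c - z)) / 2 := by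
    unfold chord
    field_simp
  norm_num
  linear_combination 2 * e

/-- The limit at the origin that fixes the constant in the addition theorem. -/
lemma tendsto_chord_sq_sub {c : ℂ} (hc : c ∉ L.lattice) :
    Tendsto (fun z => L.chord z (c - z) ^ 2 - L.weierstrassP z - L.weierstrassP (c - z))
      (𝓝[≠] 0) (𝓝 (L.weierstrassP c)) := by
  set P : ℂ → ℂ := L.weierstrassPExcept 0
  set P' : ℂ → ℂ := L.derivWeierstrassPExcept 0
  have hP : ∀ z, L.weierstrassP z = P z + 1 / z ^ 2 := fun z => by
    have := L.weierstrassPExcept_add 0 z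
    simp only [ZeroMemClass.coe_zero, sub_zero] at this
    rw [← this]
    simp [P]
  have hP' : ∀ z, L.derivWeierstrassP z = P' z - 2 / z ^ 3 := fun z => by
    have := L.derivWeierstrassPExcept_sub 0 z
    simp only [ZeroMemClass.coe_zero, sub_zero] at this
    exact this.symm
  have hc0 : c - 0 ∉ L.lattice := by simpa using hc
  have cP : ContinuousAt P 0 := (L.analyticAt_weierstrassPExcept 0).continuousAt
  have cP' : ContinuousAt P' 0 := (L.analyticAt_derivWeierstrassPExcept 0).continuousAt
  have cD : ContinuousAt (fun z => L.weierstrassP (c - z)) 0 :=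
    (hasDerivAt_const_sub (hasDerivAt_weierstrassP hc0)).continuousAt
  have cE : ContinuousAt (fun z => L.derivWeierstrassP (c - z)) 0 :=
    (hasDerivAt_const_sub (hasDerivAt_derivWeierstrassP hc0)).continuousAt
  -- With the poles `1/z²` and `-2/z³` split off, the slope is `(z³G - 2) / (2z(1 + z²H))`. The
  -- double pole of its square cancels that of `℘ z`, and the remainder is continuous at the origin
  -- with value `-2H(0) - ℘ c = ℘ c`.
  set G : ℂ → ℂ := fun z => P' z - L.derivWeierstrassP (c - z) with hG
  set H : ℂ → ℂ := fun z => P z - L.weierstrassP (c - z) with hH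
  have cG : ContinuousAt G 0 := cP'.sub cE
  have cH : ContinuousAt H 0 := cP.sub cD
  have c1 : ContinuousAt (fun z => 1 + z ^ 2 * H z) 0 := by fun_prop
  have cF : ContinuousAt (fun z => ((z ^ 4 * G z ^ 2 - 4 * z * G z - 8 * H z - 4 * z ^ 2 * H z ^ 2) / 4)
      / (1 + z ^ 2 * H z) ^ 2 - P z - L.weierstrassP (c - z)) 0 := by
    refine ((ContinuousAt.div₀ ?_ (c1.pow 2) (by simp)).sub cP).sub cD
    fun_prop
  have hF := cF.tendsto.mono_left (nhdsWithin_le_nhds (s := {0}ᶜ))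
  have hP0 : P 0 = 0 := by simp [P]
  have e0 : ((0 ^ 4 * G 0 ^ 2 - 4 * 0 * G 0 - 8 * H 0 - 4 * 0 ^ 2 * H 0 ^ 2) / 4)
      / (1 + 0 ^ 2 * H 0) ^ 2 - P 0 - L.weierstrassP (c - 0) = L.weierstrassP c := by
    simp only [hH, hP0, sub_zero]
    ring
  rw [e0] at hF
  refine hF.congr' ?_
  filter_upwards [self_mem_nhdsWithin, mem_nhdsWithin_of_mem_nhds (c1.eventually_ne (y := 0) (by simp))]
    with z hz h1
  have hz0 : z ≠ 0 := hz
  have e1 : L.chord z (c - z) = (z ^ 3 * G z - 2) / (2 * z * (1 + z ^ 2 * H z)) := by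
    unfold chord
    have e2 : L.derivWeierstrassP z - L.derivWeierstrassP (c - z) = (z ^ 3 * G z - 2) / z ^ 3 := by
      rw [hP', hG]
      field_simp
      ring
    have e3 : L.weierstrassP z - L.weierstrassP (c - z) = (1 + z ^ 2 * H z) / z ^ 2 := by
      rw [hP, hH]
      field_simp
      ring
    rw [e2, e3]
    field_simp
  rw [e1, hP z]
  field_simp
  ring

/-- The **addition theorem** for `℘`. -/
theorem weierstrassP_addition {z w : ℂ} (hz : z ∉ L.lattice) (hw : w ∉ L.lattice)
    (hzw : z + w ∉ L.lattice) :
    (L.derivWeierstrassP z - L.derivWeierstrassP w) ^ 2 =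
      4 * (L.weierstrassP z - L.weierstrassP w) ^ 2 *
        (L.weierstrassP z + L.weierstrassP w + L.weierstrassP (z + w)) := by
  obtain ⟨c, rfl⟩ : ∃ c, w = c - z := ⟨z + w, by ring⟩
  rw [add_sub_cancel] at hzw ⊢
  set U : Set ℂ := ((L.lattice : Set ℂ) ∪ (fun z => c - z) ⁻¹' (L.lattice : Set ℂ))ᶜ with hU
  have hUc : IsPreconnected U := by
    refine (Set.Countable.isConnected_compl_of_one_lt_rank (by simp) ?_).isPreconnected
    exact L.countable_lattice.union (L.countable_lattice.preimage (sub_right_injective))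
  have hUm : ∀ z, z ∈ U ↔ z ∉ L.lattice ∧ c - z ∉ L.lattice := fun z => by simp [hU]
  have hev : ∀ᶠ z in 𝓝[≠] (0 : ℂ), z ∉ L.lattice ∧ c - z ∉ L.lattice ∧
      L.weierstrassP z ≠ L.weierstrassP (c - z) := by
    have hc0 : c - 0 ∉ L.lattice := by simpa using hzw
    have hcont : ContinuousAt (fun z => L.weierstrassP (c - z)) 0 :=
      (hasDerivAt_const_sub (hasDerivAt_weierstrassP hc0)).continuousAt
    have h1 : ∀ᶠ z in 𝓝[≠] (0 : ℂ), c - z ∉ L.lattice := by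
      refine mem_nhdsWithin_of_mem_nhds ?_
      have : ContinuousAt (fun z : ℂ => c - z) 0 := by fun_prop
      exact this.preimage_mem_nhds (L.isOpen_compl_lattice.mem_nhds hc0)
    have h2 : ∀ᶠ z in 𝓝[≠] (0 : ℂ), ‖L.weierstrassP (c - z)‖ < ‖L.weierstrassP (c - 0)‖ + 1 :=
      mem_nhdsWithin_of_mem_nhds (hcont.norm.eventually_lt_const (by linarith))
    have h3 : ∀ᶠ z in 𝓝[≠] (0 : ℂ), ‖L.weierstrassP (c - 0)‖ + 1 < ‖L.weierstrassP z‖ :=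
      (tendsto_norm_cobounded_atTop.comp L.tendsto_weierstrassP_zero).eventually_gt_atTop _
    filter_upwards [L.eventually_notMem_lattice_nhdsNE_zero, h1, h2, h3] with z a1 a2 a3 a4
    refine ⟨a1, a2, fun h => ?_⟩
    rw [h] at a4
    linarith
  obtain ⟨r, hr, hball⟩ := Metric.mem_nhdsWithin_iff.1 hev
  -- A ball on which the slope is regular and whose closure contains the origin: there the
  -- expression is constant and its value can be read off from the limit.
  set B : Set ℂ := Metric.ball ((r / 2 : ℝ) : ℂ) (r / 2) with hB
  have hBsub : ∀ z ∈ B, z ∉ L.lattice ∧ c - z ∉ L.lattice ∧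
      L.weierstrassP z ≠ L.weierstrassP (c - z) := fun z hz => by
    apply hball
    rw [hB, Metric.mem_ball, dist_eq_norm] at hz
    refine ⟨?_, fun h0 => ?_⟩
    · rw [Metric.mem_ball, dist_zero_right]
      have h1 := norm_le_norm_add_norm_sub' z ((r / 2 : ℝ) : ℂ)
      have h2 : ‖((r / 2 : ℝ) : ℂ)‖ = r / 2 := by
        rw [Complex.norm_real, Real.norm_of_nonneg (by positivity)]
      linarith
    · rw [mem_singleton_iff] at h0
      rw [h0, zero_sub, norm_neg, Complex.norm_real, Real.norm_of_nonneg (by positivity)] at hz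
      exact lt_irrefl _ hz
  set F : ℂ → ℂ := fun z => L.chord z (c - z) ^ 2 - L.weierstrassP z - L.weierstrassP (c - z)
  have hFd : ∀ z ∈ B, HasDerivAt F 0 z := fun z hz =>
    hasDerivAt_chord_sq_sub (hBsub z hz).1 (hBsub z hz).2.1 (hBsub z hz).2.2
  have hm : ((r / 2 : ℝ) : ℂ) ∈ B := Metric.mem_ball_self (by positivity)
  have hFc : ∀ z ∈ B, F z = F ((r / 2 : ℝ) : ℂ) := fun z hz =>
    Metric.isOpen_ball.is_const_of_deriv_eq_zero (convex_ball _ _).isPreconnected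
      (fun z hz => (hFd z hz).differentiableAt.differentiableWithinAt)
      (fun z hz => (hFd z hz).deriv) hz hm
  have h0cl : (𝓝[B] (0 : ℂ)).NeBot := by
    rw [← mem_closure_iff_nhdsWithin_neBot, hB, closure_ball _ (by positivity),
      Metric.mem_closedBall, dist_eq_norm, zero_sub, norm_neg, Complex.norm_real,
      Real.norm_of_nonneg (by positivity)]
  have h0B : (0 : ℂ) ∉ B := fun h => (hBsub 0 h).1 (zero_mem _)
  have hval : F ((r / 2 : ℝ) : ℂ) = L.weierstrassP c := by
    have t1 : Tendsto F (𝓝[B] 0) (𝓝 (L.weierstrassP c)) :=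
      (tendsto_chord_sq_sub hzw).mono_left (nhdsWithin_mono _ (fun z hz h => h0B (by
        rw [mem_singleton_iff] at h; rwa [h] at hz)))
    refine tendsto_nhds_unique (tendsto_const_nhds.congr' ?_) t1
    filter_upwards [self_mem_nhdsWithin] with z hz using (hFc z hz).symm
  have hL := L.analyticOnNhd_weierstrassP
  have hL' := L.analyticOnNhd_derivWeierstrassP
  have hsub : AnalyticOnNhd ℂ (fun z => c - z) U := fun z _ => by fun_prop
  have a1 : AnalyticOnNhd ℂ L.weierstrassP U := hL.mono fun z hz => ((hUm z).1 hz).1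
  have a2 : AnalyticOnNhd ℂ L.derivWeierstrassP U := hL'.mono fun z hz => ((hUm z).1 hz).1
  have a3 : AnalyticOnNhd ℂ (fun z => L.weierstrassP (c - z)) U :=
    hL.comp hsub fun z hz => ((hUm z).1 hz).2
  have a4 : AnalyticOnNhd ℂ (fun z => L.derivWeierstrassP (c - z)) U :=
    hL'.comp hsub fun z hz => ((hUm z).1 hz).2
  -- With denominators cleared, both sides are analytic also where `℘ z = ℘ (c - z)`, so the
  -- identity theorem applies on all of `U`.
  have hk := AnalyticOnNhd.eqOn_of_preconnected_of_eventuallyEq ((a2.sub a4).pow 2)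
    ((analyticOnNhd_const (v := (4 : ℂ))).mul ((a1.sub a3).pow 2) |>.mul
      ((a1.add a3).add (analyticOnNhd_const (v := L.weierstrassP c)))) hUc
    ((hUm _).2 ⟨(hBsub _ hm).1, (hBsub _ hm).2.1⟩) (by
      filter_upwards [Metric.isOpen_ball.mem_nhds hm] with z hz
      have h1 : F z = L.weierstrassP c := (hFc z hz).trans hval
      have h2 : L.weierstrassP z - L.weierstrassP (c - z) ≠ 0 := sub_ne_zero.2 (hBsub z hz).2.2
      simp only [F, chord] at h1
      simp only [Pi.pow_apply, Pi.sub_apply, Pi.add_apply]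
      field_simp at h1
      linear_combination h1)
  exact hk ((hUm z).2 ⟨hz, hw⟩)

/-- Two points with the same `℘`-value agree up to sign modulo the lattice. -/
theorem sub_mem_or_add_mem_of_weierstrassP_eq {z w : ℂ} (hz : z ∉ L.lattice) (hw : w ∉ L.lattice)
    (h : L.weierstrassP z = L.weierstrassP w) : z - w ∈ L.lattice ∨ z + w ∈ L.lattice := by
  by_contra! hne
  -- The addition theorem for `z + w` and for `z - w` makes `℘' z` equal to both `℘' w` and `-℘' w`.
  have key : ∀ z w, z ∉ L.lattice → w ∉ L.lattice → L.weierstrassP z = L.weierstrassP w →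
      z - w ∉ L.lattice → z + w ∉ L.lattice → L.derivWeierstrassP w = 0 := by
    intro z w hz hw h h1 h2
    have hw' : -w ∉ L.lattice := fun hh => hw (by simpa using neg_mem hh)
    have e1 := weierstrassP_addition hz hw h2
    have e2 := weierstrassP_addition hz hw' (by rwa [← sub_eq_add_neg])
    rw [weierstrassP_neg, derivWeierstrassP_neg] at e2
    rw [h, sub_self, zero_pow two_ne_zero, mul_zero, zero_mul] at e1 e2
    have e1' := pow_eq_zero_iff two_ne_zero |>.1 e1
    have e2' := pow_eq_zero_iff two_ne_zero |>.1 e2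
    linear_combination (e2' - e1') / 2
  -- By the open mapping theorem a coincidence of values at `(z, w)` persists: every `w'` near `w`
  -- has a partner near `z`. Then `℘'` would vanish on a neighbourhood of `w`, although its zeros
  -- are isolated.
  have hopen : 𝓝 (L.weierstrassP z) ≤ map L.weierstrassP (𝓝 z) :=
    (L.analyticOnNhd_weierstrassP z hz).eventually_constant_or_nhds_le_map_nhds.resolve_left
      (L.not_eventually_weierstrassP_eq_const hz _)
  have hO : IsOpen {p : ℂ × ℂ | p.1 ∉ L.lattice ∧ p.2 ∉ L.lattice ∧ p.1 - p.2 ∉ L.lattice ∧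
      p.1 + p.2 ∉ L.lattice} := by
    have hl := L.isOpen_compl_lattice
    exact (hl.preimage continuous_fst).inter ((hl.preimage continuous_snd).inter
      ((hl.preimage (continuous_fst.sub continuous_snd)).inter
        (hl.preimage (continuous_fst.add continuous_snd))))
  have hN := hO.mem_nhds (show (z, w) ∈ _ from ⟨hz, hw, hne.1, hne.2⟩)
  rw [nhds_prod_eq] at hN
  obtain ⟨A, hA, B, hB, hAB⟩ := Filter.mem_prod_iff.1 hN
  have h1 : L.weierstrassP '' A ∈ 𝓝 (L.weierstrassP w) := by
    rw [← h]
    exact hopen (image_mem_map hA)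
  have h2 : ∀ᶠ w' in 𝓝 w, L.weierstrassP w' ∈ L.weierstrassP '' A :=
    (hasDerivAt_weierstrassP hw).continuousAt h1
  have h3 : ∀ᶠ w' in 𝓝[≠] w, L.weierstrassP w' ∈ L.weierstrassP '' A ∧ w' ∈ B :=
    mem_nhdsWithin_of_mem_nhds (h2.and hB)
  obtain ⟨w', ⟨⟨z', hz', hzw⟩, hw'⟩, hd⟩ :=
    (h3.and (L.eventually_derivWeierstrassP_ne_zero hw)).exists
  obtain ⟨b1, b2, b3, b4⟩ := hAB (show (z', w') ∈ A ×ˢ B from ⟨hz', hw'⟩)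
  exact hd (key z' w' b1 b2 hzw b3 b4)

lemma derivWeierstrassP_eq_zero_of_two_mul_mem {h : ℂ} (hh : 2 * h ∈ L.lattice) :
    L.derivWeierstrassP h = 0 := by
  have e1 := L.derivWeierstrassP_add_coe (-h) ⟨2 * h, hh⟩
  have e2 : -h + 2 * h = h := by ring
  simp only [e2, derivWeierstrassP_neg] at e1
  linear_combination e1 / 2

end PeriodPair

end

/-! ### Rectangular lattices: reality, the order of `e₁`, `e₂`, `e₃`, and `℘` on the line `ℝ + iτ`.
-/

noncomputable section

namespace PeriodPair

open Set Filter Topology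
open scoped ComplexConjugate

/-- `L` is the rectangular lattice with half periods `ω > 0` and `i τ`, `τ > 0`. -/
structure IsRect (L : PeriodPair) (ω τ : ℝ) : Prop where
  ω_pos : 0 < ω
  τ_pos : 0 < τ
  ω₁_eq : L.ω₁ = 2 * (ω : ℂ)
  ω₂_eq : L.ω₂ = 2 * ((τ : ℂ) * I)

namespace IsRect

variable {L : PeriodPair} {ω τ : ℝ} (R : L.IsRect ω τ)
include R

lemma mem_lattice_iff (x y : ℝ) :
    (x : ℂ) + y * I ∈ L.lattice ↔ (∃ m : ℤ, x = 2 * m * ω) ∧ ∃ n : ℤ, y = 2 * n * τ := by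
  rw [PeriodPair.mem_lattice, R.ω₁_eq, R.ω₂_eq]
  constructor
  · rintro ⟨m, n, h⟩
    have h1 := congrArg Complex.re h
    have h2 := congrArg Complex.im h
    simp at h1 h2
    exact ⟨⟨m, by linarith⟩, ⟨n, by linarith⟩⟩
  · rintro ⟨⟨m, rfl⟩, ⟨n, rfl⟩⟩
    exact ⟨m, n, by push_cast; ring⟩

lemma notMem_of_re {x y : ℝ} (h : ∀ m : ℤ, x ≠ 2 * m * ω) : (x : ℂ) + y * I ∉ L.lattice :=
  fun hh => by
    obtain ⟨⟨m, hm⟩, _⟩ := (R.mem_lattice_iff x y).1 hh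
    exact h m hm

lemma notMem_of_im {x y : ℝ} (h : ∀ n : ℤ, y ≠ 2 * n * τ) : (x : ℂ) + y * I ∉ L.lattice :=
  fun hh => by
    obtain ⟨_, ⟨m, hm⟩⟩ := (R.mem_lattice_iff x y).1 hh
    exact h m hm

omit R in
lemma ne_two_mul_int_mul {a t : ℝ} (ha : 0 < a) (h0 : 0 < t) (h1 : t < 2 * a) (m : ℤ) :
    t ≠ 2 * m * a := by
  rintro rfl
  have h2 : (0 : ℝ) < m := by
    by_contra! h
    nlinarith
  have h3 : (m : ℝ) < 1 := by
    by_contra! h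
    nlinarith
  have h4 : 0 < m := by exact_mod_cast h2
  have h5 : m < 1 := by exact_mod_cast h3
  omega

lemma two_ω_mem : 2 * (ω : ℂ) ∈ L.lattice := R.ω₁_eq ▸ L.ω₁_mem_lattice

lemma two_τ_mem : 2 * ((τ : ℂ) * I) ∈ L.lattice := R.ω₂_eq ▸ L.ω₂_mem_lattice

lemma conj_mem {z : ℂ} (hz : z ∈ L.lattice) : conj z ∈ L.lattice := by
  rw [← re_add_im z] at hz
  obtain ⟨h1, n, hn⟩ := (R.mem_lattice_iff z.re z.im).1 hz
  have : conj z = ((z.re : ℝ) : ℂ) + ((-z.im : ℝ) : ℂ) * I := by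
    apply Complex.ext <;> simp
  rw [this, R.mem_lattice_iff]
  exact ⟨h1, -n, by push_cast; linarith⟩

/-- Complex conjugation as a permutation of the lattice. -/
def conjEquiv : L.lattice ≃ L.lattice where
  toFun l := ⟨conj l.1, R.conj_mem l.2⟩
  invFun l := ⟨conj l.1, R.conj_mem l.2⟩
  left_inv l := by simp
  right_inv l := by simp

lemma weierstrassP_conj (z : ℂ) : L.weierstrassP (conj z) = conj (L.weierstrassP z) := by
  simp only [weierstrassP]
  rw [Complex.conj_tsum, ← R.conjEquiv.tsum_eq]
  congr with l
  simp [conjEquiv]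

lemma derivWeierstrassP_conj (z : ℂ) :
    L.derivWeierstrassP (conj z) = conj (L.derivWeierstrassP z) := by
  simp only [derivWeierstrassP]
  rw [map_neg, Complex.conj_tsum, ← R.conjEquiv.tsum_eq]
  congr 2 with l
  simp [conjEquiv, map_ofNat]

omit R in
lemma weierstrassP_add_mem {l : ℂ} (hl : l ∈ L.lattice) (z : ℂ) :
    L.weierstrassP (z + l) = L.weierstrassP z := L.weierstrassP_add_coe z ⟨l, hl⟩

omit R in
lemma derivWeierstrassP_add_mem {l : ℂ} (hl : l ∈ L.lattice) (z : ℂ) :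
    L.derivWeierstrassP (z + l) = L.derivWeierstrassP z := L.derivWeierstrassP_add_coe z ⟨l, hl⟩

omit R in
lemma ofReal_re_of_conj {z : ℂ} (h : conj z = z) : ((z.re : ℝ) : ℂ) = z :=
  Complex.conj_eq_iff_re.1 h

lemma real_axis (x : ℝ) : ((L.weierstrassP x).re : ℂ) = L.weierstrassP x :=
  ofReal_re_of_conj (by rw [← R.weierstrassP_conj, conj_ofReal])

lemma imag_axis (y : ℝ) : ((L.weierstrassP (y * I)).re : ℂ) = L.weierstrassP (y * I) :=
  ofReal_re_of_conj (by
    rw [← R.weierstrassP_conj, map_mul, conj_ofReal, conj_I, mul_neg, weierstrassP_neg])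

omit R in
lemma conj_shifted (x : ℝ) : conj ((x : ℂ) + τ * I) + 2 * (τ * I) = x + τ * I := by
  apply Complex.ext <;> simp; ring

lemma shifted_axis (x : ℝ) :
    ((L.weierstrassP (x + τ * I)).re : ℂ) = L.weierstrassP (x + τ * I) :=
  ofReal_re_of_conj (by
    rw [← R.weierstrassP_conj, ← weierstrassP_add_mem R.two_τ_mem, conj_shifted])

lemma shifted_axis_deriv (x : ℝ) :
    ((L.derivWeierstrassP (x + τ * I)).re : ℂ) = L.derivWeierstrassP (x + τ * I) :=
  ofReal_re_of_conj (by
    rw [← R.derivWeierstrassP_conj, ← derivWeierstrassP_add_mem R.two_τ_mem, conj_shifted])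

lemma vertical_axis (y : ℝ) :
    ((L.weierstrassP (ω + y * I)).re : ℂ) = L.weierstrassP (ω + y * I) :=
  ofReal_re_of_conj (by
    rw [← R.weierstrassP_conj, ← weierstrassP_neg, ← weierstrassP_add_mem R.two_ω_mem]
    congr 1
    apply Complex.ext <;> simp; ring)

lemma shifted_notMem (x : ℝ) : (x : ℂ) + τ * I ∉ L.lattice :=
  R.notMem_of_im (ne_two_mul_int_mul R.τ_pos R.τ_pos (by linarith [R.τ_pos]))

lemma vertical_notMem (y : ℝ) : (ω : ℂ) + y * I ∉ L.lattice :=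
  R.notMem_of_re (ne_two_mul_int_mul R.ω_pos R.ω_pos (by linarith [R.ω_pos]))

lemma real_notMem {x : ℝ} (h0 : 0 < x) (h1 : x ≤ ω) : (x : ℂ) ∉ L.lattice := by
  have := R.notMem_of_re (y := 0)
    (ne_two_mul_int_mul R.ω_pos h0 (by linarith [R.ω_pos]))
  simpa using this

lemma imag_notMem {y : ℝ} (h0 : 0 < y) (h1 : y ≤ τ) : (y : ℂ) * I ∉ L.lattice := by
  have := R.notMem_of_im (x := 0)
    (ne_two_mul_int_mul R.τ_pos h0 (by linarith [R.τ_pos]))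
  simpa using this

lemma ω_notMem : (ω : ℂ) ∉ L.lattice := R.real_notMem R.ω_pos le_rfl

lemma corner_notMem : (ω : ℂ) + τ * I ∉ L.lattice := R.shifted_notMem ω

lemma τ_notMem : (τ : ℂ) * I ∉ L.lattice := R.imag_notMem R.τ_pos le_rfl

end IsRect

/-- `e₁ = ℘ (ω)`, as a real number. -/
def e₁ (L : PeriodPair) (ω : ℝ) : ℝ := (L.weierstrassP ω).re

/-- `e₂ = ℘ (ω + i τ)`, as a real number. -/
def e₂ (L : PeriodPair) (ω τ : ℝ) : ℝ := (L.weierstrassP (ω + τ * I)).re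

/-- `e₃ = ℘ (i τ)`, as a real number. -/
def e₃ (L : PeriodPair) (τ : ℝ) : ℝ := (L.weierstrassP (τ * I)).re

lemma exists_bound_weierstrassP_sub_inv_sq (L : PeriodPair) :
    ∃ r > 0, ∀ z : ℂ, ‖z‖ < r → ‖L.weierstrassP z - 1 / z ^ 2‖ < 1 := by
  have cP : ContinuousAt (L.weierstrassPExcept 0) 0 :=
    (L.analyticAt_weierstrassPExcept 0).continuousAt
  have h1 : ∀ᶠ z in 𝓝 (0 : ℂ), ‖L.weierstrassPExcept 0 z‖ < 1 :=
    cP.norm.eventually_lt_const (by simp)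
  obtain ⟨r, hr, h⟩ := Metric.eventually_nhds_iff.1 h1
  refine ⟨r, hr, fun z hz => ?_⟩
  have h2 := L.weierstrassPExcept_def 0 z
  simp only [ZeroMemClass.coe_zero, sub_zero] at h2
  have h3 := h (y := z) (by simpa using hz)
  rw [h2] at h3
  convert h3 using 2
  simp
  ring

namespace IsRect

variable {L : PeriodPair} {ω τ : ℝ} (R : L.IsRect ω τ)
include R

lemma ofReal_e₁ : (L.e₁ ω : ℂ) = L.weierstrassP ω := R.real_axis ω
lemma ofReal_e₂ : (L.e₂ ω τ : ℂ) = L.weierstrassP (ω + τ * I) := R.shifted_axis ω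
lemma ofReal_e₃ : (L.e₃ τ : ℂ) = L.weierstrassP (τ * I) := R.imag_axis τ

/-- Large real values of `℘` are attained on the positive real axis. -/
lemma exists_real_axis {t : ℝ} (ht : L.e₁ ω < t) :
    ∃ x : ℝ, 0 < x ∧ x ≤ ω ∧ L.weierstrassP x = t := by
  obtain ⟨r, hr, h⟩ := L.exists_bound_weierstrassP_sub_inv_sq
  -- Near the pole `℘` differs from `1/z²` by less than 1, and `1/δ² ≥ (|t| + 1)²` leaves room for
  -- this error.
  set δ : ℝ := min (min (r / 2) ω) (1 / (|t| + 1)) with hδ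
  have hδ0 : 0 < δ := lt_min (lt_min (by positivity) R.ω_pos) (by positivity)
  have hδr : δ < r := by
    have : δ ≤ r / 2 := (min_le_left _ _).trans (min_le_left _ _)
    linarith
  have hδω : δ ≤ ω := (min_le_left _ _).trans (min_le_right _ _)
  have hδt : δ * (|t| + 1) ≤ 1 := by
    have : δ ≤ 1 / (|t| + 1) := min_le_right _ _
    rwa [le_div_iff₀ (by positivity)] at this
  have hbig : t < (L.weierstrassP δ).re := by
    have h1 := h δ (by rw [norm_real, Real.norm_of_nonneg hδ0.le]; exact hδr)
    have h2 := (abs_lt.1 ((abs_re_le_norm _).trans_lt h1)).1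
    have h3 : (1 / (δ : ℂ) ^ 2).re = 1 / δ ^ 2 := by
      rw [← ofReal_pow, ← ofReal_one, ← ofReal_div, ofReal_re]
    rw [sub_re, h3] at h2
    have h4 : (|t| + 1) ^ 2 ≤ 1 / δ ^ 2 := by
      rw [le_div_iff₀ (by positivity), ← mul_pow]
      have : 0 ≤ (|t| + 1) * δ := by positivity
      nlinarith
    nlinarith [le_abs_self t, abs_nonneg t]
  have hc : ContinuousOn (fun x : ℝ => (L.weierstrassP x).re) (Icc δ ω) := fun x hx => by
    have h1 := (hasDerivAt_weierstrassP (R.real_notMem (hδ0.trans_le hx.1) hx.2)).continuousAt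
    have : ContinuousAt (fun x : ℝ => (L.weierstrassP x).re) x := by
      have h2 : ContinuousAt (fun x : ℝ => L.weierstrassP x) x :=
        h1.comp continuous_ofReal.continuousAt
      exact continuous_re.continuousAt.comp h2
    exact this.continuousWithinAt
  obtain ⟨x, hx, hxt⟩ := intermediate_value_Icc' hδω hc ⟨ht.le, hbig.le⟩
  exact ⟨x, hδ0.trans_le hx.1, hx.2, by rw [← R.real_axis, ← hxt]⟩

/-- Large negative values of `℘` are attained on the imaginary axis. -/
lemma exists_imag_axis {t : ℝ} (ht : t < L.e₃ τ) :
    ∃ y : ℝ, 0 < y ∧ y ≤ τ ∧ L.weierstrassP (y * I) = t := by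
  obtain ⟨r, hr, h⟩ := L.exists_bound_weierstrassP_sub_inv_sq
  set δ : ℝ := min (min (r / 2) τ) (1 / (|t| + 1)) with hδ
  have hδ0 : 0 < δ := lt_min (lt_min (by positivity) R.τ_pos) (by positivity)
  have hδr : δ < r := by
    have : δ ≤ r / 2 := (min_le_left _ _).trans (min_le_left _ _)
    linarith
  have hδω : δ ≤ τ := (min_le_left _ _).trans (min_le_right _ _)
  have hδt : δ * (|t| + 1) ≤ 1 := by
    have : δ ≤ 1 / (|t| + 1) := min_le_right _ _
    rwa [le_div_iff₀ (by positivity)] at this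
  have hbig : (L.weierstrassP (δ * I)).re < t := by
    have h1 := h (δ * I) (by
      rw [norm_mul, norm_I, mul_one, norm_real, Real.norm_of_nonneg hδ0.le]; exact hδr)
    have h2 := (abs_lt.1 ((abs_re_le_norm _).trans_lt h1)).2
    have h3 : (1 / ((δ : ℂ) * I) ^ 2).re = -(1 / δ ^ 2) := by
      rw [mul_pow, I_sq, mul_neg_one, one_div, inv_neg, neg_re, ← ofReal_pow, ← ofReal_inv,
        ofReal_re, one_div]
    rw [sub_re, h3] at h2
    have h4 : (|t| + 1) ^ 2 ≤ 1 / δ ^ 2 := by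
      rw [le_div_iff₀ (by positivity), ← mul_pow]
      have : 0 ≤ (|t| + 1) * δ := by positivity
      nlinarith
    nlinarith [neg_abs_le t, abs_nonneg t]
  have hc : ContinuousOn (fun y : ℝ => (L.weierstrassP (y * I)).re) (Icc δ τ) := fun x hx => by
    have h1 := (hasDerivAt_weierstrassP (R.imag_notMem (hδ0.trans_le hx.1) hx.2)).continuousAt
    have : ContinuousAt (fun x : ℝ => (L.weierstrassP (x * I)).re) x := by
      have h2 : ContinuousAt (fun x : ℝ => L.weierstrassP (x * I)) x :=
        h1.comp (f := fun x : ℝ => (x : ℂ) * I) (by fun_prop)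
      exact continuous_re.continuousAt.comp h2
    exact this.continuousWithinAt
  obtain ⟨x, hx, hxt⟩ := intermediate_value_Icc hδω hc ⟨hbig.le, ht.le⟩
  exact ⟨x, hδ0.trans_le hx.1, hx.2, by rw [← R.imag_axis, ← hxt]⟩

/-- `℘`-values separate points of a closed quarter of the period rectangle. -/
lemma eq_of_weierstrassP_eq {x y x' y' : ℝ} (hx : x ∈ Icc 0 ω) (hx' : x' ∈ Icc 0 ω)
    (hy : y ∈ Icc 0 τ) (hy' : y' ∈ Icc 0 τ) (h : (x : ℂ) + y * I ∉ L.lattice)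
    (h' : (x' : ℂ) + y' * I ∉ L.lattice)
    (heq : L.weierstrassP (x + y * I) = L.weierstrassP (x' + y' * I)) : x = x' ∧ y = y' := by
  -- For coordinates in `[0, a]` the difference has absolute value below `2a`, and the sum lies in
  -- `[0, 2a]`. A sum of 0 or `2a` again forces equal coordinates, both 0 or both `a`.
  have aux : ∀ {a s s' : ℝ}, 0 < a → s ∈ Icc 0 a → s' ∈ Icc 0 a →
      ((∃ m : ℤ, s - s' = 2 * m * a) ∨ ∃ m : ℤ, s + s' = 2 * m * a) → s = s' := by
    intro a s s' ha hs hs' hh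
    have hl : ∀ m : ℤ, ∀ {t : ℝ}, t = 2 * m * a → -(2 * a) < t → t < 2 * a → t = 0 := by
      intro m t ht h1 h2
      have h3 : (-1 : ℝ) < m := by
        by_contra! hh
        nlinarith
      have h4 : (m : ℝ) < 1 := by
        by_contra! hh
        nlinarith
      have h5 : m = 0 := by
        have h6 : -1 < m := by exact_mod_cast h3
        have h7 : m < 1 := by exact_mod_cast h4
        omega
      rw [ht, h5]; simp
    rcases hh with ⟨m, hm⟩ | ⟨m, hm⟩
    · have := hl m hm (by linarith [hs.1, hs'.2]) (by linarith [hs.2, hs'.1])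
      linarith
    · by_cases h2 : s + s' < 2 * a
      · have := hl m hm (by linarith [hs.1, hs'.1]) h2
        linarith [hs.1, hs'.1]
      · linarith [hs.2, hs'.2]
  rcases sub_mem_or_add_mem_of_weierstrassP_eq h h' heq with hm | hm
  · have e : (x : ℂ) + y * I - (x' + y' * I) = ((x - x' : ℝ) : ℂ) + ((y - y' : ℝ) : ℂ) * I := by
      push_cast; ring
    rw [e] at hm
    obtain ⟨h1, h2⟩ := (R.mem_lattice_iff _ _).1 hm
    exact ⟨aux R.ω_pos hx hx' (Or.inl h1), aux R.τ_pos hy hy' (Or.inl h2)⟩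
  · have e : (x : ℂ) + y * I + (x' + y' * I) = ((x + x' : ℝ) : ℂ) + ((y + y' : ℝ) : ℂ) * I := by
      push_cast; ring
    rw [e] at hm
    obtain ⟨h1, h2⟩ := (R.mem_lattice_iff _ _).1 hm
    exact ⟨aux R.ω_pos hx hx' (Or.inr h1), aux R.τ_pos hy hy' (Or.inr h2)⟩

/-- On `(0, ω]` the function `℘` takes every real value from `e₁` upwards. Were `e₂ ≥ e₁`, the value
at the corner would recur on the real axis, although `℘` separates points of the quarter rectangle.
The next lemma argues in the same way on the imaginary axis. -/
lemma e₂_lt_e₁ : L.e₂ ω τ < L.e₁ ω := by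
  have hω := R.ω_pos
  have hτ := R.τ_pos
  by_contra! h
  obtain ⟨x, hx0, hx1, hx⟩ : ∃ x : ℝ, 0 < x ∧ x ≤ ω ∧ L.weierstrassP x = L.e₂ ω τ := by
    rcases h.lt_or_eq with h | h
    · exact R.exists_real_axis h
    · exact ⟨ω, hω, le_rfl, by rw [← h, R.ofReal_e₁]⟩
  rw [R.ofReal_e₂] at hx
  have := R.eq_of_weierstrassP_eq (x := x) (y := 0) ⟨hx0.le, hx1⟩ ⟨hω.le, le_rfl⟩
    ⟨le_rfl, hτ.le⟩ ⟨hτ.le, le_rfl⟩ (by simpa using R.real_notMem hx0 hx1) R.corner_notMem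
    (by simpa using hx)
  linarith [this.2]

lemma e₃_lt_e₂ : L.e₃ τ < L.e₂ ω τ := by
  have hω := R.ω_pos
  have hτ := R.τ_pos
  by_contra! h
  obtain ⟨x, hx0, hx1, hx⟩ : ∃ x : ℝ, 0 < x ∧ x ≤ τ ∧ L.weierstrassP (x * I) = L.e₂ ω τ := by
    rcases h.lt_or_eq with h | h
    · exact R.exists_imag_axis h
    · exact ⟨τ, hτ, le_rfl, by rw [h, R.ofReal_e₃]⟩
  rw [R.ofReal_e₂] at hx
  have := R.eq_of_weierstrassP_eq (x := 0) (y := x) ⟨le_rfl, hω.le⟩ ⟨hω.le, le_rfl⟩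
    ⟨hx0.le, hx1⟩ ⟨hτ.le, le_rfl⟩ (by simpa using R.imag_notMem hx0 hx1) R.corner_notMem
    (by simpa using hx)
  linarith [this.1]

omit R in
lemma cubic_root {h : ℂ} (hh : h ∉ L.lattice) (h2 : 2 * h ∈ L.lattice) :
    4 * L.weierstrassP h ^ 3 - L.g₂ * L.weierstrassP h - L.g₃ = 0 := by
  rw [← L.derivWeierstrassP_sq h hh, derivWeierstrassP_eq_zero_of_two_mul_mem h2]
  simp

lemma cubic_e₁ : 4 * (L.e₁ ω : ℂ) ^ 3 - L.g₂ * L.e₁ ω - L.g₃ = 0 := by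
  rw [R.ofReal_e₁]
  exact cubic_root R.ω_notMem R.two_ω_mem

lemma cubic_e₂ : 4 * (L.e₂ ω τ : ℂ) ^ 3 - L.g₂ * L.e₂ ω τ - L.g₃ = 0 := by
  rw [R.ofReal_e₂]
  exact cubic_root R.corner_notMem (by rw [mul_add]; exact add_mem R.two_ω_mem R.two_τ_mem)

lemma cubic_e₃ : 4 * (L.e₃ τ : ℂ) ^ 3 - L.g₂ * L.e₃ τ - L.g₃ = 0 := by
  rw [R.ofReal_e₃]
  exact cubic_root R.τ_notMem R.two_τ_mem

/-- Vieta's formulas for the cubic `4 t³ - g₂ t - g₃`. -/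
lemma vieta : L.e₁ ω + L.e₂ ω τ + L.e₃ τ = 0 ∧
    L.g₂ = ((-4 * (L.e₁ ω * L.e₂ ω τ + L.e₁ ω * L.e₃ τ + L.e₂ ω τ * L.e₃ τ) : ℝ) : ℂ) ∧
    L.g₃ = ((4 * (L.e₁ ω * L.e₂ ω τ * L.e₃ τ) : ℝ) : ℂ) := by
  have h1 := R.cubic_e₁
  have h2 := R.cubic_e₂
  have h3 := R.cubic_e₃
  have n12 : (L.e₁ ω : ℂ) - L.e₂ ω τ ≠ 0 := by
    rw [sub_ne_zero]; exact_mod_cast R.e₂_lt_e₁.ne'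
  have n13 : (L.e₁ ω : ℂ) - L.e₃ τ ≠ 0 := by
    rw [sub_ne_zero]; exact_mod_cast (R.e₃_lt_e₂.trans R.e₂_lt_e₁).ne'
  have n23 : (L.e₂ ω τ : ℂ) - L.e₃ τ ≠ 0 := by
    rw [sub_ne_zero]; exact_mod_cast R.e₃_lt_e₂.ne'
  generalize L.e₁ ω = a at *
  generalize L.e₂ ω τ = b at *
  generalize L.e₃ τ = c at *
  -- The three roots are distinct, so differences of the cubic equations may be divided by
  -- differences of roots.
  have k1 : 4 * ((a : ℂ) ^ 2 + a * b + b ^ 2) - L.g₂ = 0 :=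
    mul_left_cancel₀ n12 (by linear_combination h1 - h2)
  have k2 : 4 * ((a : ℂ) ^ 2 + a * c + c ^ 2) - L.g₂ = 0 :=
    mul_left_cancel₀ n13 (by linear_combination h1 - h3)
  have k3 : (a : ℂ) + b + c = 0 :=
    mul_left_cancel₀ n23 (by linear_combination (k1 - k2) / 4)
  refine ⟨by exact_mod_cast k3, ?_, ?_⟩
  · push_cast
    linear_combination 4 * ((a : ℂ) + b) * k3 - k1
  · push_cast
    linear_combination (a : ℂ) * k1 - h1 - 4 * a * b * k3

omit R in
/-- The set of real `x` at which `℘ (x + a)` takes a given value is countable. -/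
lemma countable_fiber (L : PeriodPair) (a c : ℂ) :
    {x : ℝ | (x : ℂ) + a ∉ L.lattice ∧ L.weierstrassP (x + a) = c}.Countable := by
  by_cases h : ∃ x₀ : ℝ, (x₀ : ℂ) + a ∉ L.lattice ∧ L.weierstrassP (x₀ + a) = c
  · obtain ⟨x₀, h0, h1⟩ := h
    have i1 : Function.Injective (fun x : ℝ => (x : ℂ) + a - (x₀ + a)) := fun x y hxy => by
      simpa using hxy
    have i2 : Function.Injective (fun x : ℝ => (x : ℂ) + a + (x₀ + a)) := fun x y hxy => by
      simpa using hxy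
    refine ((L.countable_lattice.preimage i1).union (L.countable_lattice.preimage i2)).mono ?_
    rintro x ⟨hx, hxc⟩
    exact sub_mem_or_add_mem_of_weierstrassP_eq hx h0 (hxc.trans h1.symm)
  · push Not at h
    convert countable_empty (α := ℝ)
    ext x
    simpa using h x

end IsRect

/-- `℘ (x + i τ)` as a function of the real variable `x`. -/
def shiftedP (L : PeriodPair) (τ x : ℝ) : ℝ := (L.weierstrassP (x + τ * I)).re

/-- `℘' (x + i τ)` as a function of the real variable `x`. -/
def shiftedP' (L : PeriodPair) (τ x : ℝ) : ℝ := (L.derivWeierstrassP (x + τ * I)).re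

namespace IsRect

variable {L : PeriodPair} {ω τ : ℝ} (R : L.IsRect ω τ)
include R

lemma ofReal_shiftedP (x : ℝ) : (L.shiftedP τ x : ℂ) = L.weierstrassP (x + τ * I) :=
  R.shifted_axis x

lemma ofReal_shiftedP' (x : ℝ) : (L.shiftedP' τ x : ℂ) = L.derivWeierstrassP (x + τ * I) :=
  R.shifted_axis_deriv x

lemma ofReal_g₂ : (L.g₂.re : ℂ) = L.g₂ := by
  rw [R.vieta.2.1, ofReal_re]

lemma ofReal_g₃ : (L.g₃.re : ℂ) = L.g₃ := by
  rw [R.vieta.2.2, ofReal_re]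

lemma g₂_re : L.g₂.re = -4 * (L.e₁ ω * L.e₂ ω τ + L.e₁ ω * L.e₃ τ + L.e₂ ω τ * L.e₃ τ) := by
  rw [R.vieta.2.1, ofReal_re]

lemma g₃_re : L.g₃.re = 4 * (L.e₁ ω * L.e₂ ω τ * L.e₃ τ) := by
  rw [R.vieta.2.2, ofReal_re]

lemma hasDerivAt_shiftedP (x : ℝ) : HasDerivAt (L.shiftedP τ) (L.shiftedP' τ x) x :=
  ((hasDerivAt_weierstrassP (R.shifted_notMem x)).comp_add_const (x : ℂ) (τ * I)).real_of_complex

lemma hasDerivAt_shiftedP' (x : ℝ) :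
    HasDerivAt (L.shiftedP' τ) (6 * L.shiftedP τ x ^ 2 - L.g₂.re / 2) x := by
  refine ((hasDerivAt_derivWeierstrassP (R.shifted_notMem x)).comp_add_const
    (x : ℂ) (τ * I)).real_of_complex.congr_deriv ?_
  rw [← R.ofReal_shiftedP, ← R.ofReal_g₂]
  norm_cast

lemma shiftedP'_sq (x : ℝ) :
    L.shiftedP' τ x ^ 2 = 4 * L.shiftedP τ x ^ 3 - L.g₂.re * L.shiftedP τ x - L.g₃.re := by
  have := L.derivWeierstrassP_sq _ (R.shifted_notMem x)
  rw [← R.ofReal_shiftedP, ← R.ofReal_shiftedP', ← R.ofReal_g₂, ← R.ofReal_g₃] at this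
  exact_mod_cast this

lemma shiftedP'_sq_eq_prod (x : ℝ) : L.shiftedP' τ x ^ 2 =
    4 * (L.shiftedP τ x - L.e₁ ω) * (L.shiftedP τ x - L.e₂ ω τ) * (L.shiftedP τ x - L.e₃ τ) := by
  rw [R.shiftedP'_sq, R.g₂_re, R.g₃_re]
  linear_combination (4 * L.shiftedP τ x ^ 2) * R.vieta.1

omit R in
lemma shiftedP_zero : L.shiftedP τ 0 = L.e₃ τ := by
  simp [shiftedP, e₃]

omit R in
lemma shiftedP_ω : L.shiftedP τ ω = L.e₂ ω τ := rfl

lemma shiftedP_add (x : ℝ) : L.shiftedP τ (x + 2 * ω) = L.shiftedP τ x := by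
  have := weierstrassP_add_mem R.two_ω_mem ((x : ℂ) + τ * I)
  rw [shiftedP, shiftedP, ← this]
  congr 2
  push_cast
  ring

lemma shiftedP'_add (x : ℝ) : L.shiftedP' τ (x + 2 * ω) = L.shiftedP' τ x := by
  have := derivWeierstrassP_add_mem R.two_ω_mem ((x : ℂ) + τ * I)
  rw [shiftedP', shiftedP', ← this]
  congr 2
  push_cast
  ring

lemma shiftedP_neg (x : ℝ) : L.shiftedP τ (-x) = L.shiftedP τ x := by
  have := weierstrassP_add_mem R.two_τ_mem (-((x : ℂ) + τ * I))
  rw [shiftedP, shiftedP, ← L.weierstrassP_neg ((x : ℂ) + τ * I), ← this]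
  congr 2
  push_cast
  ring

lemma shiftedP'_neg (x : ℝ) : L.shiftedP' τ (-x) = -L.shiftedP' τ x := by
  have := derivWeierstrassP_add_mem R.two_τ_mem (-((x : ℂ) + τ * I))
  rw [derivWeierstrassP_neg] at this
  rw [shiftedP', shiftedP', ← neg_re, ← this]
  congr 2
  push_cast
  ring

lemma continuous_shiftedP : Continuous (L.shiftedP τ) :=
  continuous_iff_continuousAt.2 fun x => (R.hasDerivAt_shiftedP x).continuousAt

lemma exists_shiftedP_eq {t : ℝ} (h3 : L.e₃ τ ≤ t) (h2 : t ≤ L.e₂ ω τ) :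
    ∃ x ∈ Icc 0 ω, L.shiftedP τ x = t :=
  intermediate_value_Icc R.ω_pos.le R.continuous_shiftedP.continuousOn
    ⟨by rwa [shiftedP_zero], by rwa [shiftedP_ω]⟩

/-- Since `℘'` is real here, the factored cubic is nonnegative, so values lie in `[e₃, e₂]` or above
`e₁`. By continuity the second case would produce a value strictly between `e₂ = ℘(ω + iτ)` and
`e₁`. -/
lemma shiftedP_mem (x : ℝ) : L.shiftedP τ x ∈ Icc (L.e₃ τ) (L.e₂ ω τ) := by
  have h32 := R.e₃_lt_e₂
  have h21 := R.e₂_lt_e₁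
  have hpos : ∀ y, 0 ≤ (L.shiftedP τ y - L.e₁ ω) *
      ((L.shiftedP τ y - L.e₂ ω τ) * (L.shiftedP τ y - L.e₃ τ)) := fun y => by
    have := R.shiftedP'_sq_eq_prod y
    nlinarith [sq_nonneg (L.shiftedP' τ y)]
  have hlt : L.shiftedP τ x < L.e₁ ω := by
    by_contra! h
    obtain ⟨y, hy⟩ := mem_range_of_exists_le_of_exists_ge R.continuous_shiftedP
      (c := (L.e₁ ω + L.e₂ ω τ) / 2) ⟨ω, by rw [shiftedP_ω]; linarith⟩ ⟨x, by linarith⟩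
    have h1 := hpos y
    rw [hy] at h1
    have h2 : 0 < ((L.e₁ ω + L.e₂ ω τ) / 2 - L.e₂ ω τ) * ((L.e₁ ω + L.e₂ ω τ) / 2 - L.e₃ τ) :=
      mul_pos (by linarith) (by linarith)
    nlinarith
  have h1 : (L.shiftedP τ x - L.e₂ ω τ) * (L.shiftedP τ x - L.e₃ τ) ≤ 0 := by
    by_contra! h
    have := hpos x
    nlinarith
  constructor
  · by_contra! h
    nlinarith
  · by_contra! h
    nlinarith

lemma injOn_shiftedP : InjOn (L.shiftedP τ) (Icc 0 ω) := fun x hx y hy h => by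
  have h' : L.weierstrassP (x + τ * I) = L.weierstrassP (y + τ * I) := by
    rw [← R.ofReal_shiftedP, ← R.ofReal_shiftedP, h]
  exact (R.eq_of_weierstrassP_eq hx hy ⟨R.τ_pos.le, le_rfl⟩ ⟨R.τ_pos.le, le_rfl⟩
    (R.shifted_notMem x) (R.shifted_notMem y) h').1

lemma shiftedP_two_ω_sub (x : ℝ) : L.shiftedP τ (2 * ω - x) = L.shiftedP τ x := by
  rw [← R.shiftedP_neg x, ← R.shiftedP_add (-x)]
  ring_nf

/-- Every value between `e₂` and `e₁` is taken by `℘` on the vertical through `ω`. -/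
lemma exists_vertical_eq {t : ℝ} (h2 : L.e₂ ω τ ≤ t) (h1 : t ≤ L.e₁ ω) :
    ∃ y : ℝ, L.weierstrassP (ω + y * I) = t := by
  have hc : ContinuousOn (fun y : ℝ => (L.weierstrassP (ω + y * I)).re) (Icc 0 τ) := fun x _ => by
    have h1 := (hasDerivAt_weierstrassP (R.vertical_notMem x)).continuousAt
    have h2 : ContinuousAt (fun x : ℝ => L.weierstrassP (ω + x * I)) x :=
      h1.comp (f := fun x : ℝ => (ω : ℂ) + x * I) (by fun_prop)
    exact (continuous_re.continuousAt.comp h2).continuousWithinAt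
  obtain ⟨y, -, hy⟩ := intermediate_value_Icc' R.τ_pos.le hc
    ⟨h2, by rw [e₁] at h1; simpa using h1⟩
  exact ⟨y, by rw [← R.vertical_axis, ← hy]⟩

/-- The exceptional set is a finite union of countable fibres of `℘`. -/
lemma dense_eval_shiftedP_ne_zero {f : Polynomial ℂ} (hf : f ≠ 0) :
    Dense {x : ℝ | f.eval (L.shiftedP τ x : ℂ) ≠ 0} := by
  have hc : {x : ℝ | f.eval (L.shiftedP τ x : ℂ) = 0}.Countable := by
    refine (f.roots.toFinset.finite_toSet.countable.biUnion
      (fun c _ => countable_fiber L (τ * I) c)).mono fun x hx => ?_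
    simp only [mem_iUnion]
    exact ⟨(L.shiftedP τ x : ℂ), by simpa [hf] using hx, R.shifted_notMem x,
      (R.ofReal_shiftedP x).symm⟩
  exact hc.dense_compl ℝ

end IsRect

end PeriodPair

end

/-! ### Hermite's product `X`, the map `M u = X u' - X' u / 2`, and its eigenvectors. -/

noncomputable section

namespace DarbouxDisplacement

open Set Filter Topology PeriodPair
open scoped ComplexConjugate

/-- The quadratic polynomial `9 p² + 3 E p + E² - 9 g₂ / 4`, whose value at `℘ (z)` is the product
of the two Bloch solutions of energy `E`. -/
def blochProd (L : PeriodPair) (E p : ℂ) : ℂ := 9 * p ^ 2 + 3 * E * p + E ^ 2 - 9 / 4 * L.g₂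

/-- The polynomial in the energy whose negative cuts out the bands. -/
def spectralPoly (L : PeriodPair) (E : ℂ) : ℂ :=
  -(E ^ 2 - 3 * L.g₂) * (E ^ 3 - 9 / 4 * L.g₂ * E - 27 / 4 * L.g₃)

/-- `℘ (x + i τ)`, with complex values. -/
def wp (L : PeriodPair) (τ x : ℝ) : ℂ := L.shiftedP τ x

/-- `℘' (x + i τ)`, with complex values. -/
def wp' (L : PeriodPair) (τ x : ℝ) : ℂ := L.shiftedP' τ x

/-- The product of the Bloch solutions as a function of the real variable. -/
def hermite (L : PeriodPair) (τ : ℝ) (E : ℂ) (x : ℝ) : ℂ := blochProd L E (wp L τ x)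

/-- Half the derivative of `hermite`. -/
def hermite' (L : PeriodPair) (τ : ℝ) (E : ℂ) (x : ℝ) : ℂ := (9 * wp L τ x + 3 / 2 * E) * wp' L τ x

/-- The derivative of `hermite'`. -/
def hermite'' (L : PeriodPair) (τ : ℝ) (E : ℂ) (x : ℝ) : ℂ :=
  9 * wp' L τ x ^ 2 + (9 * wp L τ x + 3 / 2 * E) * (6 * wp L τ x ^ 2 - L.g₂ / 2)

section

variable {L : PeriodPair} {ω τ : ℝ} (R : L.IsRect ω τ)
include R

lemma hasDerivAt_wp (x : ℝ) : HasDerivAt (wp L τ) (wp' L τ x) x :=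
  (R.hasDerivAt_shiftedP x).ofReal_comp

lemma hasDerivAt_wp' (x : ℝ) : HasDerivAt (wp' L τ) (6 * wp L τ x ^ 2 - L.g₂ / 2) x := by
  refine (R.hasDerivAt_shiftedP' x).ofReal_comp.congr_deriv ?_
  rw [wp, ← R.ofReal_g₂]
  push_cast
  rfl

lemma wp'_sq (x : ℝ) : wp' L τ x ^ 2 = 4 * wp L τ x ^ 3 - L.g₂ * wp L τ x - L.g₃ := by
  rw [wp, wp', ← R.ofReal_g₂, ← R.ofReal_g₃]
  exact_mod_cast R.shiftedP'_sq x

lemma wp_add (x : ℝ) : wp L τ (x + 2 * ω) = wp L τ x := by rw [wp, wp, R.shiftedP_add]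
lemma wp'_add (x : ℝ) : wp' L τ (x + 2 * ω) = wp' L τ x := by rw [wp', wp', R.shiftedP'_add]

lemma lameInce_eq (x : ℝ) : lameInce L x = 6 * wp L τ x := by
  rw [lameInce, wp, R.ofReal_shiftedP, R.ω₂_eq]
  congr 3
  ring

lemma hasDerivAt_hermite (E : ℂ) (x : ℝ) : HasDerivAt (hermite L τ E) (2 * hermite' L τ E x) x := by
  have h := hasDerivAt_wp R x
  refine (((((h.pow 2).const_mul 9).add (h.const_mul (3 * E))).add_const (E ^ 2)).sub_const
    (9 / 4 * L.g₂)).congr_deriv ?_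
  rw [hermite']
  norm_num
  ring

lemma hasDerivAt_hermite' (E : ℂ) (x : ℝ) : HasDerivAt (hermite' L τ E) (hermite'' L τ E x) x := by
  refine (((hasDerivAt_wp R x).const_mul 9).add_const (3 / 2 * E)).mul
    (hasDerivAt_wp' R x) |>.congr_deriv ?_
  rw [hermite'']
  ring

lemma hermite_add (E : ℂ) (x : ℝ) : hermite L τ E (x + 2 * ω) = hermite L τ E x := by
  rw [hermite, hermite, wp_add R]

lemma hermite'_add (E : ℂ) (x : ℝ) : hermite' L τ E (x + 2 * ω) = hermite' L τ E x := by
  rw [hermite', hermite', wp_add R, wp'_add R]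

/-- The first integral of the equation satisfied by the product of two solutions. -/
lemma hermite_first_integral (E : ℂ) (x : ℝ) :
    hermite' L τ E x ^ 2 - hermite L τ E x * hermite'' L τ E x
      + hermite L τ E x ^ 2 * (6 * wp L τ x - E) = spectralPoly L E := by
  have h := wp'_sq R x
  rw [hermite, hermite', hermite'', spectralPoly, blochProd]
  linear_combination ((9 * wp L τ x + 3 / 2 * E) ^ 2
    - 9 * (9 * wp L τ x ^ 2 + 3 * E * wp L τ x + E ^ 2 - 9 / 4 * L.g₂)) * h

/-- The linear map `u ↦ X u' - X' u / 2` preserves the solution space. -/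
lemma Solves.hermite {E : ℂ} {u u' : ℝ → ℂ} (h : Solves (fun x => 6 * wp L τ x - E) u u') :
    Solves (fun x => 6 * wp L τ x - E) (fun x => hermite L τ E x * u' x - hermite' L τ E x * u x)
      (fun x => (hermite L τ E x * (6 * wp L τ x - E) - hermite'' L τ E x) * u x
        + hermite' L τ E x * u' x) := fun x => by
  have hX := hasDerivAt_hermite R E x
  have hX' := hasDerivAt_hermite' R E x
  have hp := hasDerivAt_wp R x
  have hp' := hasDerivAt_wp' R x
  have hV : HasDerivAt (fun x => 6 * wp L τ x - E) (6 * wp' L τ x) x :=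
    (hp.const_mul 6).sub_const E
  have hX'' : HasDerivAt (hermite'' L τ E) (9 * (2 * wp' L τ x * (6 * wp L τ x ^ 2 - L.g₂ / 2)) +
      (9 * wp' L τ x * (6 * wp L τ x ^ 2 - L.g₂ / 2)
        + (9 * wp L τ x + 3 / 2 * E) * (12 * wp L τ x * wp' L τ x))) x := by
    refine (((hp'.pow 2).const_mul 9).add ((((hp.const_mul 9).add_const (3 / 2 * E))).mul
      (((hp.pow 2).const_mul 6).sub_const (L.g₂ / 2)))).congr_deriv ?_
    simp only [Nat.cast_ofNat, Nat.add_one_sub_one, pow_one, Pi.pow_apply]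
    ring
  constructor
  · refine ((hX.mul (h x).2).sub (hX'.mul (h x).1)).congr_deriv ?_
    ring
  · refine ((((hX.mul hV).sub hX'').mul (h x).1).add (hX'.mul (h x).2)).congr_deriv ?_
    simp only [Pi.mul_apply, Pi.sub_apply]
    rw [DarbouxDisplacement.hermite, hermite', hermite'', blochProd]
    ring

/-- This is `M² = P(E)`, a restatement of the first integral. -/
lemma hermite_hermite {E : ℂ} (u u' : ℝ → ℂ) (x : ℝ) :
    hermite L τ E x * ((hermite L τ E x * (6 * wp L τ x - E) - hermite'' L τ E x) * u x
        + hermite' L τ E x * u' x)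
      - hermite' L τ E x * (hermite L τ E x * u' x - hermite' L τ E x * u x)
      = spectralPoly L E * u x := by
  rw [← hermite_first_integral R E x]
  ring

lemma norm_potential_le (E : ℂ) : ∃ K : ℝ, ∀ x, ‖6 * wp L τ x - E‖ ≤ K := by
  refine ⟨6 * (|L.e₃ τ| + |L.e₂ ω τ|) + ‖E‖, fun x => (norm_sub_le _ _).trans ?_⟩
  gcongr
  rw [norm_mul, wp, norm_real, Real.norm_eq_abs]
  norm_num
  have h := R.shiftedP_mem x
  rw [abs_le]
  constructor
  · linarith [h.1, neg_abs_le (L.e₃ τ), abs_nonneg (L.e₂ ω τ)]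
  · linarith [h.2, le_abs_self (L.e₂ ω τ), abs_nonneg (L.e₃ τ)]

lemma contDiff_potential (E : ℂ) : ContDiff ℝ 1 (fun x => 6 * wp L τ x - E) := by
  have h1 : ContDiff ℝ 1 (wp L τ) := by
    rw [contDiff_one_iff_deriv]
    refine ⟨fun x => (hasDerivAt_wp R x).differentiableAt, ?_⟩
    rw [show deriv (wp L τ) = wp' L τ from funext fun x => (hasDerivAt_wp R x).deriv]
    exact continuous_iff_continuousAt.2 fun x => (hasDerivAt_wp' R x).continuousAt
  fun_prop

lemma potential_add (E : ℂ) (x : ℝ) : 6 * wp L τ (x + 2 * ω) - E = 6 * wp L τ x - E := by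
  rw [wp_add R]

lemma Solves.eq_of_eq {E : ℂ} {u u' v v' : ℝ → ℂ} (hu : Solves (fun x => 6 * wp L τ x - E) u u')
    (hv : Solves (fun x => 6 * wp L τ x - E) v v') {x₀ : ℝ} (h0 : u x₀ = v x₀)
    (h1 : u' x₀ = v' x₀) : (∀ x, u x = v x) ∧ ∀ x, u' x = v' x := by
  obtain ⟨K, hK⟩ := norm_potential_le R E
  obtain ⟨h2, h3⟩ := hu.unique hv hK h0 h1
  exact ⟨congrFun h2, congrFun h3⟩

lemma isSolution_iff {E : ℂ} {u : ℝ → ℂ} : IsSolution (lameInce L) E u ↔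
    Solves (fun x => 6 * wp L τ x - E) u (deriv u) := by
  constructor
  · rintro ⟨h1, h2, h3⟩ x
    refine ⟨(h1 x).hasDerivAt, (h2 x).hasDerivAt.congr_deriv ?_⟩
    have := h3 x
    rw [lameInce_eq R] at this
    linear_combination -this
  · intro h
    refine ⟨fun x => (h x).1.differentiableAt, fun x => (h x).2.differentiableAt, fun x => ?_⟩
    rw [(h x).2.deriv, lameInce_eq R]
    ring

lemma Solves.isSolution {E : ℂ} {u u' : ℝ → ℂ} (h : Solves (fun x => 6 * wp L τ x - E) u u') :
    IsSolution (lameInce L) E u := by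
  rw [isSolution_iff R]
  rwa [show deriv u = u' from funext fun x => (h x).1.deriv]

lemma dense_hermite_ne_zero (E : ℂ) : Dense {x : ℝ | hermite L τ E x ≠ 0} := by
  have hf : (Polynomial.C 9 * Polynomial.X ^ 2 + Polynomial.C (3 * E) * Polynomial.X
      + Polynomial.C (E ^ 2 - 9 / 4 * L.g₂) : Polynomial ℂ) ≠ 0 := fun h => by
    generalize E ^ 2 - 9 / 4 * L.g₂ = c at h
    have := congrArg (fun f => Polynomial.coeff f 2) h
    simp at this
  convert R.dense_eval_shiftedP_ne_zero hf using 4 with x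
  simp [hermite, blochProd, wp]
  ring

/-- Common eigenvectors of the monodromy and of `u ↦ X u' - X' u / 2`. -/
lemma exists_eigenvector {E C : ℂ} (hC : C ^ 2 = spectralPoly L E) (x₀ : ℝ) :
    ∃ u u' : ℝ → ℂ, Solves (fun x => 6 * wp L τ x - E) u u' ∧
      (∀ x, hermite L τ E x * u' x = (hermite' L τ E x + C) * u x) ∧
      u x₀ = hermite L τ E x₀ ∧ u' x₀ = hermite' L τ E x₀ + C := by
  obtain ⟨K, hK⟩ := norm_potential_le R E
  -- These initial data form an eigenvector of `M` at `x₀` with eigenvalue `C`, and they are nonzero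
  -- when `X(x₀) ≠ 0`. Since `M u` and `C u` are both solutions, agreement at `x₀` suffices.
  obtain ⟨u, u', hu, h0, h1⟩ := exists_solves (contDiff_potential R E) hK x₀
    (hermite L τ E x₀) (hermite' L τ E x₀ + C)
  refine ⟨u, u', hu, fun x => ?_, h0, h1⟩
  have := ((hu.hermite R).eq_of_eq R (hu.const_mul C) (x₀ := x₀) ?_ ?_).1 x
  · linear_combination this
  · rw [h0, h1]; ring
  · rw [h0, h1]
    linear_combination hermite_first_integral R E x₀ - hC

/-- Where `X ≠ 0`, the eigenvalue equation determines `u'` from `u`, so each eigenspace of `M` is at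
most a line. This holds also for `C = 0`. -/
lemma eigenvector_unique {E C : ℂ} {u u' v v' : ℝ → ℂ}
    (hu : Solves (fun x => 6 * wp L τ x - E) u u') (hv : Solves (fun x => 6 * wp L τ x - E) v v')
    (eu : ∀ x, hermite L τ E x * u' x = (hermite' L τ E x + C) * u x)
    (ev : ∀ x, hermite L τ E x * v' x = (hermite' L τ E x + C) * v x) {x₀ : ℝ}
    (hx₀ : hermite L τ E x₀ ≠ 0) (x : ℝ) : u x₀ * v x = v x₀ * u x := by
  refine ((hv.const_mul (u x₀)).eq_of_eq R (hu.const_mul (v x₀)) (x₀ := x₀) (by ring) ?_).1 x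
  apply mul_left_cancel₀ hx₀
  linear_combination u x₀ * ev x₀ - v x₀ * eu x₀

lemma eigenvector_apply_ne_zero {E C : ℂ} {u u' : ℝ → ℂ}
    (hu : Solves (fun x => 6 * wp L τ x - E) u u')
    (eu : ∀ x, hermite L τ E x * u' x = (hermite' L τ E x + C) * u x) (h0 : ∃ x, u x ≠ 0) {x₀ : ℝ}
    (hx₀ : hermite L τ E x₀ ≠ 0) : u x₀ ≠ 0 := fun h => by
  obtain ⟨x, hx⟩ := h0
  obtain ⟨K, hK⟩ := norm_potential_le R E
  refine hx (hu.eq_zero hK h ?_ x)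
  apply mul_left_cancel₀ hx₀
  rw [eu, h]
  ring

/-- Translation by the period commutes with `M`, hence preserves the line spanned by `u`. -/
lemma eigenvector_bloch {E C : ℂ} {u u' : ℝ → ℂ}
    (hu : Solves (fun x => 6 * wp L τ x - E) u u')
    (eu : ∀ x, hermite L τ E x * u' x = (hermite' L τ E x + C) * u x) {x₀ : ℝ}
    (hx₀ : hermite L τ E x₀ ≠ 0) (h0 : u x₀ ≠ 0) (x : ℝ) :
    u (x + 2 * ω) = u (x₀ + 2 * ω) / u x₀ * u x := by
  have := eigenvector_unique R hu (hu.comp_add (potential_add R E)) eu (C := C) (fun x => by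
    have := eu (x + 2 * ω)
    rwa [hermite_add R, hermite'_add R] at this) hx₀ x
  field_simp
  linear_combination this

/-- The eigenvector is a Bloch solution. -/
lemma exists_bloch_eigenvector {E C : ℂ} (hC : C ^ 2 = spectralPoly L E) :
    ∃ (β : ℂ) (u : ℝ → ℂ), IsBlochSolution (lameInce L) (2 * ω) E β u ∧
      Solves (fun x => 6 * wp L τ x - E) u (deriv u) ∧
      ∀ x, hermite L τ E x * deriv u x = (hermite' L τ E x + C) * u x := by
  obtain ⟨x₀, hx₀⟩ := (dense_hermite_ne_zero R E).nonempty
  obtain ⟨u, u', hu, eu, h0, -⟩ := exists_eigenvector R hC x₀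
  have hd : deriv u = u' := funext fun x => (hu x).1.deriv
  have h0' : u x₀ ≠ 0 := by rwa [h0]
  exact ⟨_, u, ⟨hu.isSolution R, fun h => h0' (by rw [h]; rfl),
    fun x => eigenvector_bloch R hu eu hx₀ h0' x⟩, by rwa [hd], by rwa [hd]⟩

end

end DarbouxDisplacement

end

/-! ### Real energies: bounded solutions in the bands, coexistence in the gaps, solutions at the
edges. -/

noncomputable section

namespace DarbouxDisplacement

open Set Filter Topology PeriodPair
open scoped ComplexConjugate

lemma Solves.re {Q : ℝ → ℝ} {R : ℝ → ℂ} (hR : ∀ x, R x = Q x) {u u' : ℝ → ℂ} (h : Solves R u u') :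
    Solves Q (fun x => (u x).re) (fun x => (u' x).re) := fun x => by
  refine ⟨reCLM.hasFDerivAt.comp_hasDerivAt x (h x).1,
    (reCLM.hasFDerivAt.comp_hasDerivAt x (h x).2).congr_deriv ?_⟩
  simp [hR]

lemma Solves.conj {Q : ℝ → ℝ} {R : ℝ → ℂ} (hR : ∀ x, R x = Q x) {u u' : ℝ → ℂ} (h : Solves R u u') :
    Solves R (fun x => conj (u x)) (fun x => conj (u' x)) := fun x => by
  refine ⟨(h x).1.star, (h x).2.star.congr_deriv ?_⟩
  simp [hR]

/-- The spectral polynomial in factorized form, for real energies. -/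
def spectralPolyR (L : PeriodPair) (ω τ E : ℝ) : ℝ :=
  -(E ^ 2 - 3 * L.g₂.re) * ((E - 3 * L.e₁ ω) * (E - 3 * L.e₂ ω τ) * (E - 3 * L.e₃ τ))

/-- `hermite` for real energies. -/
def hermiteR (L : PeriodPair) (τ E x : ℝ) : ℝ :=
  9 * L.shiftedP τ x ^ 2 + 3 * E * L.shiftedP τ x + E ^ 2 - 9 / 4 * L.g₂.re

/-- `hermite'` for real energies. -/
def hermiteR' (L : PeriodPair) (τ E x : ℝ) : ℝ :=
  (9 * L.shiftedP τ x + 3 / 2 * E) * L.shiftedP' τ x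

/-- `hermite''` for real energies. -/
def hermiteR'' (L : PeriodPair) (τ E x : ℝ) : ℝ :=
  9 * L.shiftedP' τ x ^ 2 +
    (9 * L.shiftedP τ x + 3 / 2 * E) * (6 * L.shiftedP τ x ^ 2 - L.g₂.re / 2)

section

variable {L : PeriodPair} {ω τ : ℝ} (R : L.IsRect ω τ)
include R

lemma spectralPoly_ofReal (E : ℝ) : spectralPoly L E = spectralPolyR L ω τ E := by
  obtain ⟨h1, h2, h3⟩ := R.vieta
  have h1' : (L.e₁ ω : ℂ) + L.e₂ ω τ + L.e₃ τ = 0 := by exact_mod_cast h1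
  push_cast at h2 h3
  rw [spectralPoly, spectralPolyR]
  push_cast
  rw [R.ofReal_g₂]
  linear_combination (-((E : ℂ) ^ 2 - 3 * L.g₂)) *
    (-(9 / 4) * E * h2 - 27 / 4 * h3 + 3 * E ^ 2 * h1')

lemma hermite_ofReal (E x : ℝ) : hermite L τ E x = hermiteR L τ E x := by
  rw [hermite, blochProd, hermiteR, wp, ← R.ofReal_g₂]
  push_cast
  rfl

omit R in
lemma hermite'_ofReal (E x : ℝ) : hermite' L τ E x = hermiteR' L τ E x := by
  rw [hermite', hermiteR', wp, wp']
  push_cast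
  rfl

lemma hermite''_ofReal (E x : ℝ) : hermite'' L τ E x = hermiteR'' L τ E x := by
  rw [hermite'', hermiteR'', wp, wp', ← R.ofReal_g₂]
  push_cast
  rfl

omit R in
lemma potential_ofReal (E x : ℝ) :
    6 * wp L τ x - E = ((6 * L.shiftedP τ x - E : ℝ) : ℂ) := by
  rw [wp]; push_cast; rfl

lemma hermiteR_first_integral (E x : ℝ) :
    hermiteR' L τ E x ^ 2 - hermiteR L τ E x * hermiteR'' L τ E x
      + hermiteR L τ E x ^ 2 * (6 * L.shiftedP τ x - E) = spectralPolyR L ω τ E := by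
  have := hermite_first_integral R E x
  rw [hermite_ofReal R, hermite'_ofReal, hermite''_ofReal R, potential_ofReal,
    spectralPoly_ofReal R] at this
  exact_mod_cast this

lemma norm_potentialR_le (E : ℝ) : ∃ K : ℝ, ∀ x, ‖6 * L.shiftedP τ x - E‖ ≤ K := by
  obtain ⟨K, hK⟩ := norm_potential_le R E
  refine ⟨K, fun x => ?_⟩
  have := hK x
  rwa [potential_ofReal, norm_real] at this

/-- Where the spectral polynomial is negative there are bounded Bloch solutions. -/
lemma mem_allowedEnergies {E : ℝ} (hE : spectralPolyR L ω τ E < 0) :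
    E ∈ allowedEnergies (lameInce L) (2 * ω) := by
  set ν : ℝ := √(-spectralPolyR L ω τ E) with hν
  have hν2 : ν ^ 2 = -spectralPolyR L ω τ E := Real.sq_sqrt (by linarith)
  have hC : ((ν : ℂ) * I) ^ 2 = spectralPoly L E := by
    rw [spectralPoly_ofReal R, mul_pow, I_sq]
    have : (ν : ℂ) ^ 2 = ((-spectralPolyR L ω τ E : ℝ) : ℂ) := by exact_mod_cast hν2
    rw [this]; push_cast; ring
  obtain ⟨β, u, hB, hu, eu⟩ := exists_bloch_eigenvector R hC
  refine ⟨β, u, ?_, hB⟩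
  -- At a real zero of the real function `X`, the first integral reduces to `X'²/4 = P(E) < 0`.
  have hX : ∀ x, hermite L τ E x ≠ 0 := fun x h => by
    rw [hermite_ofReal R] at h
    have h' : hermiteR L τ E x = 0 := by exact_mod_cast h
    have := hermiteR_first_integral R E x
    rw [h'] at this
    nlinarith [sq_nonneg (hermiteR' L τ E x)]
  have hu' := hu.conj (potential_ofReal E)
  have eu' : ∀ x, hermite L τ E x * conj (deriv u x) = (hermite' L τ E x - ν * I) * conj (u x) :=
    fun x => by
      have := congrArg conj (eu x)
      rw [hermite_ofReal R, hermite'_ofReal] at this ⊢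
      simpa [sub_eq_add_neg] using this
  -- The conjugate of `u` belongs to the eigenvalue `-C`, so `(|u|²)' X = |u|² X'` and the quotient
  -- is constant. Periodicity of `X` then gives `|β| = 1`.
  set n : ℝ → ℂ := fun x => u x * conj (u x) / hermite L τ E x with hn
  have hnd : ∀ x, HasDerivAt n 0 x := fun x => by
    refine (((hu x).1.mul (hu' x).1).div (hasDerivAt_hermite R E x) (hX x)).congr_deriv ?_
    rw [div_eq_zero_iff]
    left
    simp only [Pi.mul_apply]
    linear_combination conj (u x) * eu x + u x * eu' x
  have hnc : ∀ x y, n x = n y := fun x y =>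
    is_const_of_deriv_eq_zero (fun t => (hnd t).differentiableAt) (fun t => (hnd t).deriv) x y
  obtain ⟨x, hx⟩ : ∃ x, u x ≠ 0 := by
    by_contra! h
    exact hB.2.1 (funext h)
  have h1 := hnc (x + 2 * ω) x
  simp only [hn] at h1
  rw [hermite_add R, hB.2.2 x, div_left_inj' (hX x), mul_conj, mul_conj, normSq_mul] at h1
  have h2 : normSq β * normSq (u x) = normSq (u x) := by exact_mod_cast h1
  have h3 : normSq β = 1 := by
    have : normSq (u x) ≠ 0 := by simpa using hx
    exact mul_right_cancel₀ this (by rw [h2, one_mul])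
  rw [normSq_eq_norm_sq] at h3
  exact (pow_eq_one_iff_of_nonneg (norm_nonneg _) two_ne_zero).1 h3

/-- A Bloch solution gives an eigenvector with the same multiplier. -/
lemma exists_eigenvector_of_bloch {E β c : ℂ} {u : ℝ → ℂ} (hc : c ^ 2 = spectralPoly L E)
    (hc0 : c ≠ 0) (hB : IsBlochSolution (lameInce L) (2 * ω) E β u) :
    ∃ C : ℂ, (C = c ∨ C = -c) ∧ ∃ w w' : ℝ → ℂ, Solves (fun x => 6 * wp L τ x - E) w w' ∧
      (∀ x, hermite L τ E x * w' x = (hermite' L τ E x + C) * w x) ∧ (∃ x, w x ≠ 0) ∧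
      ∀ x, w (x + 2 * ω) = β * w x := by
  have hu := (isSolution_iff R).1 hB.1
  have hm := hu.hermite R
  have hβ' : ∀ x, deriv u (x + 2 * ω) = β * deriv u x := fun x => by
    have h1 := (hu.comp_add (potential_add R E) x).1
    have h2 := (hu.const_mul β x).1
    exact h1.unique (h2.congr_of_eventuallyEq (Eventually.of_forall fun y => hB.2.2 y))
  -- From `M² = C²`, the solution `M u + C u` is an eigenvector for `C` whenever it is nonzero, and
  -- it keeps the multiplier of `u`. It cannot vanish for both `c` and `-c`, since their difference
  -- is `2cu`.
  have key : ∀ C : ℂ, C ^ 2 = spectralPoly L E →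
      (∃ x, hermite L τ E x * deriv u x - hermite' L τ E x * u x + C * u x ≠ 0) →
      ∃ w w' : ℝ → ℂ, Solves (fun x => 6 * wp L τ x - E) w w' ∧
      (∀ x, hermite L τ E x * w' x = (hermite' L τ E x + C) * w x) ∧ (∃ x, w x ≠ 0) ∧
      ∀ x, w (x + 2 * ω) = β * w x := fun C hC h => by
    refine ⟨_, _, hm.add (hu.const_mul C), fun x => ?_, h, fun x => ?_⟩
    · linear_combination hermite_hermite R (E := E) u (deriv u) x - u x * hC
    · rw [hermite_add R, hermite'_add R, hβ', hB.2.2]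
      ring
  by_cases h : ∃ x, hermite L τ E x * deriv u x - hermite' L τ E x * u x + c * u x ≠ 0
  · exact ⟨c, Or.inl rfl, key c hc h⟩
  · refine ⟨-c, Or.inr rfl, key (-c) (by rw [neg_sq, hc]) ?_⟩
    push Not at h
    by_contra! h'
    refine hB.2.1 (funext fun x => ?_)
    have : c * u x = 0 := by linear_combination (h x - h' x) / 2
    simpa [hc0] using this

/-- Inside a gap a bounded Bloch solution would force coexistence, so that there would be real
solutions with zeros at distance one period, starting anywhere. -/
lemma exists_solves_zero_zero {E : ℝ} (hpos : 0 < spectralPolyR L ω τ E)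
    (hE : E ∈ allowedEnergies (lameInce L) (2 * ω)) (a : ℝ) :
    ∃ s s' : ℝ → ℝ, Solves (fun x => 6 * L.shiftedP τ x - E) s s' ∧ (∃ x, s x ≠ 0) ∧
      s a = 0 ∧ s (a + 2 * ω) = 0 := by
  obtain ⟨β, u, hβ, hB⟩ := hE
  set c : ℝ := √(spectralPolyR L ω τ E)
  have hc0 : c ≠ 0 := (Real.sqrt_pos.2 hpos).ne'
  have hc2 : (c : ℂ) ^ 2 = spectralPoly L E := by
    rw [spectralPoly_ofReal R]
    exact_mod_cast Real.sq_sqrt hpos.le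
  obtain ⟨C', hC', w, w', hw, ew, hw0, hwβ⟩ :=
    exists_eigenvector_of_bloch R hc2 (by exact_mod_cast hc0) hB
  obtain ⟨C, rfl, hC0⟩ : ∃ C : ℝ, C' = C ∧ C ≠ 0 := by
    rcases hC' with rfl | rfl
    · exact ⟨c, rfl, hc0⟩
    · exact ⟨-c, by push_cast; rfl, neg_ne_zero.2 hc0⟩
  obtain ⟨x₀, hx₀⟩ := (dense_hermite_ne_zero R (E : ℂ)).nonempty
  have hwx : w x₀ ≠ 0 := eigenvector_apply_ne_zero R hw ew hw0 hx₀
  -- normalization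
  have hW := hw.const_mul (w x₀)⁻¹
  set W : ℝ → ℂ := fun x => (w x₀)⁻¹ * w x with hWdef
  set W' : ℝ → ℂ := fun x => (w x₀)⁻¹ * w' x with hW'def
  have eW : ∀ x, hermite L τ E x * W' x = (hermite' L τ E x + C) * W x := fun x => by
    simp only [hWdef, hW'def]
    linear_combination (w x₀)⁻¹ * ew x
  have hW1 : W x₀ = 1 := inv_mul_cancel₀ hwx
  have hWβ : ∀ x, W (x + 2 * ω) = β * W x := fun x => by
    simp only [hWdef, hwβ]; ring
  have eW' : ∀ x, hermite L τ E x * conj (W' x) = (hermite' L τ E x + C) * conj (W x) := fun x => by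
    have := congrArg conj (eW x)
    rw [hermite_ofReal R, hermite'_ofReal] at this ⊢
    simpa using this
  -- With `C` real and `W x₀ = 1`, the derivative at `x₀` is also real, so `W` and its conjugate
  -- have the same initial data.
  have hreal : ∀ x, conj (W x) = W x := by
    refine ((hW.conj (potential_ofReal E)).eq_of_eq R hW (x₀ := x₀) ?_ ?_).1
    · rw [hW1, map_one]
    · apply mul_left_cancel₀ hx₀
      rw [eW, eW', hW1, map_one]
  have hr := hW.re (potential_ofReal E)
  set r : ℝ → ℝ := fun x => (W x).re with hrdef
  set r' : ℝ → ℝ := fun x => (W' x).re with hr'def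
  have hrW : ∀ x, (r x : ℂ) = W x := fun x => conj_eq_iff_re.1 (hreal x)
  have er : ∀ x, hermiteR L τ E x * r' x = (hermiteR' L τ E x + C) * r x := fun x => by
    have := congrArg Complex.re (eW x)
    rw [hermite_ofReal R, hermite'_ofReal, ← ofReal_add, re_ofReal_mul, re_ofReal_mul] at this
    exact this
  have hr1 : r x₀ = 1 := by simp only [hrdef, hW1, one_re]
  obtain ⟨b, rfl⟩ : ∃ b : ℝ, β = b := ⟨r (x₀ + 2 * ω), by rw [hrW, hWβ, hW1, mul_one]⟩
  have hb : b * b = 1 := by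
    rw [norm_real, Real.norm_eq_abs] at hβ
    rw [← abs_mul_abs_self, hβ, one_mul]
  have hrb : ∀ x, r (x + 2 * ω) = b * r x := fun x => by
    have := hWβ x
    rw [← hrW, ← hrW] at this
    exact_mod_cast this
  have hQ : ∀ x, 6 * L.shiftedP τ (-x) - E = 6 * L.shiftedP τ x - E := fun x => by
    rw [R.shiftedP_neg]
  have hv := hr.comp_neg hQ
  by_cases ha : r a = 0
  · exact ⟨r, r', hr, ⟨x₀, by rw [hr1]; exact one_ne_zero⟩, ha, by rw [hrb, ha, mul_zero]⟩
  -- Both `r(x)` and `r(-x)` have multiplier `b`, because `b² = 1`. The combination `r(-a) r(x) -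
  -- r(a) r(-x)` vanishes at `a`, hence at `a + 2ω`.
  have hs := (hr.const_mul (r (-a))).add (hv.const_mul (-r a))
  refine ⟨_, _, hs, ?_, by ring, ?_⟩
  · by_contra! h
    have h' : ∀ x, r (-a) * r' x + -r a * -r' (-x) = 0 := fun x =>
      (hs x).1.unique ((hasDerivAt_const x (0 : ℝ)).congr_of_eventuallyEq
        (Eventually.of_forall h))
    -- Reflection turns eigenvalue `C` of `M` into `-C`. Applying `M` to a vanishing combination and
    -- adding `C` times it isolates the part along `r`.
    have h3 : ∀ x, C * r (-a) * r x = 0 := fun x => by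
      have e1 := er x
      have e2 := er (-x)
      have e3 : hermiteR L τ E (-x) = hermiteR L τ E x := by rw [hermiteR, hermiteR, R.shiftedP_neg]
      have e4 : hermiteR' L τ E (-x) = -hermiteR' L τ E x := by
        rw [hermiteR', hermiteR', R.shiftedP_neg, R.shiftedP'_neg]; ring
      rw [e3, e4] at e2
      linear_combination (hermiteR L τ E x * h' x - r (-a) * e1 - r a * e2
        - (hermiteR' L τ E x - C) * h x) / 2
    have h4 : r (-a) = 0 := by
      have := h3 x₀
      rw [hr1, mul_one] at this
      simpa [hC0] using this
    have h5 := h (-x₀)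
    rw [h4, neg_neg, hr1] at h5
    exact ha (by linarith)
  · have e := hrb (-(a + 2 * ω))
    have e' : -(a + 2 * ω) + 2 * ω = -a := by ring
    rw [e'] at e
    rw [hrb]
    linear_combination (r a * b) * e + r a * r (-(a + 2 * ω)) * hb

lemma sturm {E F : ℝ} (hEF : E < F) {s s' v v' : ℝ → ℝ}
    (hs : Solves (fun x => 6 * L.shiftedP τ x - E) s s')
    (hv : Solves (fun x => 6 * L.shiftedP τ x - F) v v') (hs0 : ∃ x, s x ≠ 0) {a b : ℝ}
    (hab : a < b) (ha : s a = 0) (hb : s b = 0) : ∃ y ∈ Ioo a b, v y = 0 := by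
  obtain ⟨K₁, hK₁⟩ := norm_potentialR_le R E
  obtain ⟨K₂, hK₂⟩ := norm_potentialR_le R F
  exact hs.exists_zero_of_lt hv (fun x => by linarith) (K := max K₁ K₂)
    (fun x => (hK₁ x).trans (le_max_left _ _)) (fun x => (hK₂ x).trans (le_max_right _ _))
    hs0 hab ha hb

/-- At a root of the spectral polynomial there is a real solution whose zeros are
zeros of the product of Bloch solutions. -/
lemma exists_edge_solution {E : ℝ} (hE : spectralPolyR L ω τ E = 0) :
    ∃ v v' : ℝ → ℝ, Solves (fun x => 6 * L.shiftedP τ x - E) v v' ∧ (∃ x, v x ≠ 0) ∧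
      (∀ x, v x = 0 → hermiteR L τ E x = 0) ∧
      ∀ x, hermiteR L τ E x = 0 → hermiteR'' L τ E x ≠ 0 → v x = 0 := by
  obtain ⟨x₀, hx₀⟩ := (dense_hermite_ne_zero R (E : ℂ)).nonempty
  obtain ⟨u, u', hu, eu, h0, -⟩ := exists_eigenvector R (E := E) (C := 0) (by
    rw [spectralPoly_ofReal R, hE]; simp) x₀
  have hv := hu.re (potential_ofReal E)
  set v : ℝ → ℝ := fun x => (u x).re
  set v' : ℝ → ℝ := fun x => (u' x).re
  have ev : ∀ x, hermiteR L τ E x * v' x = hermiteR' L τ E x * v x := fun x => by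
    have := congrArg Complex.re (eu x)
    rw [hermite_ofReal R, hermite'_ofReal, add_zero, re_ofReal_mul, re_ofReal_mul] at this
    exact this
  have hv0 : v x₀ ≠ 0 := fun h => hx₀ (by
    rw [hermite_ofReal R] at h0 ⊢
    have h1 := congrArg Complex.re h0
    rw [ofReal_re] at h1
    have h2 : hermiteR L τ E x₀ = 0 := h1.symm.trans h
    rw [h2, ofReal_zero])
  obtain ⟨K, hK⟩ := norm_potentialR_le R E
  refine ⟨v, v', hv, ⟨x₀, hv0⟩, fun x hx => ?_, fun x hx hx'' => ?_⟩
  · have h1 := ev x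
    rw [hx, mul_zero] at h1
    refine (mul_eq_zero.1 h1).resolve_right fun h2 => hv0 (hv.eq_zero hK hx h2 x₀)
  · have hX : HasDerivAt (hermiteR L τ E) (2 * hermiteR' L τ E x) x := by
      have h := (hasDerivAt_hermite R E x)
      have h1 := reCLM.hasFDerivAt.comp_hasDerivAt x h
      have h2 : (fun y => (hermite L τ E y).re) = hermiteR L τ E := by
        funext y; rw [hermite_ofReal R]; simp
      rw [hermite'_ofReal] at h1
      simpa [Function.comp_def, h2] using h1
    have hX' : HasDerivAt (hermiteR' L τ E) (hermiteR'' L τ E x) x := by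
      have h := (hasDerivAt_hermite' R E x)
      have h1 := reCLM.hasFDerivAt.comp_hasDerivAt x h
      have h2 : (fun y => (hermite' L τ E y).re) = hermiteR' L τ E := by
        funext y; rw [hermite'_ofReal]; simp
      rw [hermite''_ofReal R] at h1
      simpa [Function.comp_def, h2] using h1
    -- For `P(E) = 0` a zero of `X` is also a zero of `X'`. The eigenvalue equation `X v' = X' v /
    -- 2` is then empty at `x`, but its derivative still yields `X'' v = 0`.
    have h1 := (hX.mul (hv x).2).unique ((hX'.mul (hv x).1).congr_of_eventuallyEq
      (Eventually.of_forall ev))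
    have h2 := hermiteR_first_integral R E x
    rw [hx, hE] at h2
    have h3 : hermiteR' L τ E x = 0 := by
      have : hermiteR' L τ E x ^ 2 = 0 := by linarith
      exact pow_eq_zero_iff two_ne_zero |>.1 this
    rw [hx, h3] at h1
    have h4 : hermiteR'' L τ E x * v x = 0 := by linarith
    exact (mul_eq_zero.1 h4).resolve_left hx''

end

end DarbouxDisplacement

end

/-! ### The band structure: exclusion of the gaps by counting zeros. -/

noncomputable section

namespace DarbouxDisplacement

open Set Filter Topology PeriodPair PeriodPair.IsRect

/-- The frontier of a set with prescribed bands and gaps. -/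
lemma frontier_of_bands {S : Set ℝ} {a b c d e : ℝ} (hab : a < b) (hbc : b < c) (hcd : c < d)
    (hde : d < e) (h1 : ∀ x, a < x → x < b → x ∈ S) (h2 : ∀ x, c < x → x < d → x ∈ S)
    (h3 : ∀ x, e < x → x ∈ S) (g1 : ∀ x, x < a → x ∉ S) (g2 : ∀ x, b < x → x < c → x ∉ S)
    (g3 : ∀ x, d < x → x < e → x ∉ S) : frontier S = {a, b, c, d, e} := by
  have hin : ∀ {s : Set ℝ}, IsOpen s → s ⊆ S → ∀ x ∈ s, x ∉ frontier S := fun hs hsS x hx h =>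
    h.2 (interior_maximal hsS hs hx)
  have hout : ∀ {s : Set ℝ}, IsOpen s → (∀ x ∈ s, x ∉ S) → ∀ x ∈ s, x ∉ frontier S :=
    fun hs hsS x hx h => by
      rw [← frontier_compl] at h
      exact h.2 (interior_maximal (fun y hy => hsS y hy) hs hx)
  have hfr : ∀ {s t : Set ℝ} {x : ℝ}, s ⊆ S → (∀ y ∈ t, y ∉ S) → x ∈ closure s → x ∈ closure t →
      x ∈ frontier S := fun hs ht hxs hxt => by
    rw [frontier_eq_closure_inter_closure]
    exact ⟨closure_mono hs hxs, closure_mono (fun y hy => ht y hy) hxt⟩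
  have cIoo : ∀ {p q : ℝ}, p < q → p ∈ closure (Ioo p q) ∧ q ∈ closure (Ioo p q) := fun h => by
    rw [closure_Ioo h.ne]
    exact ⟨⟨le_rfl, h.le⟩, ⟨h.le, le_rfl⟩⟩
  ext x
  simp only [mem_insert_iff, mem_singleton_iff]
  constructor
  · intro hx
    by_contra! hne
    obtain ⟨na, nb, nc, nd, ne⟩ := hne
    rcases lt_or_gt_of_ne na with ha | ha
    · exact hout isOpen_Iio g1 x ha hx
    rcases lt_or_gt_of_ne nb with hb | hb
    · exact hin isOpen_Ioo (fun y hy => h1 y hy.1 hy.2) x ⟨ha, hb⟩ hx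
    rcases lt_or_gt_of_ne nc with hc | hc
    · exact hout isOpen_Ioo (fun y hy => g2 y hy.1 hy.2) x ⟨hb, hc⟩ hx
    rcases lt_or_gt_of_ne nd with hd | hd
    · exact hin isOpen_Ioo (fun y hy => h2 y hy.1 hy.2) x ⟨hc, hd⟩ hx
    rcases lt_or_gt_of_ne ne with he | he
    · exact hout isOpen_Ioo (fun y hy => g3 y hy.1 hy.2) x ⟨hd, he⟩ hx
    · exact hin isOpen_Ioi h3 x he hx
  · rintro (rfl | rfl | rfl | rfl | rfl)
    · exact hfr (s := Ioo x b) (t := Iio x) (fun y hy => h1 y hy.1 hy.2) (fun y hy => g1 y hy)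
        (cIoo hab).1 (by rw [closure_Iio]; exact self_mem_Iic)
    · exact hfr (fun y hy => h1 y hy.1 hy.2) (fun y hy => g2 y hy.1 hy.2) (cIoo hab).2 (cIoo hbc).1
    · exact hfr (fun y hy => h2 y hy.1 hy.2) (fun y hy => g2 y hy.1 hy.2) (cIoo hcd).1 (cIoo hbc).2
    · exact hfr (fun y hy => h2 y hy.1 hy.2) (fun y hy => g3 y hy.1 hy.2) (cIoo hcd).2 (cIoo hde).1
    · exact hfr (s := Ioi x) (t := Ioo d x) (fun y hy => h3 y hy) (fun y hy => g3 y hy.1 hy.2)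
        (by rw [closure_Ioi]; exact self_mem_Ici) (cIoo hde).2

section

variable {L : PeriodPair} {ω τ : ℝ} (R : L.IsRect ω τ)
include R

lemma g₂_eq_of_e₁ : L.g₂.re = 3 * L.e₁ ω ^ 2 + (L.e₂ ω τ - L.e₃ τ) ^ 2 := by
  rw [R.g₂_re]
  linear_combination (-3 * L.e₁ ω + - L.e₂ ω τ - L.e₃ τ) * R.vieta.1

lemma g₂_eq_of_e₂ : L.g₂.re = 3 * L.e₂ ω τ ^ 2 + (L.e₁ ω - L.e₃ τ) ^ 2 := by
  rw [R.g₂_re]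
  linear_combination (-3 * L.e₂ ω τ + - L.e₁ ω - L.e₃ τ) * R.vieta.1

lemma g₂_eq_of_e₃ : L.g₂.re = 3 * L.e₃ τ ^ 2 + (L.e₁ ω - L.e₂ ω τ) ^ 2 := by
  rw [R.g₂_re]
  linear_combination (-3 * L.e₃ τ + - L.e₂ ω τ - L.e₁ ω) * R.vieta.1

lemma g₂_pos : 0 < L.g₂.re := by
  rw [g₂_eq_of_e₁ R]
  have : 0 < L.e₂ ω τ - L.e₃ τ := by linarith [R.e₃_lt_e₂]
  positivity

lemma sq_sqrt_g₂ : √(3 * L.g₂.re) ^ 2 = 3 * L.g₂.re :=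
  Real.sq_sqrt (by linarith [g₂_pos R])

lemma sqrt_g₂_pos : 0 < √(3 * L.g₂.re) := Real.sqrt_pos.2 (by linarith [g₂_pos R])

lemma e₁_lt_sqrt : 3 * L.e₁ ω < √(3 * L.g₂.re) := by
  have h : 0 < L.e₂ ω τ - L.e₃ τ := by linarith [R.e₃_lt_e₂]
  refine Real.lt_sqrt_of_sq_lt ?_
  rw [g₂_eq_of_e₁ R]
  nlinarith

lemma neg_sqrt_lt_e₃ : -√(3 * L.g₂.re) < 3 * L.e₃ τ := by
  have h : 0 < L.e₁ ω - L.e₂ ω τ := by linarith [R.e₂_lt_e₁]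
  have : -(3 * L.e₃ τ) < √(3 * L.g₂.re) := by
    refine Real.lt_sqrt_of_sq_lt ?_
    rw [g₂_eq_of_e₃ R]
    nlinarith
  linarith

lemma spectralPolyR_eq (E : ℝ) : spectralPolyR L ω τ E =
    -((E + √(3 * L.g₂.re)) * (E - √(3 * L.g₂.re))) *
      ((E - 3 * L.e₁ ω) * (E - 3 * L.e₂ ω τ) * (E - 3 * L.e₃ τ)) := by
  rw [spectralPolyR]
  have := sq_sqrt_g₂ R
  linear_combination -(((E - 3 * L.e₁ ω) * (E - 3 * L.e₂ ω τ) * (E - 3 * L.e₃ τ))) * this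

/-- At the lowest edge `4X = (6p - √(3g₂))²` has no real zero, since `p ≤ e₂ < √(3g₂)/6`. The edge
solution is thus free of zeros, whereas Sturm comparison would give it one. -/
lemma not_allowed_below {E : ℝ} (hE : E < -√(3 * L.g₂.re)) :
    E ∉ allowedEnergies (lameInce L) (2 * ω) := fun h => by
  have h32 := R.e₃_lt_e₂
  have h21 := R.e₂_lt_e₁
  have hG := sqrt_g₂_pos R
  have h3 := neg_sqrt_lt_e₃ R
  have hG2 := sq_sqrt_g₂ R
  have hpos : 0 < spectralPolyR L ω τ E := by
    rw [spectralPolyR_eq R]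
    have p1 : 0 < (-(E + √(3 * L.g₂.re))) * (-(E - √(3 * L.g₂.re))) :=
      mul_pos (by linarith) (by linarith)
    have p2 : 0 < -(E - 3 * L.e₁ ω) * -(E - 3 * L.e₂ ω τ) * -(E - 3 * L.e₃ τ) :=
      mul_pos (mul_pos (by linarith) (by linarith)) (by linarith)
    nlinarith
  obtain ⟨s, s', hs, hs0, ha, hb⟩ := exists_solves_zero_zero R hpos h 0
  obtain ⟨v, v', hv, -, hz, -⟩ := exists_edge_solution R (E := -√(3 * L.g₂.re))
    (by rw [spectralPolyR_eq R]; ring)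
  obtain ⟨y, -, hy⟩ := sturm R hE hs hv hs0 (by linarith [R.ω_pos]) ha hb
  have h1 := hz y hy
  have h2 := (R.shiftedP_mem y).2
  have h4 : (6 * L.shiftedP τ y - √(3 * L.g₂.re)) ^ 2 = 0 := by
    rw [hermiteR] at h1
    linear_combination 4 * h1 - 3 * hG2
  have h5 : √(3 * L.g₂.re) = 6 * L.shiftedP τ y := by
    have := pow_eq_zero_iff two_ne_zero |>.1 h4
    linarith
  have h6 := g₂_eq_of_e₂ R
  have h7 := R.vieta.1
  have h8 : 0 < L.shiftedP τ y := by linarith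
  have h9 : L.shiftedP τ y ^ 2 ≤ L.e₂ ω τ ^ 2 := by nlinarith
  rw [h5] at hG2
  have h10 : L.e₁ ω - L.e₃ τ > 3 * L.e₂ ω τ := by linarith
  nlinarith

/-- At `3e₃` one has `X = 9(p - e₁)(p - e₂)`, so the lower edge solution vanishes at `±ω`. A
solution in the gap vanishing at `±ω` then has a third zero in between, and the upper edge solution
has two zeros in `(-ω, ω)`. But there `X = 9(p - e₁)(p - e₃)` vanishes only at 0. -/
lemma not_allowed_first_gap {E : ℝ} (hE : 3 * L.e₃ τ < E) (hE' : E < 3 * L.e₂ ω τ) :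
    E ∉ allowedEnergies (lameInce L) (2 * ω) := fun h => by
  have h32 := R.e₃_lt_e₂
  have h21 := R.e₂_lt_e₁
  have hG := sqrt_g₂_pos R
  have h3 := neg_sqrt_lt_e₃ R
  have h1 := e₁_lt_sqrt R
  have hω := R.ω_pos
  have hv0 := R.vieta.1
  have hpos : 0 < spectralPolyR L ω τ E := by
    rw [spectralPolyR_eq R]
    have p1 : 0 < (E + √(3 * L.g₂.re)) * (-(E - √(3 * L.g₂.re))) :=
      mul_pos (by linarith) (by linarith)
    have p2 : 0 < -(E - 3 * L.e₁ ω) * -(E - 3 * L.e₂ ω τ) * (E - 3 * L.e₃ τ) :=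
      mul_pos (mul_pos (by linarith) (by linarith)) (by linarith)
    nlinarith
  obtain ⟨s, s', hs, hs0, ha, hb⟩ := exists_solves_zero_zero R hpos h (-ω)
  obtain ⟨v, v', hv, hvne, -, hvz⟩ := exists_edge_solution R (E := 3 * L.e₃ τ)
    (by rw [spectralPolyR]; ring)
  obtain ⟨w, w', hw, -, hwz, -⟩ := exists_edge_solution R (E := 3 * L.e₂ ω τ)
    (by rw [spectralPolyR]; ring)
  have hb' : s ω = 0 := by rwa [show -ω + 2 * ω = ω by ring] at hb
  have zero_at : ∀ x, L.shiftedP τ x = L.e₂ ω τ → v x = 0 := fun x hx => by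
    apply hvz
    · rw [hermiteR, hx, g₂_eq_of_e₃ R]
      linear_combination (9 / 4) * (L.e₂ ω τ - L.e₁ ω + L.e₂ ω τ + L.e₂ ω τ + L.e₃ τ) * hv0
    · have h4 := R.shiftedP'_sq_eq_prod x
      rw [hx, sub_self] at h4
      rw [hermiteR'', h4, hx, g₂_eq_of_e₂ R]
      have e : 9 * (4 * (L.e₂ ω τ - L.e₁ ω) * 0 * (L.e₂ ω τ - L.e₃ τ)) +
          (9 * L.e₂ ω τ + 3 / 2 * (3 * L.e₃ τ)) * (6 * L.e₂ ω τ ^ 2 -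
            (3 * L.e₂ ω τ ^ 2 + (L.e₁ ω - L.e₃ τ) ^ 2) / 2)
          = 9 * ((L.e₂ ω τ - L.e₁ ω) ^ 2 * (L.e₂ ω τ - L.e₃ τ)) := by
        have e1 : L.e₁ ω = -L.e₂ ω τ - L.e₃ τ := by linarith
        rw [e1]; ring
      rw [e]
      have : 0 < (L.e₂ ω τ - L.e₁ ω) ^ 2 := by
        have : L.e₂ ω τ - L.e₁ ω ≠ 0 := by linarith
        positivity
      have h5 : 0 < L.e₂ ω τ - L.e₃ τ := by linarith
      positivity
  obtain ⟨x, hx, hsx⟩ := sturm R hE hv hs hvne (a := -ω) (b := ω) (by linarith)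
    (zero_at _ (by rw [R.shiftedP_neg, shiftedP_ω])) (zero_at _ shiftedP_ω)
  obtain ⟨y₁, hy₁, hw₁⟩ := sturm R hE' hs hw hs0 hx.1 ha hsx
  obtain ⟨y₂, hy₂, hw₂⟩ := sturm R hE' hs hw hs0 hx.2 hsx hb'
  have key : ∀ y, -ω < y → y < ω → w y = 0 → y = 0 := fun y h4 h5 h6 => by
    have h7 := hwz y h6
    have h8 : (L.shiftedP τ y - L.e₁ ω) * (L.shiftedP τ y - L.e₃ τ) = 0 := by
      rw [hermiteR, g₂_eq_of_e₂ R] at h7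
      have e1 : L.e₂ ω τ = -L.e₁ ω - L.e₃ τ := by linarith
      rw [e1] at h7
      linear_combination h7 / 9
    have h9 : L.shiftedP τ y = L.shiftedP τ 0 := by
      rw [shiftedP_zero]
      have := (R.shiftedP_mem y).2
      rcases mul_eq_zero.1 h8 with h | h <;> linarith
    have h10 : L.shiftedP τ |y| = L.shiftedP τ 0 := by
      rcases abs_choice y with h | h <;> rw [h]
      · exact h9
      · rw [R.shiftedP_neg, h9]
    exact abs_eq_zero.1 (R.injOn_shiftedP ⟨abs_nonneg y, (abs_lt.2 ⟨h4, h5⟩).le⟩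
      ⟨le_rfl, hω.le⟩ h10)
  have z1 := key y₁ hy₁.1 (hy₁.2.trans hx.2) hw₁
  have z2 := key y₂ (hx.1.trans hy₂.1) hy₂.2 hw₂
  linarith [hy₁.2, hy₂.1]

/-- At `3e₁` one has `X = 9(p - e₂)(p - e₃)`, so the lower edge solution vanishes at `0`, `ω` and
`2ω`. Two comparisons give the upper edge solution three zeros in `(0, 2ω)`. There `4X = (6p +
√(3g₂))²`, and `p` takes each value at most once on each half period. -/
lemma not_allowed_second_gap {E : ℝ} (hE : 3 * L.e₁ ω < E) (hE' : E < √(3 * L.g₂.re)) :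
    E ∉ allowedEnergies (lameInce L) (2 * ω) := fun h => by
  have h32 := R.e₃_lt_e₂
  have h21 := R.e₂_lt_e₁
  have hG := sqrt_g₂_pos R
  have h3 := neg_sqrt_lt_e₃ R
  have h1 := e₁_lt_sqrt R
  have hω := R.ω_pos
  have hv0 := R.vieta.1
  have hG2 := sq_sqrt_g₂ R
  have hpos : 0 < spectralPolyR L ω τ E := by
    rw [spectralPolyR_eq R]
    have p1 : 0 < (E + √(3 * L.g₂.re)) * (-(E - √(3 * L.g₂.re))) :=
      mul_pos (by linarith) (by linarith)
    have p2 : 0 < (E - 3 * L.e₁ ω) * (E - 3 * L.e₂ ω τ) * (E - 3 * L.e₃ τ) :=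
      mul_pos (mul_pos (by linarith) (by linarith)) (by linarith)
    nlinarith
  obtain ⟨s, s', hs, hs0, ha, hb⟩ := exists_solves_zero_zero R hpos h 0
  rw [zero_add] at hb
  obtain ⟨v, v', hv, hvne, -, hvz⟩ := exists_edge_solution R (E := 3 * L.e₁ ω)
    (by rw [spectralPolyR]; ring)
  obtain ⟨w, w', hw, -, hwz, -⟩ := exists_edge_solution R (E := √(3 * L.g₂.re))
    (by rw [spectralPolyR_eq R]; ring)
  have e1 : L.e₁ ω = -L.e₂ ω τ - L.e₃ τ := by linarith
  have zero_at₂ : v ω = 0 := by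
    have hx : L.shiftedP τ ω = L.e₂ ω τ := shiftedP_ω
    apply hvz
    · rw [hermiteR, hx, g₂_eq_of_e₁ R, e1]
      ring
    · have h4 := R.shiftedP'_sq_eq_prod ω
      rw [hx, sub_self] at h4
      rw [hermiteR'', h4, hx, g₂_eq_of_e₂ R]
      have e : 9 * (4 * (L.e₂ ω τ - L.e₁ ω) * 0 * (L.e₂ ω τ - L.e₃ τ)) +
          (9 * L.e₂ ω τ + 3 / 2 * (3 * L.e₁ ω)) * (6 * L.e₂ ω τ ^ 2 -
            (3 * L.e₂ ω τ ^ 2 + (L.e₁ ω - L.e₃ τ) ^ 2) / 2)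
          = -(9 * ((L.e₂ ω τ - L.e₃ τ) ^ 2 * (L.e₁ ω - L.e₂ ω τ))) := by
        rw [e1]; ring
      rw [e]
      have h5 : 0 < L.e₂ ω τ - L.e₃ τ := by linarith
      have h6 : 0 < L.e₁ ω - L.e₂ ω τ := by linarith
      exact neg_ne_zero.2 (by positivity)
  have zero_at₃ : ∀ x, L.shiftedP τ x = L.e₃ τ → v x = 0 := fun x hx => by
    apply hvz
    · rw [hermiteR, hx, g₂_eq_of_e₁ R, e1]
      ring
    · have h4 := R.shiftedP'_sq_eq_prod x
      rw [hx, sub_self] at h4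
      rw [hermiteR'', h4, hx, g₂_eq_of_e₃ R]
      have e : 9 * (4 * (L.e₃ τ - L.e₁ ω) * (L.e₃ τ - L.e₂ ω τ) * 0) +
          (9 * L.e₃ τ + 3 / 2 * (3 * L.e₁ ω)) * (6 * L.e₃ τ ^ 2 -
            (3 * L.e₃ τ ^ 2 + (L.e₁ ω - L.e₂ ω τ) ^ 2) / 2)
          = -(9 * ((L.e₂ ω τ - L.e₃ τ) ^ 2 * (L.e₁ ω - L.e₃ τ))) := by
        rw [e1]; ring
      rw [e]
      have h5 : 0 < L.e₂ ω τ - L.e₃ τ := by linarith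
      have h6 : 0 < L.e₁ ω - L.e₃ τ := by linarith
      exact neg_ne_zero.2 (by positivity)
  have z0 : v 0 = 0 := zero_at₃ 0 shiftedP_zero
  have z2 : v (2 * ω) = 0 := zero_at₃ _ (by
    rw [← zero_add (2 * ω), R.shiftedP_add, shiftedP_zero])
  obtain ⟨x₁, hx₁, hs₁⟩ := sturm R hE hv hs hvne hω z0 zero_at₂
  obtain ⟨x₂, hx₂, hs₂⟩ := sturm R hE hv hs hvne (by linarith) zero_at₂ z2
  obtain ⟨y₁, hy₁, hw₁⟩ := sturm R hE' hs hw hs0 hx₁.1 ha hs₁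
  obtain ⟨y₂, hy₂, hw₂⟩ := sturm R hE' hs hw hs0 (hx₁.2.trans hx₂.1) hs₁ hs₂
  obtain ⟨y₃, hy₃, hw₃⟩ := sturm R hE' hs hw hs0 hx₂.2 hs₂ hb
  have key : ∀ y, w y = 0 → L.shiftedP τ y = -(√(3 * L.g₂.re) / 6) := fun y hy => by
    have h4 := hwz y hy
    have h5 : (6 * L.shiftedP τ y + √(3 * L.g₂.re)) ^ 2 = 0 := by
      rw [hermiteR] at h4
      linear_combination 4 * h4 - 3 * hG2
    have := pow_eq_zero_iff two_ne_zero |>.1 h5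
    linarith
  have k1 := key _ hw₁
  have k2 := key _ hw₂
  have k3 := key _ hw₃
  rcases le_or_gt y₂ ω with h4 | h4
  · have := R.injOn_shiftedP (show y₁ ∈ Icc 0 ω from ⟨hy₁.1.le, (hy₁.2.trans hx₁.2).le⟩)
      (show y₂ ∈ Icc 0 ω from ⟨(hx₁.1.trans hy₂.1).le, h4⟩) (k1.trans k2.symm)
    linarith [hy₁.2, hy₂.1]
  · have := R.injOn_shiftedP
      (show 2 * ω - y₂ ∈ Icc 0 ω from ⟨by linarith [hy₂.2, hx₂.2], by linarith⟩)
      (show 2 * ω - y₃ ∈ Icc 0 ω from ⟨by linarith [hy₃.2], by linarith [hy₃.1, hx₂.1]⟩)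
      (by rw [R.shiftedP_two_ω_sub, R.shiftedP_two_ω_sub, k2, k3])
    linarith [hy₂.2, hy₃.1]

/-- The band structure of the potential. -/
theorem bandEdges_lameInce : bandEdges (lameInce L) (2 * ω) =
    {-√(3 * L.g₂.re), 3 * L.e₃ τ, 3 * L.e₂ ω τ, 3 * L.e₁ ω, √(3 * L.g₂.re)} := by
  have h32 := R.e₃_lt_e₂
  have h21 := R.e₂_lt_e₁
  have hG := sqrt_g₂_pos R
  have h3 := neg_sqrt_lt_e₃ R
  have h1 := e₁_lt_sqrt R
  refine frontier_of_bands h3 (by linarith) (by linarith) h1 (fun E a b => ?_) (fun E a b => ?_)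
    (fun E a => ?_) (fun E a => not_allowed_below R a) (fun E a b => not_allowed_first_gap R a b)
    (fun E a b => not_allowed_second_gap R a b)
  · refine mem_allowedEnergies R ?_
    rw [spectralPolyR_eq R]
    have p1 : 0 < (E + √(3 * L.g₂.re)) * (-(E - √(3 * L.g₂.re))) :=
      mul_pos (by linarith) (by linarith)
    have p2 : 0 < -(E - 3 * L.e₁ ω) * -(E - 3 * L.e₂ ω τ) * -(E - 3 * L.e₃ τ) :=
      mul_pos (mul_pos (by linarith) (by linarith)) (by linarith)
    nlinarith
  · refine mem_allowedEnergies R ?_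
    rw [spectralPolyR_eq R]
    have p1 : 0 < (E + √(3 * L.g₂.re)) * (-(E - √(3 * L.g₂.re))) :=
      mul_pos (by linarith) (by linarith)
    have p2 : 0 < -(E - 3 * L.e₁ ω) * (E - 3 * L.e₂ ω τ) * (E - 3 * L.e₃ τ) :=
      mul_pos (mul_pos (by linarith) (by linarith)) (by linarith)
    nlinarith
  · refine mem_allowedEnergies R ?_
    rw [spectralPolyR_eq R]
    have p1 : 0 < (E + √(3 * L.g₂.re)) * (E - √(3 * L.g₂.re)) :=
      mul_pos (by linarith) (by linarith)
    have p2 : 0 < (E - 3 * L.e₁ ω) * (E - 3 * L.e₂ ω τ) * (E - 3 * L.e₃ τ) :=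
      mul_pos (mul_pos (by linarith) (by linarith)) (by linarith)
    nlinarith

end

end DarbouxDisplacement

end

/-! ### Necessity: a displacement determines the factorization constants. -/

noncomputable section

namespace DarbouxDisplacement

open Set Filter Topology PeriodPair PeriodPair.IsRect

/-- The slope of the chord through the points of the elliptic curve with parameters `x + i τ` and
`d`, as a function of the real variable. -/
def slope (L : PeriodPair) (τ : ℝ) (d : ℂ) (x : ℝ) : ℂ := L.chord (x + τ * I) d

/-- The displaced function `℘ (x + i τ + d)` of the real variable. -/
def displaced (L : PeriodPair) (τ : ℝ) (d : ℂ) (x : ℝ) : ℂ := L.weierstrassP (x + τ * I + d)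

lemma countable_add_mem_lattice (L : PeriodPair) (a : ℂ) :
    {x : ℝ | (x : ℂ) + a ∈ L.lattice}.Countable :=
  L.countable_lattice.preimage_of_injOn (f := fun x : ℝ => (x : ℂ) + a)
    (fun x _ y _ h => by simpa using h)

/-- The derivative of a Wronskian. -/
lemma hasDerivAt_wronskian {Q : ℝ → ℂ} {b₁ b₂ : ℂ} {u₁ u₂ : ℝ → ℂ}
    (h₁ : Solves (fun x => Q x - b₁) u₁ (deriv u₁)) (h₂ : Solves (fun x => Q x - b₂) u₂ (deriv u₂))
    (x : ℝ) : HasDerivAt (wronskian u₁ u₂) ((b₁ - b₂) * (u₁ x * u₂ x)) x := by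
  refine (((h₁ x).1.mul (h₂ x).2).sub ((h₁ x).2.mul (h₂ x).1)).congr_deriv ?_
  ring

section

variable {L : PeriodPair} {ω τ : ℝ} (R : L.IsRect ω τ) {d : ℂ} (hd : d ∉ L.lattice)
include R

lemma lameInce_add (x : ℝ) : lameInce L (x + d) = 6 * displaced L τ d x := by
  rw [lameInce, displaced, R.ω₂_eq]
  congr 2
  ring

lemma analyticAt_lameInce_iff {x : ℝ} :
    AnalyticAt ℂ (lameInce L) (x + d) ↔ (x : ℂ) + τ * I + d ∉ L.lattice := by
  have e : (x : ℂ) + d + L.ω₂ / 2 = x + τ * I + d := by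
    rw [R.ω₂_eq]
    ring
  constructor
  · intro h hm
    refine L.not_continuousAt_weierstrassP _ hm ?_
    have h1 : ContinuousAt (fun w => lameInce L (w - L.ω₂ / 2) / 6) ((x : ℂ) + τ * I + d) := by
      refine ContinuousAt.div_const (ContinuousAt.comp (g := lameInce L) ?_ (by fun_prop)) 6
      rw [← e, add_sub_cancel_right]
      exact h.continuousAt
    simpa [lameInce] using h1
  · intro h
    have h1 : AnalyticAt ℂ L.weierstrassP ((x : ℂ) + d + L.ω₂ / 2) := by
      rw [e]
      exact L.analyticOnNhd_weierstrassP _ h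
    exact analyticAt_const.mul (h1.comp (f := fun w => w + L.ω₂ / 2)
      (analyticAt_id.add analyticAt_const))

lemma wp_eq (x : ℝ) : wp L τ x = L.weierstrassP (x + τ * I) := R.ofReal_shiftedP x

lemma wp'_eq (x : ℝ) : wp' L τ x = L.derivWeierstrassP (x + τ * I) := R.ofReal_shiftedP' x

lemma countable_wp_eq (c : ℂ) : {x : ℝ | wp L τ x = c}.Countable :=
  (countable_fiber L (τ * I) c).mono fun x (hx : wp L τ x = c) => by
    exact ⟨R.shifted_notMem x, by rw [← hx, wp_eq R]⟩

omit R in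
lemma hasDerivAt_displaced {x : ℝ} (hx : (x : ℂ) + τ * I + d ∉ L.lattice) :
    HasDerivAt (displaced L τ d) (L.derivWeierstrassP (x + τ * I + d)) x := by
  exact (((hasDerivAt_weierstrassP hx).comp_add_const (x + τ * I : ℂ) d).comp_add_const
    (x : ℂ) (τ * I)).comp_ofReal

omit R in
lemma eventually_add_notMem {x : ℝ} (hx : (x : ℂ) + τ * I + d ∉ L.lattice) :
    ∀ᶠ y : ℝ in 𝓝 x, (y : ℂ) + τ * I + d ∉ L.lattice :=
  ContinuousAt.eventually_mem (f := fun y : ℝ => (y : ℂ) + τ * I + d) (by fun_prop)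
    (L.isOpen_compl_lattice.mem_nhds hx)

include hd

lemma wp'_sq_sub (x : ℝ) : wp' L τ x ^ 2 - L.derivWeierstrassP d ^ 2 =
    (wp L τ x - L.weierstrassP d) *
      (4 * (wp L τ x ^ 2 + wp L τ x * L.weierstrassP d + L.weierstrassP d ^ 2) - L.g₂) := by
  linear_combination wp'_sq R x - L.derivWeierstrassP_sq d hd

omit hd in
lemma slope_mul {x : ℝ} (h : wp L τ x ≠ L.weierstrassP d) :
    2 * slope L τ d x * (wp L τ x - L.weierstrassP d) = wp' L τ x - L.derivWeierstrassP d := by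
  have : wp L τ x - L.weierstrassP d ≠ 0 := sub_ne_zero.2 h
  rw [slope, chord, ← wp_eq R, ← wp'_eq R]
  field_simp

lemma hasDerivAt_slope {x : ℝ} (h : wp L τ x ≠ L.weierstrassP d) :
    HasDerivAt (slope L τ d) (2 * wp L τ x + L.weierstrassP d - slope L τ d x ^ 2) x := by
  rw [wp_eq R] at *
  exact ((hasDerivAt_chord_left (R.shifted_notMem x) hd h).comp_add_const
    (x : ℂ) (τ * I)).comp_ofReal

lemma slope_sq {x : ℝ} (h : wp L τ x ≠ L.weierstrassP d)
    (hx : (x : ℂ) + τ * I + d ∉ L.lattice) :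
    slope L τ d x ^ 2 = wp L τ x + L.weierstrassP d + displaced L τ d x := by
  have h1 := weierstrassP_addition (R.shifted_notMem x) hd hx
  rw [← wp_eq R, ← wp'_eq R, ← slope_mul R h] at h1
  have : wp L τ x - L.weierstrassP d ≠ 0 := sub_ne_zero.2 h
  apply mul_left_cancel₀ (pow_ne_zero 2 this)
  rw [displaced]
  linear_combination h1 / 4

/-- The quartic equation relating the slope and its derivative. -/
lemma slope_quartic {x : ℝ} (h : wp L τ x ≠ L.weierstrassP d) :
    (2 * wp L τ x + L.weierstrassP d - slope L τ d x ^ 2) ^ 2 =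
      slope L τ d x ^ 4 - 6 * L.weierstrassP d * slope L τ d x ^ 2
        + 4 * L.derivWeierstrassP d * slope L τ d x + L.g₂ - 3 * L.weierstrassP d ^ 2 := by
  -- Eliminating `p'` through the chord and cancelling `p - ℘(d)` leaves a quadratic equation for
  -- `p` over polynomials in the slope; the claim is its completed square.
  have h1 := wp'_sq_sub R hd x
  have h2 := slope_mul R h
  have : wp L τ x - L.weierstrassP d ≠ 0 := sub_ne_zero.2 h
  apply mul_left_cancel₀ this
  linear_combination -h1 - (2 * slope L τ d x * (wp L τ x - L.weierstrassP d)
    + wp' L τ x + L.derivWeierstrassP d) * h2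

/-- Equal values of `℘` force `2(x + iτ) + d` into the lattice, as `d` itself is not there. -/
lemma countable_wp_eq_displaced : {x : ℝ | (x : ℂ) + τ * I + d ∉ L.lattice ∧
    wp L τ x = displaced L τ d x}.Countable := by
  have hc : {x : ℝ | 2 * ((x : ℂ) + τ * I) + d ∈ L.lattice}.Countable :=
    L.countable_lattice.preimage_of_injOn (f := fun x : ℝ => 2 * ((x : ℂ) + τ * I) + d)
      (fun x _ y _ h => by simpa using h)
  refine hc.mono fun x hx => ?_
  have h1 : L.weierstrassP (x + τ * I) = L.weierstrassP (x + τ * I + d) := by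
    rw [← wp_eq R]
    exact hx.2
  rcases sub_mem_or_add_mem_of_weierstrassP_eq (R.shifted_notMem x) hx.1 h1 with h | h
  · rw [sub_add_cancel_left, neg_mem_iff] at h
    exact absurd h hd
  · change 2 * ((x : ℂ) + τ * I) + d ∈ L.lattice
    convert h using 1
    ring

omit hd in
/-- There is an interval on which the slope and the displaced function are regular. -/
lemma exists_regular_interval (d : ℂ) : ∃ a b : ℝ, a < b ∧ ∀ x ∈ Ioo a b,
    wp L τ x ≠ L.weierstrassP d ∧ (x : ℂ) + τ * I + d ∉ L.lattice := by
  obtain ⟨x, hx⟩ := ((countable_wp_eq R (L.weierstrassP d)).union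
    (countable_add_mem_lattice L (τ * I + d))).dense_compl ℝ |>.nonempty
  simp only [mem_compl_iff, mem_union, mem_ofPred_eq, not_or, ← add_assoc] at hx
  have h1 : ∀ᶠ y in 𝓝 x, wp L τ y ≠ L.weierstrassP d :=
    (hasDerivAt_wp R x).continuousAt.eventually_ne hx.1
  obtain ⟨ε, hε, h⟩ := Metric.eventually_nhds_iff_ball.1 (h1.and (eventually_add_notMem hx.2))
  rw [Real.ball_eq_Ioo] at h
  exact ⟨x - ε, x + ε, by linarith, h⟩

/-- A connected set with two points is infinite. A constant slope would have `ℓ' = p - ℘(x + iτ + d)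
= 0` on a whole interval, against countability of the coincidences. -/
lemma infinite_slope_image {a b : ℝ} (hab : a < b) (h : ∀ x ∈ Ioo a b,
    wp L τ x ≠ L.weierstrassP d ∧ (x : ℂ) + τ * I + d ∉ L.lattice) :
    (slope L τ d '' Ioo a b).Infinite := by
  have hc : IsPreconnected (slope L τ d '' Ioo a b) :=
    isPreconnected_Ioo.image _ fun x hx =>
      (hasDerivAt_slope R hd (h x hx).1).continuousAt.continuousWithinAt
  refine hc.infinite_of_nontrivial ?_
  by_contra hn
  rw [not_nontrivial_iff] at hn
  have he : ∀ x ∈ Ioo a b, wp L τ x = displaced L τ d x := fun x hx => by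
    have h1 : HasDerivAt (slope L τ d) 0 x :=
      (hasDerivAt_const x (slope L τ d x)).congr_of_eventuallyEq (by
        filter_upwards [isOpen_Ioo.mem_nhds hx] with y hy using
          hn (mem_image_of_mem _ hy) (mem_image_of_mem _ hx))
    have h2 := h1.unique (hasDerivAt_slope R hd (h x hx).1)
    rw [slope_sq R hd (h x hx).1 (h x hx).2] at h2
    linear_combination -h2
  have := (countable_wp_eq_displaced R hd).mono (s₁ := Ioo a b)
    fun x hx => by exact ⟨(h x hx).2, he x hx⟩
  rw [Cardinal.Real.Ioo_countable_iff] at this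
  exact absurd hab this.not_gt

/-- If the transformation displaces the potential on an interval, then the eigenvalues are
determined by the displacement. -/
lemma sum_and_diff_of_displacement {a b : ℝ} (hab : a < b) (h : ∀ x ∈ Ioo a b,
    wp L τ x ≠ L.weierstrassP d ∧ (x : ℂ) + τ * I + d ∉ L.lattice) {b₁ b₂ : ℂ} {u₁ u₂ : ℝ → ℂ}
    (h₁ : Solves (fun x => 6 * wp L τ x - b₁) u₁ (deriv u₁))
    (h₂ : Solves (fun x => 6 * wp L τ x - b₂) u₂ (deriv u₂))
    (hW : ∀ x ∈ Ioo a b, wronskian u₁ u₂ x ≠ 0 ∧ 6 * wp L τ x - 2 * deriv (fun y : ℝ =>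
      deriv (wronskian u₁ u₂) y / wronskian u₁ u₂ y) x = 6 * displaced L τ d x) :
    b₁ ≠ b₂ ∧ b₁ + b₂ = -3 * L.weierstrassP d ∧
      (b₁ - b₂) ^ 2 = 9 * (L.g₂ - 3 * L.weierstrassP d ^ 2) := by
  set W := wronskian u₁ u₂ with hWdef
  set D := L.weierstrassP d with hD
  set D' := L.derivWeierstrassP d with hD'
  have hdW : ∀ x, HasDerivAt W ((b₁ - b₂) * (u₁ x * u₂ x)) x := hasDerivAt_wronskian h₁ h₂
  have hdW' : deriv W = fun x => (b₁ - b₂) * (u₁ x * u₂ x) := funext fun x => (hdW x).deriv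
  rw [hdW'] at hW
  have hsl : ∀ x ∈ Ioo a b, HasDerivAt (slope L τ d) (wp L τ x - displaced L τ d x) x :=
    fun x hx => by
      refine (hasDerivAt_slope R hd (h x hx).1).congr_deriv ?_
      rw [slope_sq R hd (h x hx).1 (h x hx).2]
      ring
  -- the logarithmic derivative of the Wronskian is the slope up to a constant
  have hf : ∀ x, HasDerivAt (fun x => u₁ x * u₂ x) (deriv u₁ x * u₂ x + u₁ x * deriv u₂ x) x :=
    fun x => (h₁ x).1.mul (h₂ x).1
  obtain ⟨κ, hκ⟩ : ∃ κ, ∀ x ∈ Ioo a b,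
      (b₁ - b₂) * (u₁ x * u₂ x) = 3 * (slope L τ d x + κ) * W x := by
    have hdiff : ∀ x ∈ Ioo a b, HasDerivAt
        (fun x => (b₁ - b₂) * (u₁ x * u₂ x) / W x - 3 * slope L τ d x) 0 x := fun x hx => by
      have e1 : DifferentiableAt ℝ (fun x => (b₁ - b₂) * (u₁ x * u₂ x) / W x) x :=
        ((hf x).const_mul _).differentiableAt.div (hdW x).differentiableAt (hW x hx).1
      refine (e1.hasDerivAt.fun_sub ((hsl x hx).const_mul 3)).congr_deriv ?_
      linear_combination -(hW x hx).2 / 2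
    have hm : (a + b) / 2 ∈ Ioo a b := ⟨by linarith, by linarith⟩
    refine ⟨((b₁ - b₂) * (u₁ ((a + b) / 2) * u₂ ((a + b) / 2)) / W ((a + b) / 2)
      - 3 * slope L τ d ((a + b) / 2)) / 3, fun x hx => ?_⟩
    have := isOpen_Ioo.is_const_of_deriv_eq_zero isPreconnected_Ioo
      (fun y hy => (hdiff y hy).differentiableAt.differentiableWithinAt)
      (fun y hy => (hdiff y hy).deriv) hx hm
    rw [← this]
    have := (hW x hx).1
    field_simp
    ring
  set s : ℂ := b₁ + b₂ with hs
  set δ : ℂ := b₁ - b₂ with hδ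
  have hinf := infinite_slope_image R hd hab h
  -- the polynomial equation satisfied by the slope
  have hpoly : ∀ x ∈ Ioo a b, 144 * κ * slope L τ d x ^ 3
      + (378 * κ ^ 2 + 9 * (12 * D + 2 * s) - 54 * D) * slope L τ d x ^ 2
      + (324 * κ ^ 3 + 18 * κ * (12 * D + 2 * s) - 108 * D * κ) * slope L τ d x
      + (81 * κ ^ 4 + 9 * κ ^ 2 * (12 * D + 2 * s) + 36 * κ * D' - 9 * (L.g₂ - 3 * D ^ 2) + δ ^ 2)
      = 0 := fun x hx => by
    have hq := slope_quartic R hd (h x hx).1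
    have hsl1 : ∀ x ∈ Ioo a b, HasDerivAt (slope L τ d)
        (2 * wp L τ x + D - slope L τ d x ^ 2) x := fun x hx => hasDerivAt_slope R hd (h x hx).1
    have d1 : ∀ x ∈ Ioo a b, δ * (deriv u₁ x * u₂ x + u₁ x * deriv u₂ x) =
        (3 * (2 * wp L τ x + D - slope L τ d x ^ 2) + 9 * (slope L τ d x + κ) ^ 2) * W x :=
      fun x hx => by
        have e1 := (hf x).const_mul δ
        have e2 := ((((hsl1 x hx).add_const κ).const_mul 3).mul (hdW x)).congr_of_eventuallyEq
          (f₁ := fun x => δ * (u₁ x * u₂ x))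
          (by filter_upwards [isOpen_Ioo.mem_nhds hx] with y hy using hκ y hy)
        rw [e1.unique e2, hκ x hx]
        ring
    have d2 : δ * (2 * (deriv u₁ x * deriv u₂ x) + (12 * wp L τ x - s) * (u₁ x * u₂ x)) =
        (3 * (2 * wp' L τ x - 2 * slope L τ d x * (2 * wp L τ x + D - slope L τ d x ^ 2))
          + 18 * (slope L τ d x + κ) * (2 * wp L τ x + D - slope L τ d x ^ 2)
          + (3 * (2 * wp L τ x + D - slope L τ d x ^ 2) + 9 * (slope L τ d x + κ) ^ 2) *
            (3 * (slope L τ d x + κ))) * W x := by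
      have e1 := (((h₁ x).2.mul (h₂ x).1).add ((h₁ x).1.mul (h₂ x).2)).const_mul δ
      have l1 := hsl1 x hx
      have e2 := ((((((hasDerivAt_wp R x).const_mul 2).add_const D).sub (l1.pow 2)).const_mul
        3).add (((l1.add_const κ).pow 2).const_mul 9)).mul (hdW x)
      have e3 := e2.congr_of_eventuallyEq
        (f₁ := fun x => δ * (deriv u₁ x * u₂ x + u₁ x * deriv u₂ x))
        (by filter_upwards [isOpen_Ioo.mem_nhds hx] with y hy using d1 y hy)
      have e4 := e1.unique e3
      simp only [Pi.add_apply, Pi.sub_apply, Pi.pow_apply] at e4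
      rw [hκ x hx] at e4
      norm_num at e4
      linear_combination e4
    have d0 := hκ x hx
    have d1 := d1 x hx
    have hWx := (hW x hx).1
    have hWe : W x = u₁ x * deriv u₂ x - deriv u₁ x * u₂ x := rfl
    have hsm := slope_mul R (h x hx).1
    rw [← hD, ← hD'] at hq hsm
    generalize slope L τ d x = l at *
    generalize wp L τ x = p at *
    generalize wp' L τ x = p' at *
    generalize W x = w at *
    generalize deriv u₁ x = v₁ at *
    generalize deriv u₂ x = v₂ at *
    generalize u₁ x = y₁ at *
    generalize u₂ x = y₂ at *
    -- For `f = u₁u₂` one has `f'² - W² = 4 u₁u₂u₁'u₂'` and `f'' = 2u₁'u₂' + (12p - s)f`.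
    -- Eliminating `u₁'u₂'` relates `f`, `f'`, `f''` and `W`; inserting the expressions in the
    -- slope, `W²` factors out.
    have key : (δ * (y₁ * y₂)) * (δ * (2 * (v₁ * v₂) + (12 * p - s) * (y₁ * y₂))) * 2
        - 2 * (12 * p - s) * (δ * (y₁ * y₂)) ^ 2
        = (δ * (v₁ * y₂ + y₁ * v₂)) ^ 2 - δ ^ 2 * w ^ 2 := by
      rw [hWe]
      ring
    rw [d0, d1, d2] at key
    have hp' : p' = D' + 2 * l * (p - D) := by linear_combination -hsm
    rw [hp'] at key
    apply mul_left_cancel₀ (pow_ne_zero 2 hWx)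
    linear_combination key + 9 * w ^ 2 * hq
  -- The cubic coefficient gives `κ = 0`; then the quadratic and constant ones give the sum and the
  -- squared difference. The linear coefficient carries no further information and is left opaque.
  obtain ⟨c3, c2, c0⟩ : κ = 0 ∧ s = -3 * D ∧ δ ^ 2 = 9 * (L.g₂ - 3 * D ^ 2) := by
    generalize 324 * κ ^ 3 + 18 * κ * (12 * D + 2 * s) - 108 * D * κ = k₁ at hpoly
    have hP : (Polynomial.C (144 * κ) * Polynomial.X ^ 3
        + Polynomial.C (378 * κ ^ 2 + 9 * (12 * D + 2 * s) - 54 * D) * Polynomial.X ^ 2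
        + Polynomial.C k₁ * Polynomial.X
        + Polynomial.C (81 * κ ^ 4 + 9 * κ ^ 2 * (12 * D + 2 * s) + 36 * κ * D'
          - 9 * (L.g₂ - 3 * D ^ 2) + δ ^ 2) : Polynomial ℂ) = 0 := by
      refine Polynomial.eq_zero_of_infinite_isRoot _ (hinf.mono ?_)
      rintro _ ⟨x, hx, rfl⟩
      have := hpoly x hx
      simpa [Polynomial.IsRoot] using this
    have k3 := congrArg (fun f => Polynomial.coeff f 3) hP
    have k2 := congrArg (fun f => Polynomial.coeff f 2) hP
    have k0 := congrArg (fun f => Polynomial.coeff f 0) hP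
    simp [-map_add, -map_sub, -map_mul, -map_pow, Polynomial.coeff_X, Polynomial.coeff_C]
      at k3 k2 k0
    subst k3
    refine ⟨rfl, ?_, ?_⟩
    · linear_combination k2 / 18
    · linear_combination k0
  refine ⟨fun hb => ?_, c2, c0⟩
  -- Equal eigenvalues would make `W' = 0`, hence the slope identically zero.
  refine hinf ((finite_singleton (0 : ℂ)).subset ?_)
  rintro _ ⟨x, hx, rfl⟩
  have := hκ x hx
  rw [hδ, hb, sub_self, zero_mul, c3, add_zero] at this
  simpa [(hW x hx).1] using this.symm

end

end DarbouxDisplacement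

end

/-! ### Sufficiency: Bloch solutions that realize a displacement. -/

noncomputable section

namespace DarbouxDisplacement

open Set Filter Topology PeriodPair PeriodPair.IsRect

lemma sqrt_sq (c : ℂ) : (c ^ (1 / 2 : ℂ)) ^ 2 = c := by
  rw [one_div, ← Nat.cast_ofNat (R := ℂ), cpow_nat_inv_pow _ two_ne_zero]

/-- The two functions `a₁ (d)` and `a₂ (d)` are characterized by their sum and their difference. -/
lemma sum_diff_iff (L : PeriodPair) (d b₁ b₂ : ℂ) :
    (b₁ + b₂ = -3 * L.weierstrassP d ∧ (b₁ - b₂) ^ 2 = 9 * (L.g₂ - 3 * L.weierstrassP d ^ 2)) ↔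
      (b₁ = factorConst₁ L d ∧ b₂ = factorConst₂ L d) ∨
        (b₁ = factorConst₂ L d ∧ b₂ = factorConst₁ L d) := by
  have hr := sqrt_sq (L.g₂ - 3 * L.weierstrassP d ^ 2)
  rw [factorConst₁, factorConst₂]
  generalize (L.g₂ - 3 * L.weierstrassP d ^ 2) ^ (1 / 2 : ℂ) = r at *
  rw [← hr]
  constructor
  · rintro ⟨h1, h2⟩
    have h3 : (b₁ - b₂ - 3 * r) * (b₁ - b₂ + 3 * r) = 0 := by linear_combination h2
    rcases mul_eq_zero.1 h3 with h | h
    · left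
      constructor
      · linear_combination h1 / 2 + h / 2
      · linear_combination h1 / 2 - h / 2
    · right
      constructor
      · linear_combination h1 / 2 + h / 2
      · linear_combination h1 / 2 - h / 2
  · rintro (⟨rfl, rfl⟩ | ⟨rfl, rfl⟩) <;> constructor <;> ring

/-- A solution of a homogeneous linear equation of first order that vanishes at a point vanishes
nearby. -/
lemma eventually_eq_zero_of_hasDerivAt {W m : ℝ → ℂ} {x : ℝ} (hm : ContinuousAt m x)
    (h : ∀ᶠ y in 𝓝 x, HasDerivAt W (m y * W y) y) (h0 : W x = 0) : ∀ᶠ y in 𝓝 x, W y = 0 := by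
  have hb : ∀ᶠ y in 𝓝 x, ‖m y‖ < ‖m x‖ + 1 :=
    hm.norm.eventually_lt continuousAt_const (by linarith)
  obtain ⟨ε, hε, hball⟩ := Metric.eventually_nhds_iff_ball.1 (h.and hb)
  rw [Real.ball_eq_Ioo] at hball
  have hx : x ∈ Ioo (x - ε) (x + ε) := ⟨by linarith, by linarith⟩
  have := ODE_solution_unique_of_mem_Ioo (v := fun t w => m t * w) (s := fun _ => univ)
    (K := (‖m x‖ + 1).toNNReal) (a := x - ε) (b := x + ε) (t₀ := x) (f := W) (g := fun _ => 0)
    (fun t ht => (LipschitzWith.of_dist_le_mul fun w w' => by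
      rw [dist_eq_norm, dist_eq_norm, ← mul_sub, norm_mul, Real.coe_toNNReal _ (by positivity)]
      exact mul_le_mul_of_nonneg_right (hball t ht).2.le (norm_nonneg _)).lipschitzOnWith)
    hx (fun t ht => ⟨(hball t ht).1, trivial⟩)
    (fun t _ => ⟨by simpa using hasDerivAt_const t (0 : ℂ), trivial⟩) h0
  filter_upwards [isOpen_Ioo.mem_nhds hx] with y hy using this hy

section

variable {L : PeriodPair} {ω τ : ℝ} (R : L.IsRect ω τ) {d : ℂ} (hd : d ∉ L.lattice)
include R

/-- A potential is displaced near a point where the logarithmic derivative of the Wronskian has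
the right derivative. -/
lemma displaces_of_wronskian_eq {b₁ b₂ : ℂ} (hb : b₁ ≠ b₂) {u₁ u₂ : ℝ → ℂ}
    (h₁ : Solves (fun x => 6 * wp L τ x - b₁) u₁ (deriv u₁))
    (h₂ : Solves (fun x => 6 * wp L τ x - b₂) u₂ (deriv u₂)) (n₁ : u₁ ≠ 0) (n₂ : u₂ ≠ 0)
    {m : ℝ → ℂ} {c : ℂ} {x : ℝ} (hm : HasDerivAt m c x)
    (hW : ∀ᶠ y in 𝓝 x, (b₁ - b₂) * (u₁ y * u₂ y) = m y * wronskian u₁ u₂ y) :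
    wronskian u₁ u₂ x ≠ 0 ∧
      deriv (fun y : ℝ => deriv (wronskian u₁ u₂) y / wronskian u₁ u₂ y) x = c := by
  have hdW := hasDerivAt_wronskian h₁ h₂
  have hx : wronskian u₁ u₂ x ≠ 0 := fun h0 => by
    have h3 := eventually_eq_zero_of_hasDerivAt hm.continuousAt
      (by filter_upwards [hW] with y hy using hy ▸ hdW y) h0
    -- If `W` vanishes near `x`, so do `u₁u₂` and its derivatives. At `x` all four products of a
    -- value or derivative of `u₁` with one of `u₂` are then zero, so one solution has zero initial
    -- data.
    have h4 : ∀ᶠ y in 𝓝 x, u₁ y * u₂ y = 0 := by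
      filter_upwards [h3, hW] with y hy hy'
      rw [hy, mul_zero] at hy'
      exact (mul_eq_zero.1 hy').resolve_left (sub_ne_zero.2 hb)
    have h5 : ∀ᶠ y in 𝓝 x, deriv u₁ y * u₂ y + u₁ y * deriv u₂ y = 0 := by
      filter_upwards [h4.eventually_nhds] with y hy
      exact ((h₁ y).1.mul (h₂ y).1).unique ((hasDerivAt_const y (0 : ℂ)).congr_of_eventuallyEq hy)
    have h6 := (((h₁ x).2.mul (h₂ x).1).add ((h₁ x).1.mul (h₂ x).2)).unique
      ((hasDerivAt_const x (0 : ℂ)).congr_of_eventuallyEq h5)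
    have h7 := h4.self_of_nhds
    have h8 : deriv u₁ x * deriv u₂ x = 0 := by
      linear_combination h6 / 2 - (12 * wp L τ x - b₁ - b₂) / 2 * h7
    have h9 := h5.self_of_nhds
    rw [wronskian] at h0
    have h10 : u₁ x * deriv u₂ x = 0 := by linear_combination (h0 + h9) / 2
    have h11 : deriv u₁ x * u₂ x = 0 := by linear_combination (h9 - h0) / 2
    obtain ⟨K₁, hK₁⟩ := norm_potential_le R b₁
    obtain ⟨K₂, hK₂⟩ := norm_potential_le R b₂
    have z₁ : ¬ (u₁ x = 0 ∧ deriv u₁ x = 0) := fun h =>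
      n₁ (funext fun y => h₁.eq_zero hK₁ h.1 h.2 y)
    have z₂ : ¬ (u₂ x = 0 ∧ deriv u₂ x = 0) := fun h =>
      n₂ (funext fun y => h₂.eq_zero hK₂ h.1 h.2 y)
    simp only [mul_eq_zero] at h7 h8 h10 h11
    tauto
  refine ⟨hx, ?_⟩
  refine (hm.congr_of_eventuallyEq ?_).deriv
  filter_upwards [hW, (hdW x).continuousAt.eventually_ne hx] with y hy hy'
  rw [(hdW y).deriv, hy, mul_div_cancel_right₀ _ hy']

omit R in
/-- The product of the Bloch solutions, factored. -/
lemma hermite_eq_mul {D b₁ b₂ : ℂ} (hs : b₁ + b₂ = -3 * D)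
    (hδ : (b₁ - b₂) ^ 2 = 9 * (L.g₂ - 3 * D ^ 2)) (x : ℝ) :
    hermite L τ b₁ x = (wp L τ x - D) * (9 * wp L τ x - 3 * b₂) := by
  rw [hermite, blochProd]
  have : b₁ = -3 * D - b₂ := by linear_combination hs
  subst this
  linear_combination hδ / 4

-- The first integral evaluated at the parameter `d`, where `X` vanishes: `P(b₁)` is the square of
-- half the derivative of `X` there. With the chosen sign, the numerator `X'/2 + C` of `u'/u`
-- vanishes where `p = ℘(d)` and `p' = ℘'(d)`.
omit R in
include hd in
lemma sq_eq_spectralPoly {b₁ b₂ : ℂ} (hs : b₁ + b₂ = -3 * L.weierstrassP d)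
    (hδ : (b₁ - b₂) ^ 2 = 9 * (L.g₂ - 3 * L.weierstrassP d ^ 2)) :
    (-(9 * L.weierstrassP d + 3 / 2 * b₁) * L.derivWeierstrassP d) ^ 2 = spectralPoly L b₁ := by
  have h := L.derivWeierstrassP_sq d hd
  have hb : b₂ = -3 * L.weierstrassP d - b₁ := by linear_combination hs
  have hg : L.g₂ = 4 / 9 * (b₁ ^ 2 + 3 * b₁ * L.weierstrassP d + 9 * L.weierstrassP d ^ 2) := by
    rw [hb] at hδ
    linear_combination -hδ / 9
  rw [mul_pow, h, spectralPoly, hg]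
  ring

include hd

/-- The relation between the Wronskian and its derivative, away from a discrete set. -/
lemma wronskian_relation {b₁ b₂ : ℂ} (hs : b₁ + b₂ = -3 * L.weierstrassP d)
    (hδ : (b₁ - b₂) ^ 2 = 9 * (L.g₂ - 3 * L.weierstrassP d ^ 2)) {u₁ u₂ : ℝ → ℂ}
    (h₁ : Solves (fun x => 6 * wp L τ x - b₁) u₁ (deriv u₁))
    (h₂ : Solves (fun x => 6 * wp L τ x - b₂) u₂ (deriv u₂))
    (e₁ : ∀ x, hermite L τ b₁ x * deriv u₁ x = (hermite' L τ b₁ x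
      + -(9 * L.weierstrassP d + 3 / 2 * b₁) * L.derivWeierstrassP d) * u₁ x)
    (e₂ : ∀ x, hermite L τ b₂ x * deriv u₂ x = (hermite' L τ b₂ x
      + -(9 * L.weierstrassP d + 3 / 2 * b₂) * L.derivWeierstrassP d) * u₂ x) (x : ℝ) :
    (wp L τ x - L.weierstrassP d) * ((b₁ - b₂) * (u₁ x * u₂ x)) =
        3 / 2 * (wp' L τ x - L.derivWeierstrassP d) * wronskian u₁ u₂ x ∧
      (wp' L τ x + L.derivWeierstrassP d) * ((b₁ - b₂) * (u₁ x * u₂ x)) =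
        3 / 2 * (4 * (wp L τ x ^ 2 + wp L τ x * L.weierstrassP d + L.weierstrassP d ^ 2) - L.g₂) *
          wronskian u₁ u₂ x := by
  have cp : Continuous (wp L τ) :=
    continuous_iff_continuousAt.2 fun x => (hasDerivAt_wp R x).continuousAt
  have cp' : Continuous (wp' L τ) :=
    continuous_iff_continuousAt.2 fun x => (hasDerivAt_wp' R x).continuousAt
  have cu₁ : Continuous u₁ := continuous_iff_continuousAt.2 fun x => (h₁ x).1.continuousAt
  have cu₂ : Continuous u₂ := continuous_iff_continuousAt.2 fun x => (h₂ x).1.continuousAt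
  have cW : Continuous (wronskian u₁ u₂) :=
    continuous_iff_continuousAt.2 fun x => (hasDerivAt_wronskian h₁ h₂ x).continuousAt
  have cX : ∀ E, Continuous (hermite L τ E) := fun E =>
    continuous_iff_continuousAt.2 fun x => (hasDerivAt_hermite R E x).continuousAt
  set D := L.weierstrassP d with hD
  set D' := L.derivWeierstrassP d with hD'
  -- The eigenvalue equations can be solved for `u₁'` and `u₂'` only where both products are
  -- nonzero; the relations are continuous, so a dense set is enough.
  have dns : Dense ({x : ℝ | hermite L τ b₁ x ≠ 0} ∩ {x : ℝ | hermite L τ b₂ x ≠ 0}) :=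
    (dense_hermite_ne_zero R b₁).inter_of_isOpen_left (dense_hermite_ne_zero R b₂)
      (isOpen_ne.preimage (cX b₁))
  have hdisj : ∀ x ∈ ({x : ℝ | hermite L τ b₁ x ≠ 0} ∩ {x : ℝ | hermite L τ b₂ x ≠ 0}),
      (wp L τ x - D) * ((b₁ - b₂) * (u₁ x * u₂ x)) =
        3 / 2 * (wp' L τ x - D') * wronskian u₁ u₂ x ∧
      (wp' L τ x + D') * ((b₁ - b₂) * (u₁ x * u₂ x)) =
        3 / 2 * (4 * (wp L τ x ^ 2 + wp L τ x * D + D ^ 2) - L.g₂) * wronskian u₁ u₂ x := by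
    rintro x ⟨hx₁, hx₂⟩
    have hx₁ : hermite L τ b₁ x ≠ 0 := hx₁
    have hx₂ : hermite L τ b₂ x ≠ 0 := hx₂
    have f₁ := hermite_eq_mul hs hδ x (τ := τ)
    have f₂ := hermite_eq_mul (b₁ := b₂) (b₂ := b₁) (by rw [add_comm, hs]) (by rw [← hδ]; ring) x
      (τ := τ)
    have g₁ := e₁ x
    have g₂ := e₂ x
    have hsq := wp'_sq_sub R hd x
    rw [← hD, ← hD'] at hsq
    rw [f₁] at g₁ hx₁
    rw [f₂] at g₂ hx₂
    have hpD : wp L τ x - D ≠ 0 := left_ne_zero_of_mul hx₁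
    rw [hermite'] at g₁ g₂
    rw [wronskian]
    have hg : L.g₂ = (b₁ - b₂) ^ 2 / 9 + 3 * D ^ 2 := by linear_combination -hδ / 9
    rw [hg] at hsq ⊢
    have hbb : b₁ = -3 * D - b₂ := by linear_combination hs
    generalize wp L τ x = p at *
    generalize wp' L τ x = p' at *
    generalize deriv u₁ x = v₁ at *
    generalize deriv u₂ x = v₂ at *
    generalize u₁ x = y₁ at *
    generalize u₂ x = y₂ at *
    have key : (p - D) * ((b₁ - b₂) * (y₁ * y₂)) = 3 / 2 * (p' - D') * (y₁ * v₂ - v₁ * y₂) := by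
      apply mul_left_cancel₀ (mul_ne_zero hx₁ hx₂)
      subst hbb
      linear_combination 3 / 2 * (p' - D') * ((p - D) * (9 * p - 3 * (-3 * D - b₂)) * y₂ * g₁
        - (p - D) * (9 * p - 3 * b₂) * y₁ * g₂)
        - 81 / 4 * (p - D) ^ 2 * (-3 * D - b₂ - b₂) * y₁ * y₂ * hsq
    refine ⟨key, ?_⟩
    apply mul_left_cancel₀ hpD
    linear_combination (p' + D') * key + 3 / 2 * (y₁ * v₂ - v₁ * y₂) * hsq
  have hA := Continuous.ext_on dns (f := fun x => (wp L τ x - D) * ((b₁ - b₂) * (u₁ x * u₂ x)))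
    (g := fun x => 3 / 2 * (wp' L τ x - D') * wronskian u₁ u₂ x) (by fun_prop) (by fun_prop)
    fun x hx => (hdisj x hx).1
  have hB := Continuous.ext_on dns (f := fun x => (wp' L τ x + D') * ((b₁ - b₂) * (u₁ x * u₂ x)))
    (g := fun x => 3 / 2 * (4 * (wp L τ x ^ 2 + wp L τ x * D + D ^ 2) - L.g₂) *
      wronskian u₁ u₂ x) (by fun_prop) (by fun_prop) fun x hx => (hdisj x hx).2
  exact ⟨congrFun hA x, congrFun hB x⟩

/-- At a regular point where `℘ (x + i τ) = ℘ (d)` the chord degenerates to a proper tangent. -/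
lemma wp'_add_ne_zero {x : ℝ} (hx : (x : ℂ) + τ * I + d ∉ L.lattice)
    (h : wp L τ x = L.weierstrassP d) : wp' L τ x + L.derivWeierstrassP d ≠ 0 := fun h0 => by
  have hz := R.shifted_notMem x
  -- At a regular point `x + iτ` is congruent to `d`, not to `-d`, so `p' = ℘'(d)` and a vanishing
  -- sum means `p' = 0`. Then `p` is one of the `eᵢ` and `x + iτ` is a half period, which makes `x +
  -- iτ + d` a lattice point after all.
  have hm : d - ((x : ℂ) + τ * I) ∈ L.lattice := by
    rw [wp_eq R] at h
    rcases sub_mem_or_add_mem_of_weierstrassP_eq hz hd h with h | h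
    · rw [← neg_mem_iff, neg_sub]
      exact h
    · exact absurd h hx
  have h1 := derivWeierstrassP_add_mem hm ((x : ℂ) + τ * I)
  rw [add_sub_cancel, ← wp'_eq R] at h1
  have h2 : L.shiftedP' τ x = 0 := by
    rw [h1, wp'] at h0
    have : (L.shiftedP' τ x : ℂ) = 0 := by linear_combination h0 / 2
    exact_mod_cast this
  have key : ∀ h : ℂ, h ∉ L.lattice → 2 * h ∈ L.lattice →
      (L.shiftedP τ x : ℂ) ≠ L.weierstrassP h := fun w hw hw2 he => by
    rw [R.ofReal_shiftedP] at he
    apply hx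
    have h3 : 2 * ((x : ℂ) + τ * I) ∈ L.lattice := by
      rcases sub_mem_or_add_mem_of_weierstrassP_eq hz hw he with h | h
      · convert add_mem (add_mem h h) hw2 using 1
        ring
      · convert sub_mem (add_mem h h) hw2 using 1
        ring
    convert add_mem h3 hm using 1
    ring
  have h3 := R.shiftedP'_sq_eq_prod x
  rw [h2, zero_pow two_ne_zero, eq_comm, mul_eq_zero, mul_eq_zero, mul_eq_zero] at h3
  rcases h3 with ((h3 | h3) | h3) | h3
  · norm_num at h3
  · refine key _ R.ω_notMem R.two_ω_mem ?_
    rw [← R.ofReal_e₁, sub_eq_zero.1 h3]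
  · refine key _ R.corner_notMem (by rw [mul_add]; exact add_mem R.two_ω_mem R.two_τ_mem) ?_
    rw [← R.ofReal_e₂, sub_eq_zero.1 h3]
  · refine key _ R.τ_notMem R.two_τ_mem ?_
    rw [← R.ofReal_e₃, sub_eq_zero.1 h3]

/-- Near every regular point, the coefficient `m = 3 ℓ` in terms of the slope, or of its second
representation where `℘ (x + i τ) = ℘ (d)`. -/
lemma exists_slope_near {x : ℝ} (hx : (x : ℂ) + τ * I + d ∉ L.lattice) :
    ∃ m : ℝ → ℂ, HasDerivAt m (wp L τ x - displaced L τ d x) x ∧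
      ∀ᶠ y in 𝓝 x, ∀ A B : ℂ,
        (wp L τ y - L.weierstrassP d) * A = 3 / 2 * (wp' L τ y - L.derivWeierstrassP d) * B →
        (wp' L τ y + L.derivWeierstrassP d) * A =
          3 / 2 * (4 * (wp L τ y ^ 2 + wp L τ y * L.weierstrassP d + L.weierstrassP d ^ 2)
            - L.g₂) * B → A = 3 * m y * B := by
  by_cases h : wp L τ x = L.weierstrassP d
  · have h1 := wp'_add_ne_zero R hd hx h
    set N : ℝ → ℂ := fun y =>
      4 * (wp L τ y ^ 2 + wp L τ y * L.weierstrassP d + L.weierstrassP d ^ 2) - L.g₂ with hN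
    -- The chord slope multiplied above and below by `p' + ℘'(d)`, with `p - ℘(d)` cancelled: this
    -- form remains regular where the chord becomes a tangent.
    set m : ℝ → ℂ := fun y => N y / (2 * (wp' L τ y + L.derivWeierstrassP d)) with hm
    have hp := hasDerivAt_wp R x
    have hp' := hasDerivAt_wp' R x
    have hev : ∀ᶠ y in 𝓝 x, wp' L τ y + L.derivWeierstrassP d ≠ 0 :=
      (hp'.continuousAt.add continuousAt_const).eventually_ne h1
    have hd1 : HasDerivAt m (2 * wp L τ x + L.weierstrassP d - m x ^ 2) x := by
      have hsq := wp'_sq_sub R hd x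
      have hNd : HasDerivAt N (4 * (2 * wp L τ x + L.weierstrassP d) * wp' L τ x) x := by
        refine ((((hp.pow 2).add (hp.mul_const _)).add_const _).const_mul 4).sub_const _
          |>.congr_deriv ?_
        norm_num
        ring
      refine (hNd.div ((hp'.add_const (L.derivWeierstrassP d)).const_mul 2) (by simpa using h1))
        |>.congr_deriv ?_
      rw [hm]
      simp only
      have hNx : N x = 4 * (wp L τ x ^ 2 + wp L τ x * L.weierstrassP d + L.weierstrassP d ^ 2)
        - L.g₂ := rfl
      have h2 : (2 * (wp' L τ x + L.derivWeierstrassP d)) ^ 2 ≠ 0 :=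
        pow_ne_zero 2 (mul_ne_zero two_ne_zero h1)
      rw [div_pow, eq_sub_iff_add_eq, ← add_div, div_eq_iff h2, hNx]
      linear_combination 4 * (2 * wp L τ x + L.weierstrassP d) * hsq
    refine ⟨m, hd1.congr_deriv ?_, ?_⟩
    · have : m x ^ 2 = wp L τ x + L.weierstrassP d + displaced L τ d x := by
        -- The addition formula for `m²` holds at nearby points where `m` is the chord slope, and
        -- passes to the limit.
        have hfr : ∃ᶠ y in 𝓝 x, m y ^ 2 - wp L τ y - displaced L τ d y = L.weierstrassP d := by
          have := ((countable_wp_eq R (L.weierstrassP d)).dense_compl ℝ)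
          have := mem_closure_iff_frequently.1 (this x)
          refine (this.and_eventually (hev.and (eventually_add_notMem hx))).mono ?_
          rintro y ⟨y1, y2, y3⟩
          have y1 : wp L τ y ≠ L.weierstrassP d := y1
          have : m y = slope L τ d y := by
            have hsm := slope_mul R y1
            have hsq := wp'_sq_sub R hd y
            rw [hm]
            simp only
            rw [div_eq_iff (mul_ne_zero two_ne_zero y2)]
            apply mul_left_cancel₀ (sub_ne_zero.2 y1)
            rw [hN]
            linear_combination -hsq - (wp' L τ y + L.derivWeierstrassP d) * hsm
          rw [this, slope_sq R hd y1 y3]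
          ring
        have hc : ContinuousAt (fun y => m y ^ 2 - wp L τ y - displaced L τ d y) x :=
          ((hd1.continuousAt.pow 2).sub hp.continuousAt).sub (hasDerivAt_displaced hx).continuousAt
        have := isClosed_singleton.mem_of_frequently_of_tendsto
          (hfr : ∃ᶠ y in 𝓝 x, m y ^ 2 - wp L τ y - displaced L τ d y ∈ {L.weierstrassP d}) hc
        simp only [mem_singleton_iff] at this
        linear_combination this
      rw [this]
      ring
    · filter_upwards [hev] with y hy A B hA hB
      rw [hm]
      simp only
      field_simp
      linear_combination 2 * hB
  · refine ⟨slope L τ d, (hasDerivAt_slope R hd h).congr_deriv ?_, ?_⟩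
    · rw [slope_sq R hd h hx]
      ring
    · filter_upwards [(hasDerivAt_wp R x).continuousAt.eventually_ne h] with y hy A B hA hB
      apply mul_left_cancel₀ (sub_ne_zero.2 hy)
      rw [hA, ← slope_mul R hy]
      ring

/-- The factorization constants producing a displacement. -/
theorem areFactorizationConstants_iff (b₁ b₂ : ℂ) :
    AreFactorizationConstants (lameInce L) (2 * ω) d b₁ b₂ ↔
      b₁ ≠ b₂ ∧ ((b₁ = factorConst₁ L d ∧ b₂ = factorConst₂ L d) ∨
        (b₁ = factorConst₂ L d ∧ b₂ = factorConst₁ L d)) := by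
  rw [← sum_diff_iff]
  constructor
  · rintro ⟨β₁, β₂, u₁, u₂, ⟨h₁, -⟩, ⟨h₂, -⟩, h⟩
    obtain ⟨a, b, hab, hreg⟩ := exists_regular_interval R d
    refine sum_and_diff_of_displacement R hd hab hreg ((isSolution_iff R).1 h₁)
      ((isSolution_iff R).1 h₂) fun x hx => ?_
    have := h x ((analyticAt_lameInce_iff R).2 (hreg x hx).2)
    rwa [lameInce_eq R, lameInce_add R] at this
  · rintro ⟨hb, hs, hδ⟩
    have hs' : b₂ + b₁ = -3 * L.weierstrassP d := by rw [add_comm, hs]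
    have hδ' : (b₂ - b₁) ^ 2 = 9 * (L.g₂ - 3 * L.weierstrassP d ^ 2) := by rw [← hδ]; ring
    -- Both eigenvalues of `M` are taken with the same sign convention relative to `℘'(d)`; the
    -- Wronskian relation depends on this.
    obtain ⟨β₁, u₁, B₁, h₁, e₁⟩ := exists_bloch_eigenvector R (sq_eq_spectralPoly hd hs hδ)
    obtain ⟨β₂, u₂, B₂, h₂, e₂⟩ := exists_bloch_eigenvector R (sq_eq_spectralPoly hd hs' hδ')
    refine ⟨β₁, β₂, u₁, u₂, B₁, B₂, fun x hx => ?_⟩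
    rw [lameInce_eq R, lameInce_add R]
    obtain ⟨m, hm, hev⟩ := exists_slope_near R hd ((analyticAt_lameInce_iff R).1 hx)
    have := displaces_of_wronskian_eq R hb h₁ h₂ B₁.2.1 B₂.2.1 (hm.const_mul 3) (by
      filter_upwards [hev] with y hy
      obtain ⟨k1, k2⟩ := wronskian_relation R hd hs hδ h₁ h₂ e₁ e₂ y
      exact hy _ _ k1 k2)
    refine ⟨this.1, ?_⟩
    rw [this.2]
    ring

end

end DarbouxDisplacement

end

/-! ### Half-period displacements and stationary values. -/

noncomputable section

namespace DarbouxDisplacement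

open Set Filter Topology PeriodPair PeriodPair.IsRect

/-- The values of `a₁` and `a₂` where the radicand is the square of a positive number. -/
lemma factorConst_eq {L : PeriodPair} {d : ℂ} {r : ℝ} (hr : 0 < r)
    (h : L.g₂ - 3 * L.weierstrassP d ^ 2 = (r : ℂ) ^ 2) :
    factorConst₁ L d = -(3 / 2) * (L.weierstrassP d - r) ∧
      factorConst₂ L d = -(3 / 2) * (L.weierstrassP d + r) := by
  rw [factorConst₁, factorConst₂, h, one_div, sq_cpow_two_inv (by simpa using hr)]
  exact ⟨rfl, rfl⟩

/-- The derivatives of `a₁` and `a₂` where the radicand is the square of a positive number. -/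
lemma hasDerivAt_factorConst {L : PeriodPair} {d : ℂ} (hd : d ∉ L.lattice) {r : ℝ} (hr : 0 < r)
    (h : L.g₂ - 3 * L.weierstrassP d ^ 2 = (r : ℂ) ^ 2) :
    HasDerivAt (factorConst₁ L)
        (-(3 / 2) * (1 + 3 * L.weierstrassP d / r) * L.derivWeierstrassP d) d ∧
      HasDerivAt (factorConst₂ L)
        (-(3 / 2) * (1 - 3 * L.weierstrassP d / r) * L.derivWeierstrassP d) d := by
  have hP := hasDerivAt_weierstrassP hd
  have hr' : (r : ℂ) ≠ 0 := by exact_mod_cast hr.ne'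
  have hslit : L.g₂ - 3 * L.weierstrassP d ^ 2 ∈ slitPlane := by
    rw [h]
    left
    rw [← ofReal_pow, ofReal_re]
    positivity
  have hS : HasDerivAt (fun z => (L.g₂ - 3 * L.weierstrassP z ^ 2) ^ (1 / 2 : ℂ))
      (-3 * L.weierstrassP d / r * L.derivWeierstrassP d) d := by
    refine ((((hP.fun_pow 2).const_mul 3).const_sub L.g₂).cpow_const (c := 1 / 2)
      hslit).congr_deriv ?_
    rw [h, cpow_sub _ _ (pow_ne_zero 2 hr'), cpow_one, one_div,
      sq_cpow_two_inv (by simpa using hr)]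
    field_simp
    norm_num
    ring
  constructor
  · refine ((hP.fun_sub hS).const_mul (-(3 / 2))).congr_deriv ?_
    ring
  · refine ((hP.fun_add hS).const_mul (-(3 / 2))).congr_deriv ?_
    ring

section

variable {L : PeriodPair} {ω τ : ℝ} (R : L.IsRect ω τ)
include R

lemma factorConst_ω : factorConst₁ L ω = ((3 * L.e₂ ω τ : ℝ) : ℂ) ∧
    factorConst₂ L ω = ((3 * L.e₃ τ : ℝ) : ℂ) := by
  have h0 := R.vieta.1
  have h := factorConst_eq (L := L) (d := ω) (r := L.e₂ ω τ - L.e₃ τ) (by linarith [R.e₃_lt_e₂]) (by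
    rw [← R.ofReal_e₁, ← R.ofReal_g₂, g₂_eq_of_e₁ R]
    push_cast
    ring)
  rw [h.1, h.2, ← R.ofReal_e₁]
  have h0' : (L.e₁ ω + L.e₂ ω τ + L.e₃ τ : ℂ) = 0 := by exact_mod_cast h0
  push_cast
  constructor <;> linear_combination -(3 / 2) * h0'

lemma factorConst_corner : factorConst₁ L (ω + τ * I) = ((3 * L.e₁ ω : ℝ) : ℂ) ∧
    factorConst₂ L (ω + τ * I) = ((3 * L.e₃ τ : ℝ) : ℂ) := by
  have h0 := R.vieta.1
  have h := factorConst_eq (L := L) (d := ω + τ * I) (r := L.e₁ ω - L.e₃ τ)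
    (by linarith [R.e₃_lt_e₂, R.e₂_lt_e₁]) (by
    rw [← R.ofReal_e₂, ← R.ofReal_g₂, g₂_eq_of_e₂ R]
    push_cast
    ring)
  rw [h.1, h.2, ← R.ofReal_e₂]
  have h0' : (L.e₁ ω + L.e₂ ω τ + L.e₃ τ : ℂ) = 0 := by exact_mod_cast h0
  push_cast
  constructor <;> linear_combination -(3 / 2) * h0'

lemma factorConst_τ : factorConst₁ L (τ * I) = ((3 * L.e₁ ω : ℝ) : ℂ) ∧
    factorConst₂ L (τ * I) = ((3 * L.e₂ ω τ : ℝ) : ℂ) := by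
  have h0 := R.vieta.1
  have h := factorConst_eq (L := L) (d := τ * I) (r := L.e₁ ω - L.e₂ ω τ)
    (by linarith [R.e₂_lt_e₁]) (by
    rw [← R.ofReal_e₃, ← R.ofReal_g₂, g₂_eq_of_e₃ R]
    push_cast
    ring)
  rw [h.1, h.2, ← R.ofReal_e₃]
  have h0' : (L.e₁ ω + L.e₂ ω τ + L.e₃ τ : ℂ) = 0 := by exact_mod_cast h0
  push_cast
  constructor <;> linear_combination -(3 / 2) * h0'

lemma areFactorizationConstants_of_factorConst {d : ℂ} (hd : d ∉ L.lattice) {b₁ b₂ : ℝ}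
    (hb : b₂ < b₁) (h : factorConst₁ L d = b₁ ∧ factorConst₂ L d = b₂) :
    AreFactorizationConstants (lameInce L) (2 * ω) d b₁ b₂ :=
  (areFactorizationConstants_iff R hd _ _).2
    ⟨by exact_mod_cast hb.ne', Or.inl ⟨h.1.symm, h.2.symm⟩⟩

/-- The position of `√(3 g₂) / 6` relative to `e₁`, `e₂`, `e₃`. -/
lemma sqrt_g₂_bounds : L.e₃ τ ≤ -(√(3 * L.g₂.re) / 6) ∧ -(√(3 * L.g₂.re) / 6) ≤ L.e₂ ω τ ∧
    L.e₂ ω τ ≤ √(3 * L.g₂.re) / 6 ∧ √(3 * L.g₂.re) / 6 ≤ L.e₁ ω := by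
  have h0 := R.vieta.1
  have h32 := R.e₃_lt_e₂
  have h21 := R.e₂_lt_e₁
  have u3 : √(3 * L.g₂.re) ≤ -6 * L.e₃ τ := by
    rw [Real.sqrt_le_iff, g₂_eq_of_e₃ R]
    constructor
    · linarith
    · nlinarith [mul_nonneg (show 0 ≤ L.e₂ ω τ - L.e₃ τ by linarith)
        (show 0 ≤ L.e₁ ω - L.e₃ τ by linarith)]
  have u1 : √(3 * L.g₂.re) ≤ 6 * L.e₁ ω := by
    rw [Real.sqrt_le_iff, g₂_eq_of_e₁ R]
    constructor
    · linarith
    · nlinarith [mul_nonneg (show 0 ≤ L.e₁ ω - L.e₂ ω τ by linarith)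
        (show 0 ≤ L.e₁ ω - L.e₃ τ by linarith)]
  have u2 : |6 * L.e₂ ω τ| ≤ √(3 * L.g₂.re) := by
    refine Real.abs_le_sqrt ?_
    rw [g₂_eq_of_e₂ R]
    nlinarith [mul_nonneg (show 0 ≤ L.e₂ ω τ - L.e₃ τ by linarith)
      (show 0 ≤ L.e₁ ω - L.e₂ ω τ by linarith)]
  rw [abs_le] at u2
  refine ⟨by linarith, by linarith [u2.1], by linarith [u2.2], by linarith⟩

lemma exists_stationary_factorConst₁ : ∃ d : ℂ, d ∉ L.lattice ∧
    factorConst₁ L d = ((√(3 * L.g₂.re) : ℝ) : ℂ) ∧ HasDerivAt (factorConst₁ L) 0 d := by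
  obtain ⟨b1, b2, -, -⟩ := sqrt_g₂_bounds R
  have hG := sqrt_g₂_pos R
  have hG2 := sq_sqrt_g₂ R
  have hg := R.ofReal_g₂
  -- The derivative of `a₁` contains the factor `1 + 3℘/r`, where `r` is the square root. For `℘ =
  -- -√(3g₂)/6` one gets `r = √(3g₂)/2`, so the factor vanishes; this value is attained on the line
  -- `ℝ + iτ`.
  obtain ⟨x, -, hx⟩ := R.exists_shiftedP_eq b1 b2
  have hP := R.ofReal_shiftedP x
  rw [hx] at hP
  generalize √(3 * L.g₂.re) = G at *
  have hr : L.g₂ - 3 * L.weierstrassP (x + τ * I) ^ 2 = ((G / 2 : ℝ) : ℂ) ^ 2 := by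
    rw [← hP, ← hg, show L.g₂.re = G ^ 2 / 3 by linarith]
    push_cast
    ring
  have hG' : (G : ℂ) ≠ 0 := by exact_mod_cast hG.ne'
  refine ⟨x + τ * I, R.shifted_notMem x, ?_, ?_⟩
  · rw [(factorConst_eq (by linarith) hr).1, ← hP]
    push_cast
    ring
  · refine (hasDerivAt_factorConst (R.shifted_notMem x) (by linarith) hr).1.congr_deriv ?_
    rw [← hP]
    push_cast
    field_simp
    norm_num

lemma exists_stationary_factorConst₂ : ∃ d : ℂ, d ∉ L.lattice ∧
    factorConst₂ L d = ((-√(3 * L.g₂.re) : ℝ) : ℂ) ∧ HasDerivAt (factorConst₂ L) 0 d := by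
  obtain ⟨-, -, b1, b2⟩ := sqrt_g₂_bounds R
  have hG := sqrt_g₂_pos R
  have hG2 := sq_sqrt_g₂ R
  have hg := R.ofReal_g₂
  -- For `a₂` the factor is `1 - 3℘/r`, so `℘ = √(3g₂)/6`, which lies between `e₂` and `e₁` and is
  -- attained on the vertical through `ω`.
  obtain ⟨y, hP⟩ := R.exists_vertical_eq b1 b2
  generalize √(3 * L.g₂.re) = G at *
  have hr : L.g₂ - 3 * L.weierstrassP (ω + y * I) ^ 2 = ((G / 2 : ℝ) : ℂ) ^ 2 := by
    rw [hP, ← hg, show L.g₂.re = G ^ 2 / 3 by linarith]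
    push_cast
    ring
  have hG' : (G : ℂ) ≠ 0 := by exact_mod_cast hG.ne'
  refine ⟨ω + y * I, R.vertical_notMem y, ?_, ?_⟩
  · rw [(factorConst_eq (by linarith) hr).2, hP]
    push_cast
    ring
  · refine (hasDerivAt_factorConst (R.vertical_notMem y) (by linarith) hr).2.congr_deriv ?_
    rw [hP]
    push_cast
    field_simp
    norm_num

end

end DarbouxDisplacement

end

theorem corollary2 (L : PeriodPair) (ω τ : ℝ) (hω : 0 < ω) (hτ : 0 < τ)
    (hL₁ : L.ω₁ = 2 * (ω : ℂ)) (hL₂ : L.ω₂ = 2 * ((τ : ℂ) * Complex.I)) :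
    ∃ e₁ e₂ e₃ g₂ : ℝ,
      -- the real numbers `e₁ = ℘ (ω)`, `e₂ = ℘ (ω + ω')`, `e₃ = ℘ (ω')` and the invariant `g₂`
      (e₁ : ℂ) = L.weierstrassP ω ∧
      (e₂ : ℂ) = L.weierstrassP (ω + τ * Complex.I) ∧
      (e₃ : ℂ) = L.weierstrassP (τ * Complex.I) ∧
      (g₂ : ℂ) = L.g₂ ∧
      -- the five band edges, in increasing order
      DarbouxDisplacement.bandEdges (DarbouxDisplacement.lameInce L) (2 * ω) =
        {-√(3 * g₂), 3 * e₃, 3 * e₂, 3 * e₁, √(3 * g₂)} ∧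
      -√(3 * g₂) < 3 * e₃ ∧ 3 * e₃ < 3 * e₂ ∧ 3 * e₂ < 3 * e₁ ∧ 3 * e₁ < √(3 * g₂) ∧
      -- `a₁ (d)`, `a₂ (d)` are, up to their order, the factorization constants producing `d`
      (∀ d : ℂ, d ∉ L.lattice → ∀ b₁ b₂ : ℂ,
        (DarbouxDisplacement.AreFactorizationConstants
            (DarbouxDisplacement.lameInce L) (2 * ω) d b₁ b₂ ↔
          b₁ ≠ b₂ ∧
            ((b₁ = DarbouxDisplacement.factorConst₁ L d ∧
                b₂ = DarbouxDisplacement.factorConst₂ L d) ∨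
              (b₁ = DarbouxDisplacement.factorConst₂ L d ∧
                b₂ = DarbouxDisplacement.factorConst₁ L d)))) ∧
      -- the displacement `d = ω`
      (DarbouxDisplacement.factorConst₁ L ω = ((3 * e₂ : ℝ) : ℂ) ∧
        DarbouxDisplacement.factorConst₂ L ω = ((3 * e₃ : ℝ) : ℂ) ∧
        DarbouxDisplacement.AreFactorizationConstants (DarbouxDisplacement.lameInce L) (2 * ω)
          ω ((3 * e₂ : ℝ) : ℂ) ((3 * e₃ : ℝ) : ℂ)) ∧
      -- the displacement `d = ω + ω'`
      (DarbouxDisplacement.factorConst₁ L (ω + τ * Complex.I) = ((3 * e₁ : ℝ) : ℂ) ∧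
        DarbouxDisplacement.factorConst₂ L (ω + τ * Complex.I) = ((3 * e₃ : ℝ) : ℂ) ∧
        DarbouxDisplacement.AreFactorizationConstants (DarbouxDisplacement.lameInce L) (2 * ω)
          (ω + τ * Complex.I) ((3 * e₁ : ℝ) : ℂ) ((3 * e₃ : ℝ) : ℂ)) ∧
      -- the displacement `d = ω'`
      (DarbouxDisplacement.factorConst₁ L (τ * Complex.I) = ((3 * e₁ : ℝ) : ℂ) ∧
        DarbouxDisplacement.factorConst₂ L (τ * Complex.I) = ((3 * e₂ : ℝ) : ℂ) ∧
        DarbouxDisplacement.AreFactorizationConstants (DarbouxDisplacement.lameInce L) (2 * ω)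
          (τ * Complex.I) ((3 * e₁ : ℝ) : ℂ) ((3 * e₂ : ℝ) : ℂ)) ∧
      -- the highest and the lowest band edge are stationary values of `a₁` and of `a₂`
      (∃ d : ℂ, d ∉ L.lattice ∧
        DarbouxDisplacement.factorConst₁ L d = ((√(3 * g₂) : ℝ) : ℂ) ∧
        HasDerivAt (DarbouxDisplacement.factorConst₁ L) 0 d) ∧
      (∃ d : ℂ, d ∉ L.lattice ∧
        DarbouxDisplacement.factorConst₂ L d = ((-√(3 * g₂) : ℝ) : ℂ) ∧
        HasDerivAt (DarbouxDisplacement.factorConst₂ L) 0 d) := by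
  have R : L.IsRect ω τ := ⟨hω, hτ, hL₁, hL₂⟩
  have h32 := R.e₃_lt_e₂
  have h21 := R.e₂_lt_e₁
  have hω' := DarbouxDisplacement.factorConst_ω R
  have hc := DarbouxDisplacement.factorConst_corner R
  have hτ' := DarbouxDisplacement.factorConst_τ R
  exact ⟨L.e₁ ω, L.e₂ ω τ, L.e₃ τ, L.g₂.re, R.ofReal_e₁, R.ofReal_e₂, R.ofReal_e₃, R.ofReal_g₂,
    DarbouxDisplacement.bandEdges_lameInce R, DarbouxDisplacement.neg_sqrt_lt_e₃ R, by linarith,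
    by linarith, DarbouxDisplacement.e₁_lt_sqrt R,
    fun d hd b₁ b₂ => DarbouxDisplacement.areFactorizationConstants_iff R hd b₁ b₂,
    ⟨hω'.1, hω'.2, DarbouxDisplacement.areFactorizationConstants_of_factorConst R R.ω_notMem
      (by linarith) hω'⟩,
    ⟨hc.1, hc.2, DarbouxDisplacement.areFactorizationConstants_of_factorConst R R.corner_notMem
      (by linarith) hc⟩,
    ⟨hτ'.1, hτ'.2, DarbouxDisplacement.areFactorizationConstants_of_factorConst R R.τ_notMem
      (by linarith) hτ'⟩,
    DarbouxDisplacement.exists_stationary_factorConst₁ R,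
    DarbouxDisplacement.exists_stationary_factorConst₂ R⟩
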